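/- Let $X$ and $X'$ be non-singular irreducible complex projective varieties, of dimensions $n$ and $n'$, and let $X$ have positive Kodaira dimension. For an integer $k\ge 1$ let $H^0(X,kK_X)$ be the space of holomorphic pluricanonical forms of level $k$, that is, the holomorphic sections of $K_X^{\otimes k}$, which in local holomorphic coordinates are written $s(z)\,(dz_1\wedge\cdots\wedge dz_n)^{\otimes k}$, and let $N_k(X)=\dim H^0(X,kK_X)$. (The Kodaira dimension of $X$ is $-\infty$ if $N_k(X)=0$ for all $k\ge1$, and otherwise the smallest integer $\kappa\ge0$ with $N_k(X)=O(k^\kappa)$.) For a basis $s_1,\dots,s_N$ of $H^0(X,kK_X)$, $N=N_k(X)$, the local densities $$\bigl|\det\bigl(s_i(z_j)\bigr)_{i,j=1}^{N}\bigr|^{2/k}\,dV(z_1)\cdots dV(z_N),$$ where $dV$ is Lebesgue measure in the local holomorphic coordinates, glue to a Borel measure on $X^{N}$; let $Z$ be its total mass and let $$\mu_X^{(N)}=\frac1Z\,\bigl|\det\bigl(s_i(z_j)\bigr)\bigr|^{2/k}\,dV(z_1)\cdots dV(z_N)$$ be the canonical measure on $X^N$ computed with this basis. Proposition. Let $F:X\dashrightarrow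 X'$ be a birational map and let $k\ge1$. Then $H^0(X,kK_X)$ and $H^0(X',kK_{X'})$ are finite-dimensional of the same dimension $N=N_k(X)=N_k(X')$, and, for any choice of bases of these two spaces, the canonical measures $\mu_X^{(N)}$ on $X^{N}$ and $\mu_{X'}^{(N)}$ on $X'^{N}$ are probability measures and $$F_*\,\mu_X^{(N)}=\mu_{X'}^{(N)}.$$ Here $F_*\mu$ denotes the push-forward of the restriction of $\mu$ to $U^N$ under the map $(x_1,\dots,x_N)\mapsto (F(x_1),\dots,F(x_N))$, where $U\subset X$ is any nonempty Zariski open subset on which $F$ is defined as a morphism. -/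

import Mathlib

open MeasureTheory Topology Set Filter
open scoped Manifold ContDiff ENNReal LinearAlgebra.Projectivization

noncomputable section

namespace CanonicalPointProcess

/-! ### Complex projective varieties and rational maps -/

/-- A Zariski closed subset of complex projective space `ℙ^M`: the common zero set of a set of
homogeneous polynomials in `M + 1` variables. -/
def IsZariskiClosed {M : ℕ} (Z : Set (ℙ ℂ (Fin (M + 1) → ℂ))) : Prop :=
  ∃ S : Set (MvPolynomial (Fin (M + 1)) ℂ),
    (∀ f ∈ S, ∃ d : ℕ, f.IsHomogeneous d) ∧
    Z = {p | ∀ f ∈ S, MvPolynomial.eval p.rep f = 0}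

/-- Let `X` be a complex manifold of dimension `n`. The map `emb : X → ℙ^M` is a projective
embedding if it is an injective holomorphic immersion whose image is Zariski closed. A compact
connected complex manifold with such an embedding is the same thing as a non-singular
(irreducible) complex projective variety.

Holomorphy and immersivity are expressed by local holomorphic lifts `φ` of `emb` to
`ℂ^(M+1) \ {0}`: the differential of `[φ]` at `x` is injective iff no nonzero tangent vector is
mapped by `dφ` into the line spanned by `φ x`. -/
structure IsProjectiveEmbedding (n : ℕ) {M : ℕ} {X : Type*} [TopologicalSpace X]
    [ChartedSpace (Fin n → ℂ) X] (emb : X → ℙ ℂ (Fin (M + 1) → ℂ)) : Prop where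
  injective : Function.Injective emb
  isZariskiClosed_range : IsZariskiClosed (range emb)
  exists_lift : ∀ x : X, ∃ φ : X → (Fin (M + 1) → ℂ),
    ContMDiffAt 𝓘(ℂ, Fin n → ℂ) 𝓘(ℂ, Fin (M + 1) → ℂ) ω φ x ∧
    (∀ᶠ y in 𝓝 x, ∃ h : φ y ≠ 0, emb y = Projectivization.mk ℂ (φ y) h) ∧
    ∀ (v : TangentSpace 𝓘(ℂ, Fin n → ℂ) x) (c : ℂ),
      mfderiv 𝓘(ℂ, Fin n → ℂ) 𝓘(ℂ, Fin (M + 1) → ℂ) φ x v = c • φ x → v = 0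

/-- Zariski open subsets of a projective variety `X ⊆ ℙ^M`. -/
def IsZariskiOpen {M : ℕ} {X : Type*} (emb : X → ℙ ℂ (Fin (M + 1) → ℂ)) (U : Set X) : Prop :=
  ∃ Z : Set (ℙ ℂ (Fin (M + 1) → ℂ)), IsZariskiClosed Z ∧ U = emb ⁻¹' Zᶜ

/-- `f` is a morphism of varieties on the subset `U` of `X ⊆ ℙ^M`, with values in `X' ⊆ ℙ^M'`:
Zariski locally on `U` it is given by homogeneous polynomials of the same degree without common
zeros. -/
def IsRegularOn {M M' : ℕ} {X X' : Type*} (emb : X → ℙ ℂ (Fin (M + 1) → ℂ))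
    (emb' : X' → ℙ ℂ (Fin (M' + 1) → ℂ)) (f : X → X') (U : Set X) : Prop :=
  ∀ x ∈ U, ∃ W : Set X, IsZariskiOpen emb W ∧ x ∈ W ∧ W ⊆ U ∧
    ∃ (d : ℕ) (p : Fin (M' + 1) → MvPolynomial (Fin (M + 1)) ℂ),
      (∀ j, (p j).IsHomogeneous d) ∧
      ∀ y ∈ W, ∃ h : (fun j => MvPolynomial.eval (emb y).rep (p j)) ≠ 0,
        emb' (f y) = Projectivization.mk ℂ (fun j => MvPolynomial.eval (emb y).rep (p j)) h

/-- A rational map `X ⇢ X'` (for irreducible `X`), given by a morphism on a nonempty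
Zariski open subset `domain` of `X`. The values of `toFun` outside `domain` carry no meaning. -/
structure RationalMap {M M' : ℕ} {X X' : Type*} (emb : X → ℙ ℂ (Fin (M + 1) → ℂ))
    (emb' : X' → ℙ ℂ (Fin (M' + 1) → ℂ)) where
  toFun : X → X'
  domain : Set X
  isZariskiOpen_domain : IsZariskiOpen emb domain
  nonempty_domain : domain.Nonempty
  isRegularOn : IsRegularOn emb emb' toFun domain

/-- A rational map `F` is birational if it has an inverse: a rational map `G` such that both
composites are defined somewhere, and are the identity wherever they are defined. -/
def RationalMap.IsBirational {M M' : ℕ} {X X' : Type*} {emb : X → ℙ ℂ (Fin (M + 1) → ℂ)}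
    {emb' : X' → ℙ ℂ (Fin (M' + 1) → ℂ)} (F : RationalMap emb emb') : Prop :=
  ∃ G : RationalMap emb' emb,
    (∃ x ∈ F.domain, F.toFun x ∈ G.domain) ∧
    (∃ y ∈ G.domain, G.toFun y ∈ F.domain) ∧
    (∀ x ∈ F.domain, F.toFun x ∈ G.domain → G.toFun (F.toFun x) = x) ∧
    (∀ y ∈ G.domain, G.toFun y ∈ F.domain → F.toFun (G.toFun y) = y)

/-- The push-forward `F_* μ` of a measure `μ` on `X^N` under the rational map
`X^N ⇢ X'^N` induced by `F : X ⇢ X'`: restrict `μ` to the Zariski open subset `domain^N`, where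
the map is defined, and push forward. -/
def RationalMap.pushforward {M M' N : ℕ} {X X' : Type*} [MeasurableSpace X] [MeasurableSpace X']
    {emb : X → ℙ ℂ (Fin (M + 1) → ℂ)} {emb' : X' → ℙ ℂ (Fin (M' + 1) → ℂ)}
    (F : RationalMap emb emb') (μ : Measure (Fin N → X)) : Measure (Fin N → X') :=
  (μ.restrict {x | ∀ j, x j ∈ F.domain}).map (fun x j => F.toFun (x j))

/-! ### Pluricanonical forms -/

section Forms

variable (n : ℕ) (X : Type*) [TopologicalSpace X] [ChartedSpace (Fin n → ℂ) X]

/-- The space `H⁰(X, k K_X)` of holomorphic pluricanonical forms of level `k`. A form `s` is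
given by its coefficients `s e` in the charts `e` of `X`, that is
`s = s_e(z) (dz₁ ∧ ⋯ ∧ dz_n)^{⊗ k}` on `e.source`, where `s_e` is holomorphic on `e.target` and
the coefficients obey the transformation rule of `(K_X)^{⊗ k}`. Outside `e.target` the
function `s e` is set to zero, so that it is determined by the form. -/
def pluricanonicalForms (k : ℕ) :
    Submodule ℂ (atlas (Fin n → ℂ) X → (Fin n → ℂ) → ℂ) where
  carrier := {s |
    (∀ e, DifferentiableOn ℂ (s e) e.1.target) ∧
    (∀ e, ∀ z ∉ e.1.target, s e z = 0) ∧
    (∀ e e', ∀ x ∈ e.1.source ∩ e'.1.source,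
      s e (e.1 x) = s e' (e'.1 x) * (fderiv ℂ (e'.1 ∘ e.1.symm) (e.1 x)).det ^ k)}
  add_mem' := by
    rintro s t ⟨hs1, hs2, hs3⟩ ⟨ht1, ht2, ht3⟩
    refine ⟨fun e => (hs1 e).add (ht1 e), fun e z hz => ?_, fun e e' x hx => ?_⟩
    · simp [hs2 e z hz, ht2 e z hz]
    · simp [hs3 e e' x hx, ht3 e e' x hx, add_mul]
  zero_mem' := by
    refine ⟨fun e => differentiableOn_const 0, fun e z _ => rfl, fun e e' x _ => ?_⟩
    simp
  smul_mem' := by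
    rintro c s ⟨hs1, hs2, hs3⟩
    refine ⟨fun e => (hs1 e).const_smul c, fun e z hz => ?_, fun e e' x hx => ?_⟩
    · simp [hs2 e z hz]
    · simp [hs3 e e' x hx, mul_assoc]

/-- The `k`-th plurigenus `N_k = dim H⁰(X, k K_X)`. -/
def plurigenus (k : ℕ) : ℕ := Module.finrank ℂ (pluricanonicalForms n X k)

open Classical in
/-- The Kodaira dimension of `X`: it is `-∞` (written `⊥`) if all plurigenera `N_k`, `k ≥ 1`,
vanish, and otherwise the smallest natural number `κ` with `N_k = O(k^κ)`. -/
def kodairaDimension : WithBot ℕ :=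
  if ∀ k : ℕ, 1 ≤ k → plurigenus n X k = 0 then ⊥
  else ((sInf {κ : ℕ | (fun k : ℕ => (plurigenus n X k : ℝ)) =O[atTop]
    (fun k : ℕ => (k : ℝ) ^ κ)} : ℕ) : WithBot ℕ)

end Forms

/-! ### The canonical measures -/

section Measures

variable {n : ℕ} {X : Type*} [TopologicalSpace X] [ChartedSpace (Fin n → ℂ) X]
  [MeasurableSpace X] {k N : ℕ}

/-- The expression `|det (s_i(z_j))|^{2/k} dz₁ ∧ dz̄₁ ∧ ⋯ ∧ dz_N ∧ dz̄_N` in the product chart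
`e₁ × ⋯ × e_N` of `X^N`, where the volume form is Lebesgue measure, regarded as a measure on
`X^N` that is carried by the domain of this chart. -/
def localMeasure (s : Fin N → pluricanonicalForms n X k) (e : Fin N → atlas (Fin n → ℂ) X) :
    Measure (Fin N → X) :=
  Measure.map (fun z j => (e j).1.symm (z j))
    ((volume.restrict {z : Fin N → Fin n → ℂ | ∀ j, z j ∈ (e j).1.target}).withDensity
      (fun z => ENNReal.ofReal
        (‖(Matrix.of fun i j : Fin N => (s i).1 (e j) (z j)).det‖ ^ (2 / (k : ℝ)))))

/-- The measure on `X^N` defined by the density `|det (s_i(z_j))|^{2/k}`. The local measures in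
the product charts agree where the domains of the charts overlap, so their supremum is the
global measure that restricts to each of them. -/
def detMeasure (s : Fin N → pluricanonicalForms n X k) : Measure (Fin N → X) :=
  ⨆ e : Fin N → atlas (Fin n → ℂ) X, localMeasure s e

/-- The partition function: the total mass of the measure `|det (s_i(z_j))|^{2/k}`. -/
def partitionFunction (s : Fin N → pluricanonicalForms n X k) : ℝ≥0∞ := detMeasure s univ

/-- The canonical probability measure `Z⁻¹ |det (s_i(z_j))|^{2/k} dz ∧ dz̄` on `X^N`,
computed with the basis `s` of `H⁰(X, k K_X)`. -/
def canonicalMeasure (s : Module.Basis (Fin N) ℂ (pluricanonicalForms n X k)) :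
    Measure (Fin N → X) :=
  (partitionFunction s)⁻¹ • detMeasure s

end Measures

end CanonicalPointProcess

end

/-! A birational map is biholomorphic between dense Zariski open sets. The result therefore rests on
three facts: the sets left out are null, pluricanonical forms pull back to global forms, and the
normalised measure does not depend on the basis.

On the open sets, pull-back multiplies each coefficient by the `k`-th power of a Jacobian
determinant `J`. It therefore multiplies `|det|^{2/k}` by the product of the `|J|²`, which is the
real Jacobian of the map on the product. Change of variables (`IsBihol.map_localMeasure`) then
matches the two densities. Applied to the identity map, it also shows that `detMeasure` really glues
the local measures (`detMeasure_restrict`). The zero set of a homogeneous equation is null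
(`detMeasure_compl_box_polyNe`). A change of basis scales the density by a constant that the
normalisation cancels (`canonicalMeasure_eq`), so a basis pulled back from `X'` may be used on `X`.

The hard point is that a pulled-back form extends across the points where the map is undefined
(`extendsAt_pullCoeff`). Classically the indeterminacy has codimension two and Hartogs applies. Here
a mean value argument takes its place. Along a single complex disc, one of the homogeneous
coordinates of the map dominates the others near each point. By Baire
(`eventually_mem_closure_dominated`), for a dense set of parallel discs this domination holds on
full neighbourhoods. There the ratios of coordinates extend by Riemann's theorem, so the map and the
pull-back extend, and the mean value formula holds on these discs. Means over boundary circles that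
avoid the bad set are holomorphic in the centre, and they define the extension
(`extendsAt_of_eq_circleMean`).

Injective pull-backs in both directions give equal plurigenera, once the spaces are known to be
finite-dimensional (`finite_pluricanonicalForms`, by the Schwarz lemma on a finite net). The total
mass is finite by compactness and positive by linear independence (`partitionFunction_lt_top`,
`partitionFunction_pos`). -/

namespace CanonicalPointProcess

/-! ### Holomorphic functions of several variables -/

section SeveralVariables

open Metric

variable {E : Type*} [NormedAddCommGroup E] [NormedSpace ℂ E]

/-- Cauchy estimate for the derivative of a holomorphic function. -/
theorem norm_fderiv_le_of_norm_le {F : Type*} [NormedAddCommGroup F] [NormedSpace ℂ F]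
    {h : E → F} {p : E} {r C : ℝ} (hr : 0 < r)
    (hd : DifferentiableOn ℂ h (ball p r)) (hC : ∀ z ∈ ball p r, ‖h z‖ ≤ C) :
    ‖fderiv ℂ h p‖ ≤ 2 * C / r := by
  refine Complex.norm_fderiv_le_div_of_mapsTo_ball hd (fun z hz => ?_) hr
  rw [mem_closedBall, dist_eq_norm]
  calc ‖h z - h p‖ ≤ ‖h z‖ + ‖h p‖ := norm_sub_le _ _
    _ ≤ 2 * C := by linarith [hC z hz, hC p (mem_ball_self hr)]

theorem continuous_add_smul (y v : E) : Continuous fun τ : ℂ => y + τ • v := by fun_prop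

/-- A slice of a ball is a ball in the sense of connectedness. -/
theorem isPreconnected_slice {B : Set E} (hB : Convex ℝ B) (y v : E) :
    IsPreconnected ((fun τ : ℂ => y + τ • v) ⁻¹' B) := by
  have : Convex ℝ ((fun τ : ℂ => y + τ • v) ⁻¹' B) := by
    intro a ha b hb s t hs ht hst
    have := hB ha hb hs ht hst
    simp only [mem_preimage] at *
    convert this using 1
    have h1 : y = s • y + t • y := by rw [← add_smul, hst, one_smul]
    conv_lhs => rw [h1]
    simp only [add_smul, smul_add, smul_assoc]
    abel
  exact this.isPreconnected

theorem analyticOnNhd_slice {a : E → ℂ} {B : Set E} (hB : IsOpen B) (ha : DifferentiableOn ℂ a B)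
    (y v : E) :
    AnalyticOnNhd ℂ (fun τ : ℂ => a (y + τ • v)) ((fun τ : ℂ => y + τ • v) ⁻¹' B) := by
  have hUo : IsOpen ((fun τ : ℂ => y + τ • v) ⁻¹' B) := hB.preimage (continuous_add_smul _ _)
  have hd : DifferentiableOn ℂ (fun τ : ℂ => a (y + τ • v)) ((fun τ : ℂ => y + τ • v) ⁻¹' B) :=
    ha.comp (Differentiable.differentiableOn (by fun_prop)) fun τ hτ => hτ
  exact hd.analyticOnNhd hUo

/-- Identity theorem on convex open sets. -/
theorem eqOn_zero_of_convex {a : E → ℂ} {B : Set E} (hB : IsOpen B) (hBc : Convex ℝ B)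
    (ha : DifferentiableOn ℂ a B) {z : E} (hz : z ∈ B) (h0 : ∀ᶠ y in 𝓝 z, a y = 0) :
    ∀ y ∈ B, a y = 0 := by
  intro y hy
  have h1 := (analyticOnNhd_slice hB ha z (y - z)).eqOn_zero_of_preconnected_of_eventuallyEq_zero
    (isPreconnected_slice hBc _ _) (z₀ := 0) (by simpa using hz) (by
      have : Tendsto (fun τ : ℂ => z + τ • (y - z)) (𝓝 0) (𝓝 z) := by
        have := (continuous_add_smul z (y - z)).tendsto 0
        simpa using this
      exact this.eventually h0)
  have := h1 (x := 1) (by simpa using hy)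
  simpa using this

/-- A holomorphic function which does not vanish near `z₀` is nonzero on arbitrarily small
circles around `z₀`. -/
theorem exists_circle_ne_zero {a : E → ℂ} {z₀ : E} (ha : ∀ᶠ z in 𝓝 z₀, DifferentiableAt ℂ a z)
    (h0 : ∃ᶠ z in 𝓝 z₀, a z ≠ 0) {O : Set E} (hO : O ∈ 𝓝 z₀) :
    ∃ v : E, (∀ τ ∈ closedBall (0 : ℂ) 1, z₀ + τ • v ∈ O) ∧
      ∀ τ ∈ sphere (0 : ℂ) 1, a (z₀ + τ • v) ≠ 0 := by
  obtain ⟨ρ, hρ, hρs⟩ := Metric.mem_nhds_iff.1 (inter_mem ha hO)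
  obtain ⟨w, hwB, hw⟩ : ∃ w ∈ ball z₀ ρ, a w ≠ 0 := by
    obtain ⟨w, hw⟩ := (h0.and_eventually (ball_mem_nhds z₀ hρ)).exists
    exact ⟨w, hw.2, hw.1⟩
  have hd : DifferentiableOn ℂ a (ball z₀ ρ) := fun z hz =>
    (hρs hz).1.differentiableWithinAt
  have han := analyticOnNhd_slice isOpen_ball hd z₀ (w - z₀)
  have hpre := isPreconnected_slice (convex_ball z₀ ρ) z₀ (w - z₀)
  have h0mem : (0 : ℂ) ∈ (fun τ : ℂ => z₀ + τ • (w - z₀)) ⁻¹' ball z₀ ρ := by simpa using hρ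
  have hev : ∀ᶠ τ in 𝓝[≠] (0 : ℂ), a (z₀ + τ • (w - z₀)) ≠ 0 := by
    rcases (han 0 h0mem).eventually_eq_zero_or_eventually_ne_zero with h | h
    · have := han.eqOn_zero_of_preconnected_of_eventuallyEq_zero hpre h0mem h (x := 1)
        (by simpa using hwB)
      simp at this
      exact absurd this hw
    · exact h
  have hev2 : ∀ᶠ τ in 𝓝 (0 : ℂ), z₀ + τ • (w - z₀) ∈ ball z₀ ρ :=
    (isOpen_ball.preimage (continuous_add_smul z₀ (w - z₀))).mem_nhds h0mem
  rw [eventually_nhdsWithin_iff] at hev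
  obtain ⟨ε, hε, hεs⟩ := Metric.mem_nhds_iff.1 (hev.and hev2)
  -- Rescaling by `ε / 2` places the unit circle inside the punctured disc of radius `ε` on which
  -- the slice has no zeros.
  have hsc : ∀ τ ∈ closedBall (0 : ℂ) 1, τ * ((ε / 2 : ℝ) : ℂ) ∈ ball (0 : ℂ) ε := by
    intro τ hτ
    have : ‖τ‖ ≤ 1 := by simpa using hτ
    rw [mem_ball_zero_iff, norm_mul, Complex.norm_real, Real.norm_of_nonneg (by positivity)]
    nlinarith
  refine ⟨((ε / 2 : ℝ) : ℂ) • (w - z₀), fun τ hτ => ?_, fun τ hτ => ?_⟩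
  · rw [smul_smul]
    exact (hρs (hεs (hsc τ hτ)).2).2
  · rw [smul_smul]
    refine (hεs (hsc τ (sphere_subset_closedBall hτ))).1 ?_
    have : τ ≠ 0 := ne_of_mem_sphere hτ one_ne_zero
    exact mul_ne_zero this (by exact_mod_cast (by positivity : (ε / 2 : ℝ) ≠ 0))

variable [FiniteDimensional ℂ E]

/-- Differentiation under the integral sign. The circle is compact in `O`, so a thickening of it
stays in `O`; there `h` is bounded, and the Cauchy estimate bounds the derivative uniformly. -/
theorem differentiableAt_circleIntegral {h : E → ℂ} {O : Set E} (hO : IsOpen O)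
    (hh : DifferentiableOn ℂ h O) {c : ℂ → ℂ} (hc : ContinuousOn c (sphere 0 1)) {y₀ v : E}
    (hs : ∀ τ ∈ sphere (0 : ℂ) 1, y₀ + τ • v ∈ O) :
    DifferentiableAt ℂ (fun y => ∮ τ in C(0, 1), c τ • h (y + τ • v)) y₀ := by
  borelize E
  have : ProperSpace E := FiniteDimensional.proper ℂ E
  set K : Set E := (fun τ : ℂ => y₀ + τ • v) '' sphere (0 : ℂ) 1 with hK
  have hKc : IsCompact K := (isCompact_sphere _ _).image (continuous_add_smul y₀ v)
  have hKO : K ⊆ O := by rintro _ ⟨τ, hτ, rfl⟩; exact hs τ hτ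
  obtain ⟨δ, hδ, hδO⟩ := hKc.exists_cthickening_subset_open hO hKO
  obtain ⟨C, hC⟩ := (hKc.cthickening (r := δ)).exists_bound_of_continuousOn
    (hh.continuousOn.mono hδO)
  have hmem : ∀ y ∈ ball y₀ (δ / 2), ∀ τ ∈ sphere (0 : ℂ) 1,
      ball (y + τ • v) (δ / 2) ⊆ cthickening δ K := by
    intro y hy τ hτ z hz
    refine mem_cthickening_of_dist_le z (y₀ + τ • v) δ K ⟨τ, hτ, rfl⟩ ?_
    calc dist z (y₀ + τ • v) ≤ dist z (y + τ • v) + dist (y + τ • v) (y₀ + τ • v) :=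
          dist_triangle _ _ _
      _ ≤ δ / 2 + δ / 2 := by
          rw [dist_add_right]
          exact add_le_add (mem_ball.1 hz).le (mem_ball.1 hy).le
      _ = δ := by ring
  have hcm : ∀ θ : ℝ, circleMap (0 : ℂ) 1 θ ∈ sphere (0 : ℂ) 1 := fun θ =>
    circleMap_mem_sphere _ zero_le_one _
  have hδ2 : 0 < δ / 2 := by positivity
  obtain ⟨C', hC'⟩ := (isCompact_sphere (0 : ℂ) 1).exists_bound_of_continuousOn hc
  have hcont : ∀ y ∈ ball y₀ (δ / 2), Continuous fun θ : ℝ =>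
      deriv (circleMap 0 1) θ • (c (circleMap 0 1 θ) • h (y + circleMap 0 1 θ • v)) := by
    intro y hy
    have h1 : Continuous fun θ : ℝ => c (circleMap 0 1 θ) :=
      hc.comp_continuous (continuous_circleMap _ _) hcm
    have h2 : Continuous fun θ : ℝ => h (y + circleMap 0 1 θ • v) :=
      (hh.continuousOn).comp_continuous
        ((continuous_add_smul y v).comp (continuous_circleMap _ _))
        fun θ => hδO (hmem y hy _ (hcm θ) (mem_ball_self hδ2))
    have h3 : Continuous fun θ : ℝ => deriv (circleMap 0 1) θ := by
      simp only [deriv_circleMap]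
      fun_prop
    exact h3.smul (h1.smul h2)
  have hsc : SecondCountableTopology (E →L[ℂ] ℂ) := by
    have : ProperSpace (E →L[ℂ] ℂ) := FiniteDimensional.proper ℂ _
    infer_instance
  -- Measurability of the derivative is enough here; its regularity is only derived afterwards, from
  -- this very lemma.
  have hmeas : AEStronglyMeasurable (fun θ : ℝ =>
      deriv (circleMap 0 1) θ • (c (circleMap 0 1 θ) • fderiv ℂ h (y₀ + circleMap 0 1 θ • v)))
      (volume.restrict (Set.uIoc 0 (2 * Real.pi))) := by
    have h1 : Continuous fun θ : ℝ => c (circleMap 0 1 θ) :=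
      hc.comp_continuous (continuous_circleMap _ _) hcm
    have h3 : Continuous fun θ : ℝ => deriv (circleMap 0 1) θ := by
      simp only [deriv_circleMap]
      fun_prop
    have h2 : Measurable fun θ : ℝ => fderiv ℂ h (y₀ + circleMap 0 1 θ • v) :=
      (measurable_fderiv ℂ h).comp
        ((continuous_add_smul y₀ v).comp (continuous_circleMap _ _)).measurable
    exact (h3.aestronglyMeasurable).smul (h1.aestronglyMeasurable.smul h2.aestronglyMeasurable)
  refine (intervalIntegral.hasFDerivAt_integral_of_dominated_of_fderiv_le
    (s := ball y₀ (δ / 2)) (bound := fun _ => |C'| * (2 * C / (δ / 2)))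
    (F' := fun y θ => deriv (circleMap 0 1) θ •
      (c (circleMap 0 1 θ) • fderiv ℂ h (y + circleMap 0 1 θ • v)))
    (ball_mem_nhds _ hδ2) ?_ ?_ hmeas ?_ ?_ ?_).differentiableAt
  · filter_upwards [ball_mem_nhds y₀ hδ2] with y hy
    exact (hcont y hy).aestronglyMeasurable
  · exact (hcont y₀ (mem_ball_self hδ2)).intervalIntegrable _ _
  · refine Eventually.of_forall fun θ _ y hy => ?_
    have h1 : ‖deriv (circleMap (0 : ℂ) 1) θ‖ = 1 := by simp [deriv_circleMap]
    rw [norm_smul, norm_smul, h1, one_mul]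
    refine mul_le_mul ((hC' _ (hcm θ)).trans (le_abs_self _)) ?_ (norm_nonneg _) (abs_nonneg _)
    exact norm_fderiv_le_of_norm_le hδ2 (hh.mono ((hmem y hy _ (hcm θ)).trans hδO))
      fun z hz => hC z (hmem y hy _ (hcm θ) hz)
  · exact intervalIntegrable_const
  · refine Eventually.of_forall fun θ _ y hy => ?_
    have h1 : DifferentiableAt ℂ h (y + circleMap 0 1 θ • v) :=
      hh.differentiableAt (hO.mem_nhds (hδO (hmem y hy _ (hcm θ) (mem_ball_self hδ2))))
    have h2 : HasFDerivAt (fun y => h (y + circleMap 0 1 θ • v))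
        (fderiv ℂ h (y + circleMap 0 1 θ • v)) y := by
      have := h1.hasFDerivAt.comp y ((hasFDerivAt_id y).add_const (circleMap 0 1 θ • v))
      simpa [Function.comp_def] using this
    exact (h2.const_smul (c (circleMap 0 1 θ))).const_smul (deriv (circleMap 0 1) θ)

/-- Cauchy's formula with kernel `τ⁻²` writes the directional derivative as a circle integral of
`h`, which is holomorphic in the centre. The factor `t` shrinks `v` until all the discs fit in `O`.
-/
theorem differentiableAt_fderiv_apply {h : E → ℂ} {O : Set E} (hO : IsOpen O)
    (hh : DifferentiableOn ℂ h O) {y₀ : E} (hy₀ : y₀ ∈ O) (v : E) :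
    DifferentiableAt ℂ (fun y => fderiv ℂ h y v) y₀ := by
  have h0 : Tendsto (fun t : ℝ => closedBall y₀ (t * ‖v‖ + t)) (𝓝[>] 0) (𝓝 y₀).smallSets := by
    have : Tendsto (fun t : ℝ => t * ‖v‖ + t) (𝓝[>] 0) (𝓝 0) := by
      have : Tendsto (fun t : ℝ => t * ‖v‖ + t) (𝓝 0) (𝓝 (0 * ‖v‖ + 0)) :=
        Continuous.tendsto (by fun_prop) 0
      simp only [zero_mul, add_zero] at this
      exact this.mono_left nhdsWithin_le_nhds
    exact (tendsto_closedBall_smallSets y₀).comp this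
  obtain ⟨t, ht, htpos⟩ := ((tendsto_smallSets_iff.1 h0 O (hO.mem_nhds hy₀)).and
    self_mem_nhdsWithin).exists
  have htpos : (0 : ℝ) < t := htpos
  have hmem : ∀ y ∈ ball y₀ t, ∀ τ ∈ closedBall (0 : ℂ) 1, y + τ • ((t : ℂ) • v) ∈ O := by
    intro y hy τ hτ
    refine ht (mem_closedBall.2 ?_)
    rw [dist_eq_norm]
    have h1 : ‖τ‖ ≤ 1 := by simpa using hτ
    have h2 : ‖y - y₀‖ ≤ t := by simpa [dist_eq_norm] using (mem_ball.1 hy).le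
    calc ‖y + τ • ((t : ℂ) • v) - y₀‖ = ‖τ • ((t : ℂ) • v) + (y - y₀)‖ := by congr 1; abel
      _ ≤ ‖τ • ((t : ℂ) • v)‖ + ‖y - y₀‖ := norm_add_le _ _
      _ ≤ t * ‖v‖ + t := by
        rw [norm_smul, norm_smul, Complex.norm_real, Real.norm_of_nonneg htpos.le]
        refine add_le_add ?_ h2
        exact mul_le_of_le_one_left (by positivity) h1
  have key : ∀ y ∈ ball y₀ t, fderiv ℂ h y v = (t : ℂ)⁻¹ • ((2 * Real.pi * Complex.I : ℂ)⁻¹ •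
      ∮ τ in C(0, 1), (τ ^ 2)⁻¹ • h (y + τ • ((t : ℂ) • v))) := by
    intro y hy
    set U : Set ℂ := (fun τ : ℂ => y + τ • ((t : ℂ) • v)) ⁻¹' O with hU
    have hUo : IsOpen U := hO.preimage (continuous_add_smul _ _)
    have hd : DifferentiableOn ℂ (fun τ : ℂ => h (y + τ • ((t : ℂ) • v))) U := by
      refine hh.comp (Differentiable.differentiableOn (by fun_prop)) fun τ hτ => hτ
    have := Complex.two_pi_I_inv_smul_circleIntegral_sub_sq_inv_smul_of_differentiable hUo
      (c := 0) (R := 1) (w₀ := 0) (fun τ hτ => hmem y hy τ hτ) hd (by simp)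
    simp only [sub_zero] at this
    rw [this]
    have hy' : y ∈ O := by simpa using hmem y hy 0 (by simp)
    have h1 : HasFDerivAt h (fderiv ℂ h y) (y + (0 : ℂ) • ((t : ℂ) • v)) := by
      simpa using (hh.differentiableAt (hO.mem_nhds hy')).hasFDerivAt
    have h2 : HasDerivAt (fun τ : ℂ => y + τ • ((t : ℂ) • v)) ((t : ℂ) • v) 0 := by
      simpa using ((hasDerivAt_id (0 : ℂ)).smul_const ((t : ℂ) • v)).const_add y
    have h3 := h1.comp_hasDerivAt (0 : ℂ) h2
    have h4 : deriv (fun τ : ℂ => h (y + τ • ((t : ℂ) • v))) 0 = fderiv ℂ h y ((t : ℂ) • v) :=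
      h3.deriv
    rw [h4, map_smul, smul_smul, inv_mul_cancel₀, one_smul]
    exact_mod_cast htpos.ne'
  have hdiff : DifferentiableAt ℂ (fun y => (t : ℂ)⁻¹ • ((2 * Real.pi * Complex.I : ℂ)⁻¹ •
      ∮ τ in C(0, 1), (τ ^ 2)⁻¹ • h (y + τ • ((t : ℂ) • v)))) y₀ := by
    refine ((differentiableAt_circleIntegral hO hh (c := fun τ => (τ ^ 2)⁻¹) ?_ ?_).const_smul
      ((2 * Real.pi * Complex.I : ℂ)⁻¹)).const_smul ((t : ℂ)⁻¹)
    · refine ContinuousOn.inv₀ (by fun_prop) fun τ hτ => ?_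
      have : τ ≠ 0 := ne_of_mem_sphere hτ one_ne_zero
      exact pow_ne_zero _ this
    · exact fun τ hτ => hmem y₀ (mem_ball_self htpos) τ (sphere_subset_closedBall hτ)
  refine hdiff.congr_of_eventuallyEq ?_
  filter_upwards [ball_mem_nhds y₀ htpos] with y hy using key y hy

end SeveralVariables

/-! ### Extension of holomorphic functions across thin sets -/

section Extension

open Metric

/-- The mean value of `f` over the unit circle, as a Cauchy integral. -/
noncomputable def circleMean (f : ℂ → ℂ) : ℂ :=
  (2 * Real.pi * Complex.I : ℂ)⁻¹ • ∮ τ in C(0, 1), τ⁻¹ • f τ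

theorem circleMean_congr {f g : ℂ → ℂ} (h : ∀ τ ∈ sphere (0 : ℂ) 1, f τ = g τ) :
    circleMean f = circleMean g := by
  unfold circleMean
  congr 1
  exact circleIntegral.integral_congr zero_le_one fun τ hτ => by simp only [h τ hτ]

theorem circleMean_eq {f : ℂ → ℂ} {U : Set ℂ} (hcU : closedBall 0 1 ⊆ U)
    (hf : DifferentiableOn ℂ f U) : circleMean f = f 0 := by
  have := (hf.diffContOnCl_ball hcU).two_pi_i_inv_smul_circleIntegral_sub_inv_smul
    (w := 0) (by simp)
  simpa [circleMean] using this

/-- The form in which density is used below: an identity between continuous maps need only be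
checked arbitrarily close to the point. -/
theorem eq_of_frequently_eq {X Y : Type*} [TopologicalSpace X] [TopologicalSpace Y] [T2Space Y]
    {f g : X → Y} {p : X} (hf : ContinuousAt f p) (hg : ContinuousAt g p)
    (h : ∃ᶠ y in 𝓝 p, f y = g y) : f p = g p := by
  by_contra hne
  exact h ((hf.prodMk hg).eventually_mem
    (isClosed_diagonal.isOpen_compl.mem_nhds (x := (f p, g p)) hne))

variable {E : Type*} [NormedAddCommGroup E] [NormedSpace ℂ E]

/-- The function `h`, which is given where `a ≠ 0`, extends holomorphically to a
neighbourhood of `z`. -/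
def ExtendsAt (a h : E → ℂ) (z : E) : Prop :=
  ∃ H : E → ℂ, (∀ᶠ y in 𝓝 z, DifferentiableAt ℂ H y) ∧ ∀ᶠ y in 𝓝 z, a y ≠ 0 → H y = h y

theorem ExtendsAt.eventually {a h : E → ℂ} {z : E} (hz : ExtendsAt a h z) :
    ∀ᶠ y in 𝓝 z, ExtendsAt a h y := by
  obtain ⟨H, h1, h2⟩ := hz
  filter_upwards [h1.eventually_nhds, h2.eventually_nhds] with y hy1 hy2 using ⟨H, hy1, hy2⟩

/-- Local extensions agree by continuity, since each equals `h` at points with `a ≠ 0` arbitrarily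
near. Evaluating at each point the extension chosen there is thus locally the same as using a single
extension. -/
theorem exists_differentiableOn_of_extendsAt {a h : E → ℂ} {O : Set E}
    (ha : ∀ z ∈ O, ∃ᶠ y in 𝓝 z, a y ≠ 0) (hO : IsOpen O) (hext : ∀ z ∈ O, ExtendsAt a h z) :
    ∃ H : E → ℂ, DifferentiableOn ℂ H O ∧ ∀ z ∈ O, a z ≠ 0 → H z = h z := by
  choose! H hHd hH using hext
  have hagree : ∀ p ∈ O, ∀ᶠ p' in 𝓝 p, H p' p' = H p p' := by
    intro p hp
    filter_upwards [(hHd p hp).eventually_nhds, (hH p hp).eventually_nhds, hO.mem_nhds hp]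
      with p' h1 h2 h3
    refine eq_of_frequently_eq (hHd p' h3).self_of_nhds.continuousAt h1.self_of_nhds.continuousAt ?_
    refine (ha p' h3).mp ?_
    filter_upwards [h2, hH p' h3] with y hy1 hy2 hy3
    rw [hy1 hy3, hy2 hy3]
  refine ⟨fun p => H p p, fun p hp => ?_, fun p hp hap => (hH p hp).self_of_nhds hap⟩
  exact ((hHd p hp).self_of_nhds.congr_of_eventuallyEq (hagree p hp)).differentiableWithinAt

theorem isOpen_inter_ne_zero {X : Type*} [TopologicalSpace X] {a : X → ℂ} {O : Set X}
    (hO : IsOpen O) (ha : ContinuousOn a O) :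
    IsOpen (O ∩ {z | a z ≠ 0}) :=
  ha.isOpen_inter_preimage hO isOpen_ne

/-- If `h` extends holomorphically to a neighbourhood of a disc, then it satisfies the mean value
formula on this disc. -/
theorem eq_circleMean_of_extendsAt {a h : E → ℂ} {O : Set E} (hO : IsOpen O)
    (ha : ∀ z ∈ O, ∃ᶠ y in 𝓝 z, a y ≠ 0) {y v : E}
    (hext : ∀ τ ∈ closedBall (0 : ℂ) 1, y + τ • v ∈ O ∧ ExtendsAt a h (y + τ • v))
    (hs : ∀ τ ∈ sphere (0 : ℂ) 1, a (y + τ • v) ≠ 0) (hy : a y ≠ 0) :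
    h y = circleMean fun τ => h (y + τ • v) := by
  set R : Set E := {p | p ∈ O ∧ ExtendsAt a h p}
  have hR : IsOpen R := isOpen_iff_mem_nhds.2 fun p hp =>
    inter_mem (hO.mem_nhds hp.1) hp.2.eventually
  obtain ⟨H, hHd, hH⟩ := exists_differentiableOn_of_extendsAt (a := a) (h := h)
    (fun z (hz : z ∈ R) => ha z hz.1) hR fun z hz => hz.2
  have h1 : circleMean (fun τ => h (y + τ • v)) = circleMean fun τ => H (y + τ • v) :=
    circleMean_congr fun τ hτ => (hH _ (hext τ (sphere_subset_closedBall hτ)) (hs τ hτ)).symm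
  have hyR : y ∈ R := by
    have := hext 0 (by simp)
    rwa [zero_smul, add_zero] at this
  rw [h1, circleMean_eq (f := fun τ => H (y + τ • v)) (U := (fun τ : ℂ => y + τ • v) ⁻¹' R)
    (fun τ hτ => hext τ hτ)
    (hHd.comp (Differentiable.differentiableOn (by fun_prop)) fun τ hτ => hτ)]
  simp [hH y hyR hy]

theorem eventually_forall_add_smul_mem {O : Set E} (hO : IsOpen O) {K : Set ℂ} (hK : IsCompact K)
    {z₀ v : E} (h : ∀ τ ∈ K, z₀ + τ • v ∈ O) : ∀ᶠ y in 𝓝 z₀, ∀ τ ∈ K, y + τ • v ∈ O := by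
  refine hK.eventually_forall_of_forall_eventually fun τ hτ => ?_
  have : Continuous fun p : E × ℂ => p.1 + p.2 • v := by fun_prop
  exact this.continuousAt.eventually_mem (hO.mem_nhds (h τ hτ))

/-- Divide out the lowest vanishing order `m` of the family. The quotients `u i` do not all vanish
at `τ₀`, and a largest one there remains largest nearby up to the factor 2. -/
theorem exists_dominant {ι : Type*} [Finite ι] [Nonempty ι] {G : ι → ℂ → ℂ} {τ₀ : ℂ}
    (hG : ∀ i, AnalyticAt ℂ (G i) τ₀) :
    ∃ j, ∀ᶠ τ in 𝓝 τ₀, ∀ i, ‖G i τ‖ ≤ 2 * ‖G j τ‖ := by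
  obtain ⟨i₀, hi₀⟩ := Finite.exists_min fun i => analyticOrderAt (G i) τ₀
  by_cases htop : analyticOrderAt (G i₀) τ₀ = ⊤
  · refine ⟨i₀, ?_⟩
    rw [eventually_all]
    intro i
    have : analyticOrderAt (G i) τ₀ = ⊤ := top_le_iff.1 (htop ▸ hi₀ i)
    filter_upwards [analyticOrderAt_eq_top.1 this] with τ hτ
    rw [hτ, norm_zero]
    positivity
  · obtain ⟨m, hm⟩ := ENat.ne_top_iff_exists.1 htop
    have hu : ∀ i, ∃ u : ℂ → ℂ, AnalyticAt ℂ u τ₀ ∧ (∀ᶠ τ in 𝓝 τ₀, G i τ = (τ - τ₀) ^ m • u τ) ∧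
        (i = i₀ → u τ₀ ≠ 0) := by
      intro i
      by_cases hi : i = i₀
      · subst hi
        obtain ⟨u, h1, h2, h3⟩ := ((hG i).analyticOrderAt_eq_natCast (n := m)).1 hm.symm
        exact ⟨u, h1, h3, fun _ => h2⟩
      · obtain ⟨u, h1, h2⟩ := (natCast_le_analyticOrderAt (hG i) (n := m)).1 (hm ▸ hi₀ i)
        exact ⟨u, h1, h2, fun h => absurd h hi⟩
    choose u hua hu hu0 using hu
    obtain ⟨j, hj⟩ := Finite.exists_max fun i => ‖u i τ₀‖
    have hjpos : 0 < ‖u j τ₀‖ := lt_of_lt_of_le (norm_pos_iff.2 (hu0 i₀ rfl)) (hj i₀)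
    refine ⟨j, ?_⟩
    rw [eventually_all]
    intro i
    have hlt : ∀ᶠ τ in 𝓝 τ₀, ‖u i τ‖ < 2 * ‖u j τ‖ := by
      refine ((hua i).continuousAt.norm).eventually_lt (continuousAt_const.mul
        (hua j).continuousAt.norm) ?_
      linarith [hj i]
    filter_upwards [hlt, hu i, hu j] with τ h1 h2 h3
    rw [h2, h3, norm_smul, norm_smul]
    nlinarith [norm_nonneg ((τ - τ₀) ^ m)]

variable [FiniteDimensional ℂ E]

/-- The circle mean only involves points with `a ≠ 0`, so it is holomorphic in the centre even where
`h` is not defined. Agreement with `h` on a dense set spreads to all nearby points with `a ≠ 0` by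
continuity. -/
theorem extendsAt_of_eq_circleMean {a h : E → ℂ} {O : Set E} (hO : IsOpen O)
    (ha : DifferentiableOn ℂ a O) (hh : ∀ z ∈ O, a z ≠ 0 → DifferentiableAt ℂ h z) {z₀ v : E}
    (hcl : ∀ τ ∈ closedBall (0 : ℂ) 1, z₀ + τ • v ∈ O)
    (hs : ∀ τ ∈ sphere (0 : ℂ) 1, a (z₀ + τ • v) ≠ 0)
    (hdense : ∀ᶠ y in 𝓝 z₀, y ∈ closure {y | a y ≠ 0 → h y = circleMean fun τ => h (y + τ • v)}) :
    ExtendsAt a h z₀ := by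
  have hO' := isOpen_inter_ne_zero hO ha.continuousOn
  have hh' : DifferentiableOn ℂ h (O ∩ {z | a z ≠ 0}) := fun z hz =>
    (hh z hz.1 hz.2).differentiableWithinAt
  have hz₀ : z₀ ∈ O := by simpa using hcl 0 (by simp)
  have hd : ∀ᶠ y in 𝓝 z₀, DifferentiableAt ℂ (fun y => circleMean fun τ => h (y + τ • v)) y := by
    filter_upwards [eventually_forall_add_smul_mem hO' (isCompact_sphere 0 1)
      fun τ hτ => ⟨hcl τ (sphere_subset_closedBall hτ), hs τ hτ⟩] with y hy
    refine (differentiableAt_circleIntegral hO' hh' (c := fun τ => τ⁻¹) ?_ hy).const_smul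
      ((2 * Real.pi * Complex.I : ℂ)⁻¹)
    exact ContinuousOn.inv₀ (by fun_prop) fun τ hτ => ne_of_mem_sphere hτ one_ne_zero
  refine ⟨fun y => circleMean fun τ => h (y + τ • v), hd, ?_⟩
  filter_upwards [hd, hdense, hO.mem_nhds hz₀] with y hy1 hy2 hy3 hay
  refine eq_of_frequently_eq hy1.continuousAt (hh y hy3 hay).continuousAt ?_
  refine (mem_closure_iff_frequently.1 hy2).mp ?_
  filter_upwards [hO'.mem_nhds ⟨hy3, hay⟩] with y' hy' h2
  exact (h2 hy'.2).symm

/-- Riemann extension theorem in one variable. -/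
theorem extendsAt_of_bounded_one {a h : ℂ → ℂ} {τ₀ : ℂ} (ha : AnalyticAt ℂ a τ₀)
    (ha0 : ∃ᶠ τ in 𝓝 τ₀, a τ ≠ 0) (hh : ∀ᶠ τ in 𝓝 τ₀, a τ ≠ 0 → DifferentiableAt ℂ h τ)
    {C : ℝ} (hC : ∀ᶠ τ in 𝓝 τ₀, a τ ≠ 0 → ‖h τ‖ ≤ C) : ExtendsAt a h τ₀ := by
  by_cases h0 : a τ₀ = 0
  · have hev := ha.eventually_eq_zero_or_eventually_ne_zero.resolve_left fun h =>
      ha0 (by simpa using h)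
    rw [eventually_nhdsWithin_iff] at hev
    obtain ⟨s, hs, hso, hτ₀⟩ := _root_.eventually_nhds_iff.1 (hev.and (hh.and hC))
    have hd : DifferentiableOn ℂ (Function.update h τ₀ (limUnder (𝓝[≠] τ₀) h)) s := by
      refine Complex.differentiableOn_update_limUnder_of_bddAbove (hso.mem_nhds hτ₀) ?_ ?_
      · intro τ hτ
        exact ((hs τ hτ.1).2.1 ((hs τ hτ.1).1 hτ.2)).differentiableWithinAt
      · refine ⟨C, ?_⟩
        rintro _ ⟨τ, hτ, rfl⟩
        exact (hs τ hτ.1).2.2 ((hs τ hτ.1).1 hτ.2)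
    refine ⟨_, (hd.eventually_differentiableAt (hso.mem_nhds hτ₀)), ?_⟩
    refine Eventually.of_forall fun τ hτ => Function.update_of_ne ?_ _ _
    rintro rfl
    exact hτ h0
  · refine ⟨h, ?_, Eventually.of_forall fun _ _ => rfl⟩
    filter_upwards [hh, ha.continuousAt.eventually_ne h0] with τ h1 h2 using h1 h2

/-- Riemann extension theorem. -/
theorem extendsAt_of_bounded {a h : E → ℂ} {O : Set E} (hO : IsOpen O)
    (ha : DifferentiableOn ℂ a O) (hh : ∀ z ∈ O, a z ≠ 0 → DifferentiableAt ℂ h z)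
    {C : ℝ} (hC : ∀ z ∈ O, a z ≠ 0 → ‖h z‖ ≤ C) {z₀ : E} (hz₀ : z₀ ∈ O)
    (ha0 : ∃ᶠ y in 𝓝 z₀, a y ≠ 0) : ExtendsAt a h z₀ := by
  obtain ⟨ρ, hρ, hρO⟩ := Metric.isOpen_iff.1 hO z₀ hz₀
  have hda : DifferentiableOn ℂ a (ball z₀ ρ) := ha.mono hρO
  obtain ⟨v, hcl, hs⟩ := exists_circle_ne_zero
    (hda.eventually_differentiableAt (ball_mem_nhds z₀ hρ)) ha0 (ball_mem_nhds z₀ hρ)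
  refine extendsAt_of_eq_circleMean isOpen_ball hda (fun z hz => hh z (hρO hz)) hcl hs ?_
  have hO' := isOpen_inter_ne_zero isOpen_ball hda.continuousOn
  filter_upwards [eventually_forall_add_smul_mem isOpen_ball (isCompact_closedBall 0 1) hcl,
    eventually_forall_add_smul_mem hO' (isCompact_sphere 0 1)
      fun τ hτ => ⟨hcl τ (sphere_subset_closedBall hτ), hs τ hτ⟩] with y hy1 hy2
  refine subset_closure fun hay => ?_
  have hUo : IsOpen ((fun τ : ℂ => y + τ • v) ⁻¹' ball z₀ ρ) :=
    isOpen_ball.preimage (continuous_add_smul _ _)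
  have han := analyticOnNhd_slice isOpen_ball hda y v
  have hpre := isPreconnected_slice (convex_ball z₀ ρ) y v
  -- The slice cannot lie in the zero set, because `a` is nonzero at its boundary point `y + v`.
  have hfreq : ∀ τ ∈ (fun τ : ℂ => y + τ • v) ⁻¹' ball z₀ ρ,
      ∃ᶠ τ' in 𝓝 τ, a (y + τ' • v) ≠ 0 := by
    intro τ hτ hev
    simp only [not_not] at hev
    have := han.eqOn_zero_of_preconnected_of_eventuallyEq_zero hpre hτ hev (x := 1)
      (hy1 1 (by simp))
    exact (hy2 1 (by simp)).2 this
  -- The mean value formula is used for the restriction to the slice, where the one-variable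
  -- removable singularity theorem supplies the local extensions.
  have := eq_circleMean_of_extendsAt (a := fun τ : ℂ => a (y + τ • v))
    (h := fun τ : ℂ => h (y + τ • v)) hUo hfreq (y := 0) (v := 1) (fun τ hτ => ?_)
    (fun τ hτ => by simpa using (hy2 τ hτ).2) (by simpa using hay)
  · simpa using this
  · simp only [zero_add, smul_eq_mul, mul_one]
    refine ⟨hy1 τ hτ, extendsAt_of_bounded_one (han τ (hy1 τ hτ)) (hfreq τ (hy1 τ hτ)) ?_
      (C := C) ?_⟩
    · filter_upwards [hUo.mem_nhds (hy1 τ hτ)] with τ' hτ' h1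
      have h2 := hh _ (hρO hτ') h1
      exact h2.comp τ' (by fun_prop)
    · filter_upwards [hUo.mem_nhds (hy1 τ hτ)] with τ' hτ' h1
      exact hC _ (hρO hτ') h1

/-- On a dense set of parallel discs, a finite family of holomorphic functions is locally
dominated by one of its members, near each point of the disc. -/
theorem eventually_mem_closure_dominated {ι : Type*} [Finite ι] [Nonempty ι] {g : ι → E → ℂ}
    {O : Set E} (hO : IsOpen O) (hg : ∀ i, DifferentiableOn ℂ (g i) O) {z₀ v : E}
    (hcl : ∀ τ ∈ closedBall (0 : ℂ) 1, z₀ + τ • v ∈ O) :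
    ∀ᶠ y in 𝓝 z₀, y ∈ closure {y | ∀ τ ∈ closedBall (0 : ℂ) 1, y + τ • v ∈ O ∧
      ∃ j, ∀ᶠ p in 𝓝 (y + τ • v), ∀ i, ‖g i p‖ ≤ 2 * ‖g j p‖} := by
  have : CompleteSpace E := FiniteDimensional.complete ℂ E
  have hK := isCompact_closedBall (0 : ℂ) 1
  obtain ⟨δ, hδ, hδO⟩ := (Metric.nhds_basis_closedBall.mem_iff).1
    (eventually_forall_add_smul_mem hO hK hcl)
  have hcont : ∀ i, ∀ τ ∈ closedBall (0 : ℂ) 1,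
      ContinuousOn (fun y => ‖g i (y + τ • v)‖) (closedBall z₀ δ) := fun i τ hτ =>
    ((hg i).continuousOn.comp (by fun_prop) fun y hy => hδO hy τ hτ).norm
  let 𝔅 := TopologicalSpace.countableBasis ℂ
  have hB : TopologicalSpace.IsTopologicalBasis 𝔅 := TopologicalSpace.isBasis_countableBasis ℂ
  have : Countable 𝔅 := (TopologicalSpace.countable_countableBasis ℂ).to_subtype
  -- A finite set `S` of pairs (basic open set, index) records a covering of the disc together with
  -- the coordinate that dominates on each piece. There are only countably many such `S`, and each
  -- `A S` is closed.
  let A : Finset (𝔅 × ι) → Set E := fun S =>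
    closedBall z₀ δ ∩ {_y | ∀ τ ∈ closedBall (0 : ℂ) 1, ∃ s ∈ S, τ ∈ s.1.1} ∩
      ⋂ s ∈ S, ⋂ τ ∈ s.1.1 ∩ closedBall (0 : ℂ) 1, ⋂ i,
        {y ∈ closedBall z₀ δ | ‖g i (y + τ • v)‖ ≤ 2 * ‖g s.2 (y + τ • v)‖}
  have hA : ∀ S, IsClosed (A S) := by
    intro S
    refine (isClosed_closedBall.inter isClosed_const).inter ?_
    refine isClosed_biInter fun s _ => isClosed_biInter fun τ hτ => isClosed_iInter fun i => ?_
    exact isClosed_closedBall.isClosed_le (hcont i τ hτ.2) (continuousOn_const.mul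
      (hcont s.2 τ hτ.2))
  -- The extra set `(ball z₀ δ)ᶜ` makes the family cover the whole space, as the Baire theorem
  -- requires.
  let A' : Option (Finset (𝔅 × ι)) → Set E := fun o => o.elim (ball z₀ δ)ᶜ A
  have hA' : ∀ o, IsClosed (A' o) := by
    rintro (_ | S)
    · exact isOpen_ball.isClosed_compl
    · exact hA S
  have hcover : ⋃ o, A' o = univ := by
    refine eq_univ_of_forall fun y => mem_iUnion.2 ?_
    by_cases hy : y ∈ ball z₀ δ
    swap
    · exact ⟨none, hy⟩
    have hyc : y ∈ closedBall z₀ δ := ball_subset_closedBall hy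
    have hloc : ∀ τ ∈ closedBall (0 : ℂ) 1, ∃ s : 𝔅 × ι, τ ∈ s.1.1 ∧
        ∀ τ' ∈ s.1.1, ∀ i, ‖g i (y + τ' • v)‖ ≤ 2 * ‖g s.2 (y + τ' • v)‖ := by
      intro τ hτ
      obtain ⟨j, hj⟩ := exists_dominant (G := fun i τ' => g i (y + τ' • v)) (τ₀ := τ) fun i =>
        analyticOnNhd_slice hO (hg i) y v τ (hδO hyc τ hτ)
      obtain ⟨b, hb, hτb, hbs⟩ := hB.mem_nhds_iff.1 hj
      exact ⟨⟨⟨b, hb⟩, j⟩, hτb, fun τ' hτ' => hbs hτ'⟩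
    have : Nonempty (𝔅 × ι) := (hloc 0 (by simp)).nonempty
    choose! s hs1 hs2 using hloc
    obtain ⟨t, ht1, ht2⟩ := hK.elim_nhds_subcover (fun τ => (s τ).1.1) fun τ hτ =>
      (hB.isOpen (s τ).1.2).mem_nhds (hs1 τ hτ)
    classical
    refine ⟨some (t.image s), ⟨hyc, fun τ hτ => ?_⟩, ?_⟩
    · obtain ⟨τ', hτ', h⟩ := mem_iUnion₂.1 (ht2 hτ)
      exact ⟨s τ', Finset.mem_image_of_mem s hτ', h⟩
    · simp only [mem_iInter]
      intro s' hs' τ hτ i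
      obtain ⟨τ', hτ', rfl⟩ := Finset.mem_image.1 hs'
      exact ⟨hyc, hs2 τ' (ht1 τ' hτ') τ hτ.1 i⟩
  have hdense := dense_iUnion_interior_of_closed hA' hcover
  filter_upwards [ball_mem_nhds z₀ hδ] with y hy
  rw [mem_closure_iff_nhds]
  intro t ht
  obtain ⟨y', ⟨hy't, hy'b⟩, hy'⟩ := mem_closure_iff_nhds.1 (hdense y) _
    (inter_mem ht (isOpen_ball.mem_nhds hy))
  refine ⟨y', hy't, fun τ hτ => ?_⟩
  obtain ⟨o, ho⟩ := mem_iUnion.1 hy'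
  rcases o with _ | S
  · exact absurd hy'b (interior_subset ho)
  refine ⟨hδO (ball_subset_closedBall hy'b) τ hτ, ?_⟩
  obtain ⟨s, hs, hτs⟩ := (interior_subset ho).1.2 τ hτ
  refine ⟨s.2, ?_⟩
  -- A point `p` near `y' + τ • v` is `y'' + τ • v` with `y''` near `y'` and the same `τ`. An
  -- interior point `y'` of `A S` thus gives domination on a full neighbourhood.
  have htend : Tendsto (fun p => p - τ • v) (𝓝 (y' + τ • v)) (𝓝 y') := by
    have : Continuous fun p : E => p - τ • v := by fun_prop
    simpa using this.tendsto (y' + τ • v)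
  filter_upwards [htend (mem_interior_iff_mem_nhds.1 ho)] with p hp i
  have := hp.2
  simp only [mem_iInter] at this
  simpa using (this s hs τ ⟨hτs, hτ⟩ i).2

/-- The zero set of a holomorphic function is a null set, near each point at which the function
does not vanish locally. -/
theorem exists_mem_nhds_measure_zero_set [MeasurableSpace E] [BorelSpace E] (μ : Measure E)
    [μ.IsAddHaarMeasure] {a : E → ℂ} {z₀ : E}
    (ha : ∀ᶠ z in 𝓝 z₀, DifferentiableAt ℂ a z) (ha0 : ∃ᶠ y in 𝓝 z₀, a y ≠ 0) :
    ∃ V ∈ 𝓝 z₀, μ (V ∩ {z | a z = 0}) = 0 := by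
  have : ProperSpace E := FiniteDimensional.proper ℂ E
  obtain ⟨ρ, hρ, hρa⟩ := Metric.mem_nhds_iff.1 ha
  have hda : DifferentiableOn ℂ a (ball z₀ ρ) := fun z hz => (hρa hz).differentiableWithinAt
  obtain ⟨v, hcl, hs⟩ := exists_circle_ne_zero ha ha0 (ball_mem_nhds z₀ hρ)
  have hO' := isOpen_inter_ne_zero isOpen_ball hda.continuousOn
  obtain ⟨δ, hδ, hδs⟩ := Metric.mem_nhds_iff.1
    ((eventually_forall_add_smul_mem hO' (isCompact_sphere 0 1)
      fun τ hτ => ⟨hcl τ (sphere_subset_closedBall hτ), hs τ hτ⟩).and (ball_mem_nhds z₀ hρ))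
  refine ⟨ball z₀ δ, ball_mem_nhds z₀ hδ, ?_⟩
  -- A Fubini argument: it is enough that every complex line in the direction `v` meets the
  -- complement of this set in a null set.
  have hmeas : MeasurableSet ((ball z₀ δ)ᶜ ∪ (ball z₀ ρ ∩ {z | a z ≠ 0})) :=
    measurableSet_ball.compl.union hO'.measurableSet
  have hae := ae_mem_of_ae_add_linearMap_mem ((LinearMap.id : ℂ →ₗ[ℂ] ℂ).smulRight v) volume μ
    hmeas fun y => ?_
  · refine measure_mono_null ?_ (mem_ae_iff.1 hae)
    rintro z ⟨hz1, hz2⟩ (h | h)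
    · exact h hz1
    · exact h.2 hz2
  · rw [ae_iff]
    refine measure_null_of_locally_null _ fun τ₀ hτ₀ => ?_
    simp only [LinearMap.smulRight_apply, LinearMap.id_apply, mem_ofPred_eq, mem_union,
      mem_compl_iff, not_or, not_not] at hτ₀
    have hyδ : y + τ₀ • v ∈ ball z₀ δ := hτ₀.1
    have hyρ : y + τ₀ • v ∈ ball z₀ ρ := (hδs hyδ).2
    have han := analyticOnNhd_slice isOpen_ball hda y v
    have hpre := isPreconnected_slice (convex_ball z₀ ρ) y v
    have h1 := (hδs hyδ).1 1 (by simp)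
    -- If `a` vanished identically along the slice, it would vanish at parameter `τ₀ + 1`, which
    -- lies on the circle of nonvanishing about `y + τ₀ • v`.
    have hev : ∀ᶠ τ in 𝓝[≠] τ₀, a (y + τ • v) ≠ 0 := by
      rcases (han τ₀ hyρ).eventually_eq_zero_or_eventually_ne_zero with h | h
      · have h2 : y + (τ₀ + 1) • v = y + τ₀ • v + (1 : ℂ) • v := by rw [add_smul, add_assoc]
        have h3 := han.eqOn_zero_of_preconnected_of_eventuallyEq_zero hpre hyρ h (x := τ₀ + 1)
          (by rw [mem_preimage, h2]; exact h1.1)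
        simp only [Pi.zero_apply, h2] at h3
        exact absurd h3 h1.2
      · exact h
    rw [eventually_nhdsWithin_iff] at hev
    have hmemρ : ∀ᶠ τ in 𝓝 τ₀, y + τ • v ∈ ball z₀ ρ :=
      (isOpen_ball.preimage (continuous_add_smul y v)).mem_nhds hyρ
    refine ⟨_, inter_mem self_mem_nhdsWithin (mem_nhdsWithin_of_mem_nhds (hev.and hmemρ)), ?_⟩
    refine measure_mono_null (t := {τ₀}) ?_ (measure_singleton τ₀)
    rintro τ ⟨hτ1, hτ2, hτ3⟩
    by_contra hne
    refine hτ1 (Or.inr ⟨?_, ?_⟩)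
    · simpa using hτ3
    · simpa using hτ2 hne

end Extension

/-! ### Projective coordinates -/

section Projective

/-- Vanishing of the 2 × 2 minors expresses proportionality by polynomial identities, which pass to
limits. -/
theorem mk_eq_mk_iff_mul_eq {m : ℕ} {u v : Fin m → ℂ} (hu : u ≠ 0) (hv : v ≠ 0) :
    Projectivization.mk ℂ u hu = Projectivization.mk ℂ v hv ↔
      ∀ i j, u i * v j = u j * v i := by
  rw [Projectivization.mk_eq_mk_iff']
  constructor
  · rintro ⟨c, rfl⟩ i j
    simp only [Pi.smul_apply, smul_eq_mul]
    ring
  · intro h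
    obtain ⟨j, hj⟩ := Function.ne_iff.1 hv
    simp only [Pi.zero_apply] at hj
    refine ⟨u j / v j, ?_⟩
    ext i
    simp only [Pi.smul_apply, smul_eq_mul]
    rw [div_mul_eq_mul_div, div_eq_iff hj, h i j]

theorem eval_smul_of_isHomogeneous {σ : Type*} {f : MvPolynomial σ ℂ} {d : ℕ}
    (hf : f.IsHomogeneous d) (c : ℂ) (v : σ → ℂ) :
    MvPolynomial.eval (c • v) f = c ^ d * MvPolynomial.eval v f := by
  rw [MvPolynomial.eval_eq, MvPolynomial.eval_eq, Finset.mul_sum]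
  refine Finset.sum_congr rfl fun m hm => ?_
  have hdeg := hf.degree_eq_sum_deg_support hm
  simp only [Pi.smul_apply, smul_eq_mul, mul_pow, Finset.prod_mul_distrib]
  rw [Finset.prod_pow_eq_pow_sum, hdeg]
  ring

theorem eval_rep_mk_eq_zero_iff {m d : ℕ} {f : MvPolynomial (Fin m) ℂ} (hf : f.IsHomogeneous d)
    {v : Fin m → ℂ} (hv : v ≠ 0) :
    MvPolynomial.eval (Projectivization.mk ℂ v hv).rep f = 0 ↔ MvPolynomial.eval v f = 0 := by
  obtain ⟨c, hc⟩ := Projectivization.exists_smul_eq_mk_rep ℂ v hv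
  rw [← hc, Units.smul_def, eval_smul_of_isHomogeneous hf]
  simp

theorem differentiableAt_eval_comp {E : Type*} [NormedAddCommGroup E] [NormedSpace ℂ E] {m : ℕ}
    (f : MvPolynomial (Fin m) ℂ) {q : E → Fin m → ℂ} {z : E} (hq : DifferentiableAt ℂ q z) :
    DifferentiableAt ℂ (fun z => MvPolynomial.eval (q z) f) z := by
  induction f using MvPolynomial.induction_on with
  | C c => simp
  | add f g hf hg =>
    simp only [map_add]
    exact hf.fun_add hg
  | mul_X f i hf =>
    simp only [map_mul, MvPolynomial.eval_X]
    exact hf.fun_mul (differentiableAt_pi.1 hq i)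

end Projective

/-! ### Maps into a projective manifold which are holomorphic in projective coordinates -/

section Maps

variable {n M : ℕ} {X : Type*} [TopologicalSpace X] [ChartedSpace (Fin n → ℂ) X]
  {emb : X → ℙ ℂ (Fin (M + 1) → ℂ)}

/-- The map `Z` has near `z₀` the homogeneous coordinates `q`. -/
def HasProjectiveLift {Y : Type*} [TopologicalSpace Y] (emb : X → ℙ ℂ (Fin (M + 1) → ℂ))
    (Z : Y → X) (q : Y → Fin (M + 1) → ℂ) (z₀ : Y) : Prop :=
  ∀ᶠ z in 𝓝 z₀, ∃ h : q z ≠ 0, emb (Z z) = Projectivization.mk ℂ (q z) h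

/-- By compactness `Z` has a limit along every ultrafilter converging to `z₀`. Proportionality of
coordinates passes to the limit, so injectivity of `emb` forces this limit to be `Z z₀`. -/
theorem continuousAt_of_hasProjectiveLift [CompactSpace X] (hemb : IsProjectiveEmbedding n emb)
    {Y : Type*} [TopologicalSpace Y] {Z : Y → X} {q : Y → Fin (M + 1) → ℂ} {z₀ : Y}
    (hq : ContinuousAt q z₀) (h : HasProjectiveLift emb Z q z₀) : ContinuousAt Z z₀ := by
  refine (tendsto_iff_ultrafilter Z (𝓝 z₀) (𝓝 (Z z₀))).2 fun g hg => ?_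
  obtain ⟨y, -, hy⟩ := isCompact_univ.ultrafilter_le_nhds (g.map Z) (by simp)
  have hZ : Tendsto Z g (𝓝 y) := hy
  suffices y = Z z₀ from this ▸ hZ
  obtain ⟨φ, hφc, hφ, -⟩ := hemb.exists_lift y
  obtain ⟨hq0, hq1⟩ := h.self_of_nhds
  obtain ⟨hφ0, hφ1⟩ := hφ.self_of_nhds
  apply hemb.injective
  rw [hq1, hφ1, mk_eq_mk_iff_mul_eq]
  intro i j
  have h1 : Tendsto (fun z => φ (Z z)) g (𝓝 (φ y)) := hφc.continuousAt.tendsto.comp hZ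
  have h2 : Tendsto q g (𝓝 (q z₀)) := hq.tendsto.mono_left hg
  rw [tendsto_pi_nhds] at h1 h2
  refine tendsto_nhds_unique_of_eventuallyEq ((h1 i).mul (h2 j)) ((h1 j).mul (h2 i)) ?_
  filter_upwards [hg h, hZ.eventually hφ] with z hz1 hz2
  obtain ⟨hz, hz'⟩ := hz1
  obtain ⟨hw, hw'⟩ := hz2
  exact (mk_eq_mk_iff_mul_eq hw hz).1 (hw'.symm.trans hz') i j

variable [IsManifold 𝓘(ℂ, Fin n → ℂ) ω X]

theorem contMDiffAt_chart_symm (e : atlas (Fin n → ℂ) X) {w : Fin n → ℂ} (hw : w ∈ e.1.target) :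
    ContMDiffAt 𝓘(ℂ, Fin n → ℂ) 𝓘(ℂ, Fin n → ℂ) ω e.1.symm w :=
  (contMDiffOn_symm_of_mem_maximalAtlas (IsManifold.subset_maximalAtlas e.2)).contMDiffAt
    (e.1.open_target.mem_nhds hw)

theorem contMDiffAt_chart (e : atlas (Fin n → ℂ) X) {x : X} (hx : x ∈ e.1.source) :
    ContMDiffAt 𝓘(ℂ, Fin n → ℂ) 𝓘(ℂ, Fin n → ℂ) ω e.1 x :=
  contMDiffAt_of_mem_maximalAtlas (IsManifold.subset_maximalAtlas e.2) hx

theorem contDiffAt_transition (e e' : atlas (Fin n → ℂ) X) {x : X} (hx : x ∈ e.1.source)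
    (hx' : x ∈ e'.1.source) : ContDiffAt ℂ ω (e'.1 ∘ e.1.symm) (e.1 x) := by
  rw [← contMDiffAt_iff_contDiffAt]
  refine ContMDiffAt.comp (I' := 𝓘(ℂ, Fin n → ℂ)) (e.1 x) ?_
    (contMDiffAt_chart_symm e (e.1.map_source hx))
  rw [e.1.left_inv hx]
  exact contMDiffAt_chart e' hx'

/-- In a chart, a projective embedding has a holomorphic lift whose differential is injective
modulo the line spanned by the lift. -/
theorem exists_chart_lift (hemb : IsProjectiveEmbedding n emb) (e : atlas (Fin n → ℂ) X) {x : X}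
    (hx : x ∈ e.1.source) : ∃ ψ : (Fin n → ℂ) → Fin (M + 1) → ℂ,
      ContDiffAt ℂ ω ψ (e.1 x) ∧ HasProjectiveLift emb e.1.symm ψ (e.1 x) ∧
      ∀ (v : Fin n → ℂ) (c : ℂ), fderiv ℂ ψ (e.1 x) v = c • ψ (e.1 x) → v = 0 := by
  obtain ⟨φ, hφc, hφ, himm⟩ := hemb.exists_lift x
  have hxt := e.1.map_source hx
  have hsymm := contMDiffAt_chart_symm e hxt
  have hφc' : ContMDiffAt 𝓘(ℂ, Fin n → ℂ) 𝓘(ℂ, Fin (M + 1) → ℂ) ω φ (e.1.symm (e.1 x)) := by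
    rwa [e.1.left_inv hx]
  refine ⟨φ ∘ e.1.symm, ?_, ?_, ?_⟩
  · rw [← contMDiffAt_iff_contDiffAt]
    exact hφc'.comp (e.1 x) hsymm
  · have : Tendsto e.1.symm (𝓝 (e.1 x)) (𝓝 x) := by
      have := (e.1.continuousAt_symm hxt).tendsto
      rwa [e.1.left_inv hx] at this
    exact this.eventually hφ
  · intro v c hv
    have hd1 : MDifferentiableAt 𝓘(ℂ, Fin n → ℂ) 𝓘(ℂ, Fin n → ℂ) e.1.symm (e.1 x) :=
      hsymm.mdifferentiableAt (by simp)
    have hd2 : MDifferentiableAt 𝓘(ℂ, Fin n → ℂ) 𝓘(ℂ, Fin (M + 1) → ℂ) φ (e.1.symm (e.1 x)) :=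
      hφc'.mdifferentiableAt (by simp)
    have hd3 : MDifferentiableAt 𝓘(ℂ, Fin n → ℂ) 𝓘(ℂ, Fin n → ℂ) e.1 (e.1.symm (e.1 x)) := by
      rw [e.1.left_inv hx]
      exact (contMDiffAt_chart e hx).mdifferentiableAt (by simp)
    have hcomp := mfderiv_comp (e.1 x) hd2 hd1
    rw [mfderiv_eq_fderiv] at hcomp
    have h1 : mfderiv 𝓘(ℂ, Fin n → ℂ) 𝓘(ℂ, Fin n → ℂ) e.1.symm (e.1 x) v = 0 := by
      -- The tangent space depends on its base point, and `e.symm (e x)` equals `x` only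
      -- propositionally, so the base point is generalised before substituting.
      have key : ∀ y : X, y = x → ∀ u : TangentSpace 𝓘(ℂ, Fin n → ℂ) y, 
          mfderiv 𝓘(ℂ, Fin n → ℂ) 𝓘(ℂ, Fin (M + 1) → ℂ) φ y u = c • φ y → u = 0 := by
        rintro y rfl u hu
        exact himm u c hu
      refine key _ (e.1.left_inv hx) _ ?_
      rw [hcomp] at hv
      exact hv
    have hid := mfderiv_comp (e.1 x) hd3 hd1
    rw [mfderiv_eq_fderiv] at hid
    have hid2 : fderiv ℂ (e.1 ∘ e.1.symm) (e.1 x) = ContinuousLinearMap.id ℂ _ := by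
      have : (e.1 ∘ e.1.symm) =ᶠ[𝓝 (e.1 x)] id := by
        filter_upwards [e.1.open_target.mem_nhds hxt] with w hw using e.1.right_inv hw
      rw [this.fderiv_eq]
      exact fderiv_id
    have h2 : v = (fderiv ℂ (e.1 ∘ e.1.symm) (e.1 x)) v := by rw [hid2]; rfl
    rw [h2, hid]
    change (mfderiv 𝓘(ℂ, Fin n → ℂ) 𝓘(ℂ, Fin n → ℂ) e.1 (e.1.symm (e.1 x)))
      (mfderiv 𝓘(ℂ, Fin n → ℂ) 𝓘(ℂ, Fin n → ℂ) e.1.symm (e.1 x) v) = 0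
    rw [h1, map_zero]

/-- In affine coordinates `α` the embedding is an immersion, so a linear projection `π` makes `π ∘
α` locally invertible. Applying the holomorphic local inverse to `π` of the affine coordinates of
`q` recovers `e ∘ Z`. -/
theorem eventually_differentiableAt_chart_comp [CompactSpace X]
    (hemb : IsProjectiveEmbedding n emb)
    {E : Type*} [NormedAddCommGroup E] [NormedSpace ℂ E] {Z : E → X} {q : E → Fin (M + 1) → ℂ}
    {z₀ : E} (hq : ∀ᶠ z in 𝓝 z₀, DifferentiableAt ℂ q z) (h : HasProjectiveLift emb Z q z₀)
    (e : atlas (Fin n → ℂ) X) (he : Z z₀ ∈ e.1.source) :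
    ∀ᶠ z in 𝓝 z₀, DifferentiableAt ℂ (e.1 ∘ Z) z := by
  have hZ := continuousAt_of_hasProjectiveLift hemb hq.self_of_nhds.continuousAt h
  obtain ⟨ψ, hψc, hψ, himm⟩ := exists_chart_lift hemb e he
  set w₀ := e.1 (Z z₀) with hw₀
  obtain ⟨hψ0, hψ1⟩ := hψ.self_of_nhds
  obtain ⟨j, hj⟩ := Function.ne_iff.1 hψ0
  simp only [Pi.zero_apply] at hj
  -- the affine coordinates
  set α : (Fin n → ℂ) → Fin (M + 1) → ℂ := fun w i => ψ w i * (ψ w j)⁻¹ with hα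
  have hαc : ContDiffAt ℂ ω α w₀ := by
    rw [contDiffAt_pi]
    intro i
    exact (contDiffAt_pi.1 hψc i).mul ((contDiffAt_pi.1 hψc j).inv hj)
  have hψd : ∀ i, HasFDerivAt (fun w => ψ w i)
      ((ContinuousLinearMap.proj i).comp (fderiv ℂ ψ w₀)) w₀ := fun i =>
    hasFDerivAt_pi'.1 (hψc.differentiableAt (by simp)).hasFDerivAt i
  have hψmul : ∀ᶠ w in 𝓝 w₀, ∀ i, ψ w i = α w i * ψ w j := by
    filter_upwards [(hψd j).continuousAt.eventually_ne hj] with w hw i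
    simp only [hα]
    field_simp
  have hαd : ∀ i, HasFDerivAt (fun w => α w i)
      ((ContinuousLinearMap.proj i).comp (fderiv ℂ α w₀)) w₀ := fun i =>
    hasFDerivAt_pi'.1 (hαc.differentiableAt (by simp)).hasFDerivAt i
  -- Differentiating `ψ i = α i * ψ j` shows that a vector killed by `dα` is sent by `dψ` into the
  -- line of `ψ w₀`; the immersion condition excludes this unless the vector is zero.
  have hker : LinearMap.ker (fderiv ℂ α w₀ : (Fin n → ℂ) →ₗ[ℂ] (Fin (M + 1) → ℂ)) = ⊥ := by
    rw [LinearMap.ker_eq_bot']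
    intro v hv
    have hv' : fderiv ℂ α w₀ v = 0 := hv
    refine himm v ((fderiv ℂ ψ w₀ v j) * (ψ w₀ j)⁻¹) ?_
    ext i
    have h1 : HasFDerivAt (fun w => ψ w i) _ w₀ := ((hαd i).mul (hψd j)).congr_of_eventuallyEq
      (by filter_upwards [hψmul] with w hw using hw i)
    have h2 := DFunLike.congr_fun ((hψd i).unique h1) v
    simp [hv'] at h2
    rw [h2]
    simp [hα]
    ring
  obtain ⟨π, hπ⟩ := LinearMap.exists_leftInverse_of_injective _ hker
  set πc : (Fin (M + 1) → ℂ) →L[ℂ] (Fin n → ℂ) := LinearMap.toContinuousLinearMap π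
  have hβc : ContDiffAt ℂ ω (πc ∘ α) w₀ := πc.contDiff.contDiffAt.comp w₀ hαc
  have hβd : HasFDerivAt (πc ∘ α)
      ((ContinuousLinearEquiv.refl ℂ (Fin n → ℂ) : (Fin n → ℂ) →L[ℂ] (Fin n → ℂ))) w₀ := by
    have h1 := πc.hasFDerivAt.comp w₀ (hαc.differentiableAt (by simp)).hasFDerivAt
    have h2 : πc.comp (fderiv ℂ α w₀) =
        (ContinuousLinearEquiv.refl ℂ (Fin n → ℂ) : (Fin n → ℂ) →L[ℂ] (Fin n → ℂ)) :=
      ContinuousLinearMap.ext fun v => DFunLike.congr_fun hπ v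
    rwa [h2] at h1
  have hne : (ω : WithTop ℕ∞) ≠ 0 := by simp
  have hinvc := hβc.to_localInverse hβd hne
  have hinv := (hβc.hasStrictFDerivAt' hβd hne).eventually_left_inverse
  set L := hβc.localInverse hβd hne with hL
  have hinv' : ∀ᶠ w in 𝓝 w₀, L ((πc ∘ α) w) = w := hinv
  have hLd : ∀ᶠ u in 𝓝 ((πc ∘ α) w₀), DifferentiableAt ℂ L u := by
    filter_upwards [hinvc.eventually (by simp)] with u hu using hu.differentiableAt (by simp)
  have heZ : Tendsto (fun z => e.1 (Z z)) (𝓝 z₀) (𝓝 w₀) :=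
    (e.1.continuousAt he).tendsto.comp hZ.tendsto
  have hkey : ∀ᶠ z in 𝓝 z₀, q z j ≠ 0 ∧ α (e.1 (Z z)) = fun i => q z i * (q z j)⁻¹ := by
    filter_upwards [heZ.eventually hψ, h, hZ.eventually_mem (e.1.open_source.mem_nhds he),
      heZ.eventually ((hψd j).continuousAt.eventually_ne hj)] with z hz1 hz2 hz3 hz4
    obtain ⟨h1, h1'⟩ := hz1
    obtain ⟨h2, h2'⟩ := hz2
    rw [e.1.left_inv hz3] at h1'
    have hcol := (mk_eq_mk_iff_mul_eq h1 h2).1 (h1'.symm.trans h2')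
    have hqj : q z j ≠ 0 := by
      intro h0
      apply h2
      ext i
      have := hcol j i
      rw [h0, mul_zero] at this
      exact (mul_eq_zero.1 this).resolve_left hz4
    refine ⟨hqj, ?_⟩
    ext i
    simp only [hα]
    rw [mul_inv_eq_iff_eq_mul₀ hz4]
    field_simp
    linear_combination hcol i j
  have hfin : ∀ᶠ z in 𝓝 z₀, (e.1 ∘ Z) z = L (πc fun i => q z i * (q z j)⁻¹) := by
    filter_upwards [hkey, heZ.eventually hinv'] with z hz1 hz2
    rw [← hz1.2]
    exact hz2.symm
  have hαe : Tendsto (fun z => (πc ∘ α) (e.1 (Z z))) (𝓝 z₀) (𝓝 ((πc ∘ α) w₀)) :=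
    hβc.continuousAt.tendsto.comp heZ
  filter_upwards [hfin.eventually_nhds, hkey, hq, hαe.eventually hLd] with z hz1 hz2 hz3 hz4
  refine DifferentiableAt.congr_of_eventuallyEq ?_ hz1
  have h1 : DifferentiableAt ℂ (fun z => πc fun i => q z i * (q z j)⁻¹) z := by
    refine πc.differentiableAt.comp z (differentiableAt_pi.2 fun i => ?_)
    exact (differentiableAt_pi.1 hz3 i).mul ((differentiableAt_pi.1 hz3 j).inv hz2.1)
  refine DifferentiableAt.comp (g := L) z ?_ h1
  have h2 := hz4
  simp only [Function.comp_apply, hz2.2] at h2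
  exact h2

end Maps

/-! ### Pull-back of pluricanonical forms -/

section PullCoeff

theorem hasProjectiveLift_of_ne_zero {E X : Type*} [TopologicalSpace E] {M : ℕ}
    {emb : X → ℙ ℂ (Fin (M + 1) → ℂ)} {O : Set E} {a : E → ℂ} {g : Fin (M + 1) → E → ℂ} {Z : E → X}
    (hO : IsOpen O) (ha : ContinuousOn a O)
    (hZ : ∀ z ∈ O, a z ≠ 0 → ∃ h : (fun j => g j z) ≠ 0,
      emb (Z z) = Projectivization.mk ℂ (fun j => g j z) h) {z : E} (hz : z ∈ O)
    (haz : a z ≠ 0) : HasProjectiveLift emb Z (fun z j => g j z) z := by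
  filter_upwards [(isOpen_inter_ne_zero hO ha).mem_nhds ⟨hz, haz⟩] with y hy
    using hZ y hy.1 hy.2


variable {n M k : ℕ} {X : Type*} [TopologicalSpace X] [ChartedSpace (Fin n → ℂ) X]
  {emb : X → ℙ ℂ (Fin (M + 1) → ℂ)}

/-- The coefficient at `z` of the pull-back of the form `s` under the map `Z` from an open subset
of `ℂⁿ` to `X`. -/
noncomputable def pullCoeff (s : pluricanonicalForms n X k) (Z : (Fin n → ℂ) → X)
    (z : Fin n → ℂ) : ℂ :=
  s.1 (achart _ (Z z)) ((achart (Fin n → ℂ) (Z z)).1 (Z z)) *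
    (fderiv ℂ ((achart (Fin n → ℂ) (Z z)).1 ∘ Z) z).det ^ k

theorem pullCoeff_congr (s : pluricanonicalForms n X k) {Z Z' : (Fin n → ℂ) → X} {z : Fin n → ℂ}
    (h : Z =ᶠ[𝓝 z] Z') : pullCoeff s Z z = pullCoeff s Z' z := by
  have h0 := h.self_of_nhds
  unfold pullCoeff
  rw [h0]
  have : ((achart (Fin n → ℂ) (Z' z)).1 ∘ Z) =ᶠ[𝓝 z] ((achart (Fin n → ℂ) (Z' z)).1 ∘ Z') := by
    filter_upwards [h] with y hy
    simp [hy]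
  rw [this.fderiv_eq]

theorem det_fderiv_eq (f : (Fin n → ℂ) → Fin n → ℂ) {z : Fin n → ℂ} (hf : DifferentiableAt ℂ f z) :
    (fderiv ℂ f z).det = (Matrix.of fun i j : Fin n =>
      fderiv ℂ (fun z => f z i) z (Pi.single j 1)).det := by
  rw [ContinuousLinearMap.det, ← LinearMap.det_toMatrix']
  congr 1
  ext i j
  rw [LinearMap.toMatrix'_apply, Matrix.of_apply]
  have h1 : HasFDerivAt (fun z => f z i)
      ((ContinuousLinearMap.proj i).comp (fderiv ℂ f z)) z := hasFDerivAt_pi'.1 hf.hasFDerivAt i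
  rw [h1.fderiv]
  simp

/-- The determinant is a polynomial in the partial derivatives, which are themselves holomorphic. -/
theorem eventually_differentiableAt_det_fderiv {f : (Fin n → ℂ) → Fin n → ℂ} {z₀ : Fin n → ℂ}
    (hf : ∀ᶠ z in 𝓝 z₀, DifferentiableAt ℂ f z) :
    DifferentiableAt ℂ (fun z => (fderiv ℂ f z).det) z₀ := by
  obtain ⟨O, hOf, hO, hz₀⟩ := eventually_nhds_iff.1 hf
  have h1 : (fun z => (fderiv ℂ f z).det) =ᶠ[𝓝 z₀] fun z => ∑ σ : Equiv.Perm (Fin n),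
      ((Equiv.Perm.sign σ : ℤ) : ℂ) *
        ∏ i, fderiv ℂ (fun z => f z (σ i)) z (Pi.single i 1) := by
    filter_upwards [hf] with z hz
    rw [det_fderiv_eq f hz, Matrix.det_apply']
    rfl
  refine DifferentiableAt.congr_of_eventuallyEq ?_ h1
  refine DifferentiableAt.fun_sum fun σ _ => DifferentiableAt.const_mul ?_ _
  have h2 : ∀ i, DifferentiableAt ℂ
      (fun z => fderiv ℂ (fun z => f z (σ i)) z (Pi.single i 1)) z₀ := fun i =>
    differentiableAt_fderiv_apply hO (fun z hz => (differentiableAt_pi.1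
      (hOf z hz) (σ i)).differentiableWithinAt) hz₀ _
  exact (HasFDerivAt.finsetProd fun i _ => (h2 i).hasFDerivAt).differentiableAt

/-- The homogeneous equations of the image pass to limits. This keeps an extended map inside the
variety. -/
theorem mem_range_of_frequently (hemb : IsProjectiveEmbedding n emb) {Y : Type*}
    [TopologicalSpace Y] {Q : Y → Fin (M + 1) → ℂ} {p : Y} (hQ : ContinuousAt Q p)
    (hp : Q p ≠ 0)
    (h : ∃ᶠ z in 𝓝 p, ∃ hne : Q z ≠ 0, Projectivization.mk ℂ (Q z) hne ∈ range emb) :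
    Projectivization.mk ℂ (Q p) hp ∈ range emb := by
  obtain ⟨S, hS, hr⟩ := hemb.isZariskiClosed_range
  rw [hr]
  intro f hf
  obtain ⟨d, hd⟩ := hS f hf
  rw [eval_rep_mk_eq_zero_iff hd hp]
  have hc : ContinuousAt (fun z => MvPolynomial.eval (Q z) f) p :=
    (MvPolynomial.continuous_eval f).continuousAt.comp hQ
  refine eq_of_frequently_eq (f := fun z => MvPolynomial.eval (Q z) f) (g := fun _ => (0 : ℂ)) hc
    continuousAt_const ?_
  refine h.mono fun z hz => ?_
  obtain ⟨hne, hz⟩ := hz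
  rw [hr] at hz
  exact (eval_rep_mk_eq_zero_iff hd hne).1 (hz f hf)

variable [IsManifold 𝓘(ℂ, Fin n → ℂ) ω X]

/-- The transformation rule cancels against the chain rule. This matters because the preferred chart
at `Z z` used in `pullCoeff` may jump with `z`, whereas holomorphy is visible only in a fixed chart.
-/
theorem pullCoeff_eq (s : pluricanonicalForms n X k) {Z : (Fin n → ℂ) → X} {z : Fin n → ℂ}
    (hZ : ContinuousAt Z z) (e : atlas (Fin n → ℂ) X) (he : Z z ∈ e.1.source)
    (hd : DifferentiableAt ℂ (e.1 ∘ Z) z) :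
    pullCoeff s Z z = s.1 e (e.1 (Z z)) * (fderiv ℂ (e.1 ∘ Z) z).det ^ k := by
  set e' := achart (Fin n → ℂ) (Z z) with he'
  have hmem : Z z ∈ e'.1.source := mem_chart_source _ (Z z)
  have h1 := s.2.2.2 e e' (Z z) ⟨he, hmem⟩
  have h2 : (e'.1 ∘ Z) =ᶠ[𝓝 z] (e'.1 ∘ e.1.symm) ∘ (e.1 ∘ Z) := by
    filter_upwards [hZ.eventually_mem (e.1.open_source.mem_nhds he)] with y hy
    simp [e.1.left_inv hy]
  have ht : DifferentiableAt ℂ (e'.1 ∘ e.1.symm) ((e.1 ∘ Z) z) :=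
    (contDiffAt_transition e e' he hmem).differentiableAt (by simp)
  have h3 : fderiv ℂ (e'.1 ∘ Z) z =
      (fderiv ℂ (e'.1 ∘ e.1.symm) (e.1 (Z z))).comp (fderiv ℂ (e.1 ∘ Z) z) := by
    rw [h2.fderiv_eq, fderiv_comp z ht hd]
    rfl
  have h4 : (fderiv ℂ (e'.1 ∘ Z) z).det =
      (fderiv ℂ (e'.1 ∘ e.1.symm) (e.1 (Z z))).det * (fderiv ℂ (e.1 ∘ Z) z).det := by
    rw [h3]
    exact LinearMap.det_comp _ _
  unfold pullCoeff
  rw [← he', h4, h1, mul_pow]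
  ring

theorem eventually_differentiableAt_pullCoeff [CompactSpace X] (hemb : IsProjectiveEmbedding n emb)
    (s : pluricanonicalForms n X k) {Z : (Fin n → ℂ) → X} {q : (Fin n → ℂ) → Fin (M + 1) → ℂ}
    {z₀ : Fin n → ℂ} (hq : ∀ᶠ z in 𝓝 z₀, DifferentiableAt ℂ q z)
    (h : HasProjectiveLift emb Z q z₀) :
    ∀ᶠ z in 𝓝 z₀, DifferentiableAt ℂ (pullCoeff s Z) z := by
  set e := achart (Fin n → ℂ) (Z z₀)
  have he : Z z₀ ∈ e.1.source := mem_chart_source _ (Z z₀)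
  have hd := eventually_differentiableAt_chart_comp hemb hq h e he
  have hc : ∀ᶠ z in 𝓝 z₀, ContinuousAt Z z := by
    filter_upwards [hq, h.eventually_nhds] with z h1 h2 using
      continuousAt_of_hasProjectiveLift hemb h1.continuousAt h2
  have hmem := hc.self_of_nhds.eventually_mem (e.1.open_source.mem_nhds he)
  have heq : ∀ᶠ z in 𝓝 z₀, pullCoeff s Z z =
      s.1 e (e.1 (Z z)) * (fderiv ℂ (e.1 ∘ Z) z).det ^ k := by
    filter_upwards [hd, hc, hmem] with z h1 h2 h3 using pullCoeff_eq s h2 e h3 h1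
  filter_upwards [heq.eventually_nhds, hd.eventually_nhds, hmem] with z h1 h2 h3
  refine DifferentiableAt.congr_of_eventuallyEq ?_ h1
  refine DifferentiableAt.fun_mul ?_ ((eventually_differentiableAt_det_fderiv h2).fun_pow k)
  have h4 : DifferentiableAt ℂ (s.1 e) ((e.1 ∘ Z) z) :=
    (s.2.1 e).differentiableAt (e.1.open_target.mem_nhds (e.1.map_source h3))
  exact h4.comp z h2.self_of_nhds

variable {O : Set (Fin n → ℂ)} {a : (Fin n → ℂ) → ℂ} {g : Fin (M + 1) → (Fin n → ℂ) → ℂ}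
  {Z : (Fin n → ℂ) → X}

/-- The pull-back of a form extends across a point near which one of the homogeneous coordinates
dominates the others. -/
theorem extendsAt_pullCoeff_of_dominated [CompactSpace X] (hemb : IsProjectiveEmbedding n emb)
    (s : pluricanonicalForms n X k) (hO : IsOpen O) (ha : DifferentiableOn ℂ a O)
    (ha0 : ∀ z ∈ O, ∃ᶠ y in 𝓝 z, a y ≠ 0) (hg : ∀ j, DifferentiableOn ℂ (g j) O)
    (hZ : ∀ z ∈ O, a z ≠ 0 → ∃ h : (fun j => g j z) ≠ 0,
      emb (Z z) = Projectivization.mk ℂ (fun j => g j z) h)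
    {p : Fin n → ℂ} (hp : p ∈ O) {j : Fin (M + 1)}
    (hj : ∀ᶠ z in 𝓝 p, ∀ i, ‖g i z‖ ≤ 2 * ‖g j z‖) : ExtendsAt a (pullCoeff s Z) p := by
  obtain ⟨B, hBs, hB, hpB⟩ := eventually_nhds_iff.1 (hj.and (hO.mem_nhds hp))
  -- A zero of the dominating coordinate is a common zero of all of them, which the projective lift
  -- excludes where `a ≠ 0`.
  have hgj : ∀ z ∈ B, a z ≠ 0 → g j z ≠ 0 := by
    intro z hz haz h0
    obtain ⟨hne, -⟩ := hZ z (hBs z hz).2 haz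
    apply hne
    ext i
    have := (hBs z hz).1 i
    rw [h0, norm_zero, mul_zero] at this
    exact norm_le_zero_iff.1 this
  have hext : ∀ i, ExtendsAt (g j) (fun z => g i z / g j z) p := by
    intro i
    refine extendsAt_of_bounded hB ((hg j).mono fun z hz => (hBs z hz).2) (C := 2) ?_ ?_ hpB ?_
    · intro z hz hne
      have h1 := (hg i).differentiableAt (hO.mem_nhds (hBs z hz).2)
      have h2 := (hg j).differentiableAt (hO.mem_nhds (hBs z hz).2)
      simp only [div_eq_mul_inv]
      exact h1.fun_mul (h2.fun_inv hne)
    · intro z hz hne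
      rw [norm_div, div_le_iff₀ (norm_pos_iff.2 hne)]
      exact (hBs z hz).1 i
    · refine (ha0 p hp).mp ?_
      filter_upwards [hB.mem_nhds hpB] with z hz haz using hgj z hz haz
  choose Q hQd hQ using hext
  -- Setting the `j`-th coordinate to the constant 1 keeps `R` nonzero even at common zeros of the
  -- `g i`, so `R` lifts an extension of `Z`.
  set R : (Fin n → ℂ) → Fin (M + 1) → ℂ := fun z i => if i = j then 1 else Q i z with hR
  have hRne : ∀ z, R z ≠ 0 := fun z h0 => by simpa [hR] using congrFun h0 j
  have hRd : ∀ᶠ z in 𝓝 p, DifferentiableAt ℂ R z := by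
    filter_upwards [eventually_all.2 hQd] with z hz
    refine differentiableAt_pi.2 fun i => ?_
    by_cases hi : i = j
    · simp [hR, hi]
    · simpa [hR, hi] using hz i
  have hRZ : ∀ᶠ z in 𝓝 p, a z ≠ 0 → emb (Z z) = Projectivization.mk ℂ (R z) (hRne z) := by
    filter_upwards [eventually_all.2 hQ, hB.mem_nhds hpB] with z h1 h2 haz
    obtain ⟨hne, hz⟩ := hZ z (hBs z h2).2 haz
    have h0 := hgj z h2 haz
    have hRi : ∀ i, R z i = g i z / g j z := by
      intro i
      by_cases hi : i = j
      · simp [hR, hi, h0]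
      · simp [hR, hi, h1 i h0]
    rw [hz, mk_eq_mk_iff_mul_eq]
    intro i i'
    rw [hRi, hRi]
    ring
  have hrange : ∀ᶠ z in 𝓝 p, Projectivization.mk ℂ (R z) (hRne z) ∈ range emb := by
    filter_upwards [hRd, hRZ.eventually_nhds, hO.mem_nhds hp] with z h1 h2 h3
    refine mem_range_of_frequently hemb h1.continuousAt (hRne z) ?_
    refine (ha0 z h3).mp ?_
    filter_upwards [h2] with y hy hay
    exact ⟨hRne y, Z y, hy hay⟩
  have : Nonempty X := ⟨Z p⟩
  choose! Z' hZ' using fun z (h : Projectivization.mk ℂ (R z) (hRne z) ∈ range emb) => h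
  have hlift : HasProjectiveLift emb Z' R p := by
    filter_upwards [hrange] with z hz using ⟨hRne z, hZ' z hz⟩
  refine ⟨pullCoeff s Z', eventually_differentiableAt_pullCoeff hemb s hRd hlift, ?_⟩
  have heq : ∀ᶠ z in 𝓝 p, a z ≠ 0 → Z' z = Z z := by
    filter_upwards [hrange, hRZ] with z h1 h2 haz
    exact hemb.injective ((hZ' z h1).trans (h2 haz).symm)
  filter_upwards [heq.eventually_nhds, hO.mem_nhds hp] with z h1 h2 haz
  refine pullCoeff_congr s ?_
  filter_upwards [h1, (isOpen_inter_ne_zero hO ha.continuousOn).mem_nhds ⟨h2, haz⟩] with y h3 h4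
    using h3 h4.2

/-- The pull-back of a form under a map which is given by homogeneous coordinates outside of the
zero set of `a` extends holomorphically. -/
theorem extendsAt_pullCoeff [CompactSpace X] (hemb : IsProjectiveEmbedding n emb)
    (s : pluricanonicalForms n X k) (hO : IsOpen O) (ha : DifferentiableOn ℂ a O)
    (ha0 : ∀ z ∈ O, ∃ᶠ y in 𝓝 z, a y ≠ 0) (hg : ∀ j, DifferentiableOn ℂ (g j) O)
    (hZ : ∀ z ∈ O, a z ≠ 0 → ∃ h : (fun j => g j z) ≠ 0,
      emb (Z z) = Projectivization.mk ℂ (fun j => g j z) h)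
    {p : Fin n → ℂ} (hp : p ∈ O) : ExtendsAt a (pullCoeff s Z) p := by
  obtain ⟨v, hcl, hs⟩ := exists_circle_ne_zero
    (ha.eventually_differentiableAt (hO.mem_nhds hp)) (ha0 p hp) (hO.mem_nhds hp)
  -- The mean value formula remains to be shown for a dense set of centres; discs with a dominating
  -- coordinate near each of their points provide it.
  refine extendsAt_of_eq_circleMean hO ha (fun z hz haz => ?_) hcl hs ?_
  · refine (eventually_differentiableAt_pullCoeff hemb s (q := fun z j => g j z) ?_
      (hasProjectiveLift_of_ne_zero hO ha.continuousOn hZ hz haz)).self_of_nhds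
    filter_upwards [hO.mem_nhds hz] with y hy
    exact differentiableAt_pi.2 fun j => (hg j).differentiableAt (hO.mem_nhds hy)
  · have hO' := isOpen_inter_ne_zero hO ha.continuousOn
    filter_upwards [eventually_mem_closure_dominated hO hg hcl,
      (eventually_forall_add_smul_mem hO' (isCompact_sphere 0 1)
        fun τ hτ => ⟨hcl τ (Metric.sphere_subset_closedBall hτ), hs τ hτ⟩).eventually_nhds]
      with y hy1 hy2
    rw [mem_closure_iff_frequently] at hy1 ⊢
    refine hy1.mp ?_
    filter_upwards [hy2] with y' h2 h1 hay
    refine eq_circleMean_of_extendsAt hO ha0 (fun τ hτ => ⟨(h1 τ hτ).1, ?_⟩)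
      (fun τ hτ => (h2 τ hτ).2) hay
    obtain ⟨hmem, j, hj⟩ := h1 τ hτ
    exact extendsAt_pullCoeff_of_dominated hemb s hO ha ha0 hg hZ hmem hj

end PullCoeff

/-! ### Principal Zariski open sets -/

section PolyNe

variable {n M : ℕ} {X : Type*} {emb : X → ℙ ℂ (Fin (M + 1) → ℂ)}

/-- The principal Zariski open set on which the homogeneous polynomial `P` does not vanish. -/
def polyNe (emb : X → ℙ ℂ (Fin (M + 1) → ℂ)) (P : MvPolynomial (Fin (M + 1)) ℂ) : Set X :=
  {x | MvPolynomial.eval (emb x).rep P ≠ 0}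

theorem mem_polyNe_iff_of_eq_mk {P : MvPolynomial (Fin (M + 1)) ℂ} {d : ℕ} (hP : P.IsHomogeneous d)
    {x : X} {v : Fin (M + 1) → ℂ} {hv : v ≠ 0} (hx : emb x = Projectivization.mk ℂ v hv) :
    x ∈ polyNe emb P ↔ MvPolynomial.eval v P ≠ 0 := by
  change MvPolynomial.eval (emb x).rep P ≠ 0 ↔ _
  rw [hx, Ne, eval_rep_mk_eq_zero_iff hP hv]

theorem IsZariskiOpen.exists_polyNe_subset {U : Set X} (hU : IsZariskiOpen emb U) {x : X}
    (hx : x ∈ U) : ∃ (P : MvPolynomial (Fin (M + 1)) ℂ) (d : ℕ), P.IsHomogeneous d ∧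
      x ∈ polyNe emb P ∧ polyNe emb P ⊆ U := by
  obtain ⟨_, ⟨S, hS, rfl⟩, rfl⟩ := hU
  obtain ⟨P, hP, hPx⟩ : ∃ P ∈ S, MvPolynomial.eval (emb x).rep P ≠ 0 := by
    by_contra! h
    exact hx h
  obtain ⟨d, hd⟩ := hS P hP
  exact ⟨P, d, hd, hPx, fun y hy h => hy (h P hP)⟩

/-- The common degree makes the image point independent of the representative, so the arbitrary
`rep` can be exchanged for a holomorphic lift. -/
theorem mk_eval_rep_eq {M' d : ℕ} {p : Fin (M' + 1) → MvPolynomial (Fin (M + 1)) ℂ}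
    (hp : ∀ j, (p j).IsHomogeneous d) {x : ℙ ℂ (Fin (M + 1) → ℂ)} {v : Fin (M + 1) → ℂ}
    {hv : v ≠ 0} (hx : x = Projectivization.mk ℂ v hv)
    (h : (fun j => MvPolynomial.eval x.rep (p j)) ≠ 0) :
    ∃ h' : (fun j => MvPolynomial.eval v (p j)) ≠ 0,
      Projectivization.mk ℂ _ h = Projectivization.mk ℂ _ h' := by
  obtain ⟨c, hc⟩ := Projectivization.exists_smul_eq_mk_rep ℂ v hv
  have hrep : x.rep = (c : ℂ) • v := by rw [hx, ← hc]; rfl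
  have heq : (fun j => MvPolynomial.eval x.rep (p j)) =
      (c : ℂ) ^ d • fun j => MvPolynomial.eval v (p j) := by
    ext j
    rw [hrep, eval_smul_of_isHomogeneous (hp j)]
    rfl
  have h' : (fun j => MvPolynomial.eval v (p j)) ≠ 0 := by
    intro h0
    rw [h0, smul_zero] at heq
    exact h heq
  exact ⟨h', (Projectivization.mk_eq_mk_iff' ..).2 ⟨(c : ℂ) ^ d, heq.symm⟩⟩

variable [TopologicalSpace X] [ChartedSpace (Fin n → ℂ) X] [IsManifold 𝓘(ℂ, Fin n → ℂ) ω X]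

/-- On a small ball in a chart, a projective embedding has a holomorphic lift. -/
theorem exists_ball_lift (hemb : IsProjectiveEmbedding n emb) (e : atlas (Fin n → ℂ) X)
    {w : Fin n → ℂ} (hw : w ∈ e.1.target) : ∃ ρ > 0, Metric.ball w ρ ⊆ e.1.target ∧
      ∃ ψ : (Fin n → ℂ) → Fin (M + 1) → ℂ, DifferentiableOn ℂ ψ (Metric.ball w ρ) ∧
        ∀ z ∈ Metric.ball w ρ, ∃ h : ψ z ≠ 0, emb (e.1.symm z) = Projectivization.mk ℂ (ψ z) h := by
  obtain ⟨ψ, h1, h2, -⟩ := exists_chart_lift hemb e (e.1.map_target hw)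
  rw [e.1.right_inv hw] at h1 h2
  have h3 : ∀ᶠ z in 𝓝 w, DifferentiableAt ℂ ψ z := by
    filter_upwards [h1.eventually (by simp)] with u hu using hu.differentiableAt (by simp)
  obtain ⟨ρ, hρ, h⟩ := Metric.mem_nhds_iff.1
    (inter_mem (inter_mem h3 h2) (e.1.open_target.mem_nhds hw))
  exact ⟨ρ, hρ, fun z hz => (h hz).2, ψ, fun z hz => (h hz).1.1.differentiableWithinAt,
    fun z hz => (h hz).1.2⟩

theorem exists_ball_equation (hemb : IsProjectiveEmbedding n emb) (e : atlas (Fin n → ℂ) X)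
    {w : Fin n → ℂ} (hw : w ∈ e.1.target) {P : MvPolynomial (Fin (M + 1)) ℂ} {d : ℕ}
    (hP : P.IsHomogeneous d) : ∃ ρ > 0, Metric.ball w ρ ⊆ e.1.target ∧
      ∃ a : (Fin n → ℂ) → ℂ, DifferentiableOn ℂ a (Metric.ball w ρ) ∧
        ∀ z ∈ Metric.ball w ρ, e.1.symm z ∈ polyNe emb P ↔ a z ≠ 0 := by
  obtain ⟨ρ, hρ, hρt, ψ, hψ, hψe⟩ := exists_ball_lift hemb e hw
  refine ⟨ρ, hρ, hρt, fun z => MvPolynomial.eval (ψ z) P, fun z hz => ?_, fun z hz => ?_⟩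
  · exact (differentiableAt_eval_comp P
      (hψ.differentiableAt (Metric.isOpen_ball.mem_nhds hz))).differentiableWithinAt
  · obtain ⟨h, hz'⟩ := hψe z hz
    exact mem_polyNe_iff_of_eq_mk hP hz'

theorem isOpen_polyNe (hemb : IsProjectiveEmbedding n emb) {P : MvPolynomial (Fin (M + 1)) ℂ}
    {d : ℕ} (hP : P.IsHomogeneous d) : IsOpen (polyNe emb P) := by
  refine isOpen_iff_mem_nhds.2 fun x hx => ?_
  set e := achart (Fin n → ℂ) x
  have hxe : x ∈ e.1.source := mem_chart_source _ x
  obtain ⟨ρ, hρ, hρt, a, ha, haP⟩ := exists_ball_equation hemb e (e.1.map_source hxe) hP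
  have h1 : ∀ᶠ z in 𝓝 (e.1 x), z ∈ Metric.ball (e.1 x) ρ ∩ {z | a z ≠ 0} := by
    refine (isOpen_inter_ne_zero Metric.isOpen_ball ha.continuousOn).mem_nhds
      ⟨Metric.mem_ball_self hρ, ?_⟩
    rw [mem_ofPred_eq, ← haP _ (Metric.mem_ball_self hρ), e.1.left_inv hxe]
    exact hx
  filter_upwards [(e.1.continuousAt hxe).eventually h1, e.1.open_source.mem_nhds hxe] with y hy hye
  have := (haP _ hy.1).2 hy.2
  rwa [e.1.left_inv hye] at this

/-- By the identity theorem on balls in charts, the set of points near which `P` vanishes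
identically is both open and closed. Connectedness leaves only the empty set. -/
theorem frequently_mem_polyNe [ConnectedSpace X] (hemb : IsProjectiveEmbedding n emb)
    {P : MvPolynomial (Fin (M + 1)) ℂ} {d : ℕ} (hP : P.IsHomogeneous d)
    (hne : (polyNe emb P).Nonempty) (x : X) : ∃ᶠ y in 𝓝 x, y ∈ polyNe emb P := by
  set C : Set X := {x | ∀ᶠ y in 𝓝 x, y ∉ polyNe emb P} with hC
  have hCo : IsOpen C := isOpen_setOfPred_eventually_nhds
  have hCc : IsClosed C := by
    refine isClosed_of_closure_subset fun x hx => ?_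
    set e := achart (Fin n → ℂ) x
    have hxe : x ∈ e.1.source := mem_chart_source _ x
    obtain ⟨ρ, hρ, hρt, a, ha, haP⟩ := exists_ball_equation hemb e (e.1.map_source hxe) hP
    have hnear : ∀ᶠ y in 𝓝 x, y ∈ e.1.source ∧ e.1 y ∈ Metric.ball (e.1 x) ρ :=
      (e.1.open_source.eventually_mem hxe).and
        ((e.1.continuousAt hxe).eventually_mem (Metric.ball_mem_nhds _ hρ))
    obtain ⟨y, hyC, hye, hyB⟩ := ((mem_closure_iff_frequently.1 hx).and_eventually hnear).exists
    have h0 : ∀ᶠ z in 𝓝 (e.1 y), a z = 0 := by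
      have h1 : Tendsto e.1.symm (𝓝 (e.1 y)) (𝓝 y) := by
        have := (e.1.continuousAt_symm (e.1.map_source hye)).tendsto
        rwa [e.1.left_inv hye] at this
      filter_upwards [h1.eventually hyC, Metric.isOpen_ball.mem_nhds hyB] with z hz1 hz2
      by_contra hne
      exact hz1 ((haP z hz2).2 hne)
    have h1 := eqOn_zero_of_convex Metric.isOpen_ball (convex_ball _ _) ha hyB h0
    filter_upwards [hnear] with y' hy' hmem
    have := (haP _ hy'.2).1 (by rwa [e.1.left_inv hy'.1])
    exact this (h1 _ hy'.2)
  rcases isClopen_iff.1 ⟨hCc, hCo⟩ with h | h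
  · intro hev
    have : x ∈ C := hev
    rw [h] at this
    exact this
  · obtain ⟨y, hy⟩ := hne
    have : y ∈ C := by rw [h]; trivial
    exact absurd hy this.self_of_nhds

theorem frequently_symm_mem_polyNe [ConnectedSpace X] (hemb : IsProjectiveEmbedding n emb)
    {P : MvPolynomial (Fin (M + 1)) ℂ} {d : ℕ} (hP : P.IsHomogeneous d)
    (hne : (polyNe emb P).Nonempty) (e : atlas (Fin n → ℂ) X) {w : Fin n → ℂ}
    (hw : w ∈ e.1.target) : ∃ᶠ z in 𝓝 w, e.1.symm z ∈ polyNe emb P := by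
  have h1 := frequently_mem_polyNe hemb hP hne (e.1.symm w)
  have h2 : Tendsto e.1 (𝓝 (e.1.symm w)) (𝓝 w) := by
    have := (e.1.continuousAt (e.1.map_target hw)).tendsto
    rwa [e.1.right_inv hw] at this
  refine h2.frequently (h1.mp ?_)
  filter_upwards [e.1.open_source.mem_nhds (e.1.map_target hw)] with y hy hyP
  rwa [e.1.left_inv hy]

end PolyNe

/-! ### Holomorphic maps -/

section Holomorphic

variable {n n' : ℕ} {X X' : Type*} [TopologicalSpace X] [ChartedSpace (Fin n → ℂ) X]
  [TopologicalSpace X'] [ChartedSpace (Fin n' → ℂ) X']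

/-- The map `f` is holomorphic near `x`, in terms of charts. -/
structure IsHolAt (n n' : ℕ) {X X' : Type*} [TopologicalSpace X] [ChartedSpace (Fin n → ℂ) X]
    [TopologicalSpace X'] [ChartedSpace (Fin n' → ℂ) X'] (f : X → X') (x : X) : Prop where
  continuousAt : ContinuousAt f x
  differentiableAt : ∀ (e : atlas (Fin n → ℂ) X) (e' : atlas (Fin n' → ℂ) X'), x ∈ e.1.source →
    f x ∈ e'.1.source → ∀ᶠ w in 𝓝 (e.1 x), DifferentiableAt ℂ (e'.1 ∘ f ∘ e.1.symm) w

/-- Composing the polynomials with a local holomorphic lift of `emb` gives holomorphic homogeneous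
coordinates for `f` in a chart. -/
theorem isHolAt_of_polynomials {M M' d : ℕ} [CompactSpace X'] [IsManifold 𝓘(ℂ, Fin n → ℂ) ω X]
    [IsManifold 𝓘(ℂ, Fin n' → ℂ) ω X'] {emb : X → ℙ ℂ (Fin (M + 1) → ℂ)}
    (hemb : IsProjectiveEmbedding n emb) {emb' : X' → ℙ ℂ (Fin (M' + 1) → ℂ)}
    (hemb' : IsProjectiveEmbedding n' emb') {f : X → X'}
    {p : Fin (M' + 1) → MvPolynomial (Fin (M + 1)) ℂ} (hp : ∀ j, (p j).IsHomogeneous d) {x : X}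
    (h : ∀ᶠ y in 𝓝 x, ∃ h : (fun j => MvPolynomial.eval (emb y).rep (p j)) ≠ 0,
      emb' (f y) = Projectivization.mk ℂ (fun j => MvPolynomial.eval (emb y).rep (p j)) h) :
    IsHolAt n n' f x := by
  have key : ∀ e : atlas (Fin n → ℂ) X, x ∈ e.1.source →
      ∃ q : (Fin n → ℂ) → Fin (M' + 1) → ℂ, (∀ᶠ w in 𝓝 (e.1 x), DifferentiableAt ℂ q w) ∧
        HasProjectiveLift emb' (f ∘ e.1.symm) q (e.1 x) := by
    intro e he
    obtain ⟨ρ, hρ, hρt, ψ, hψ, hψe⟩ := exists_ball_lift hemb e (e.1.map_source he)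
    refine ⟨fun w j => MvPolynomial.eval (ψ w) (p j), ?_, ?_⟩
    · filter_upwards [Metric.ball_mem_nhds _ hρ] with w hw
      exact differentiableAt_pi.2 fun j => differentiableAt_eval_comp (p j)
        (hψ.differentiableAt (Metric.isOpen_ball.mem_nhds hw))
    · have h1 : Tendsto e.1.symm (𝓝 (e.1 x)) (𝓝 x) := by
        have := (e.1.continuousAt_symm (e.1.map_source he)).tendsto
        rwa [e.1.left_inv he] at this
      filter_upwards [h1.eventually h, Metric.ball_mem_nhds _ hρ] with w hw1 hw2
      obtain ⟨ha, ha'⟩ := hw1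
      obtain ⟨hb, hb'⟩ := hψe w hw2
      obtain ⟨h', hh'⟩ := mk_eval_rep_eq hp hb' ha
      exact ⟨h', ha'.trans hh'⟩
  constructor
  · set e := achart (Fin n → ℂ) x
    have hxe : x ∈ e.1.source := mem_chart_source _ x
    obtain ⟨q, hq, hqf⟩ := key e hxe
    have h1 := continuousAt_of_hasProjectiveLift hemb' hq.self_of_nhds.continuousAt hqf
    have h2 := h1.comp (e.1.continuousAt hxe)
    refine h2.congr ?_
    filter_upwards [e.1.open_source.mem_nhds hxe] with y hy
    simp [e.1.left_inv hy]
  · intro e e' he he'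
    obtain ⟨q, hq, hqf⟩ := key e he
    refine eventually_differentiableAt_chart_comp hemb' hq hqf e' ?_
    simpa [e.1.left_inv he] using he'

theorem RationalMap.isHolAt {M M' : ℕ} [CompactSpace X'] [IsManifold 𝓘(ℂ, Fin n → ℂ) ω X]
    [IsManifold 𝓘(ℂ, Fin n' → ℂ) ω X'] {emb : X → ℙ ℂ (Fin (M + 1) → ℂ)}
    (hemb : IsProjectiveEmbedding n emb) {emb' : X' → ℙ ℂ (Fin (M' + 1) → ℂ)}
    (hemb' : IsProjectiveEmbedding n' emb') (F : RationalMap emb emb') {x : X}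
    (hx : x ∈ F.domain) : IsHolAt n n' F.toFun x := by
  obtain ⟨W, hW, hxW, -, d, p, hp, h⟩ := F.isRegularOn x hx
  obtain ⟨P, d', hP, hxP, hPW⟩ := hW.exists_polyNe_subset hxW
  refine isHolAt_of_polynomials hemb hemb' hp ?_
  filter_upwards [(isOpen_polyNe hemb hP).mem_nhds hxP] with y hy using h y (hPW hy)

theorem RationalMap.isOpen_domain {M M' : ℕ} {X' : Type*} [IsManifold 𝓘(ℂ, Fin n → ℂ) ω X]
    {emb : X → ℙ ℂ (Fin (M + 1) → ℂ)}
    (hemb : IsProjectiveEmbedding n emb) {emb' : X' → ℙ ℂ (Fin (M' + 1) → ℂ)}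
    (F : RationalMap emb emb') : IsOpen F.domain := by
  refine isOpen_iff_mem_nhds.2 fun x hx => ?_
  obtain ⟨P, d', hP, hxP, hPW⟩ := F.isZariskiOpen_domain.exists_polyNe_subset hx
  exact mem_of_superset ((isOpen_polyNe hemb hP).mem_nhds hxP) hPW

theorem IsHolAt.fderiv_comp_eq_id {f : X → X'} {g : X' → X} {x : X} (hf : IsHolAt n n' f x)
    (hg : IsHolAt n' n g (f x)) (hgf : ∀ᶠ y in 𝓝 x, g (f y) = y)
    (e : atlas (Fin n → ℂ) X) (e' : atlas (Fin n' → ℂ) X') (he : x ∈ e.1.source)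
    (he' : f x ∈ e'.1.source) :
    (fderiv ℂ (e.1 ∘ g ∘ e'.1.symm) (e'.1 (f x))).comp
      (fderiv ℂ (e'.1 ∘ f ∘ e.1.symm) (e.1 x)) = ContinuousLinearMap.id ℂ _ := by
  have h1 := (hf.differentiableAt e e' he he').self_of_nhds
  have hgx : g (f x) ∈ e.1.source := by rwa [hgf.self_of_nhds]
  have h2 := (hg.differentiableAt e' e he' hgx).self_of_nhds
  have hsymm : Tendsto e.1.symm (𝓝 (e.1 x)) (𝓝 x) := by
    have := (e.1.continuousAt_symm (e.1.map_source he)).tendsto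
    rwa [e.1.left_inv he] at this
  have h3 : (e.1 ∘ g ∘ e'.1.symm) ∘ (e'.1 ∘ f ∘ e.1.symm) =ᶠ[𝓝 (e.1 x)] id := by
    filter_upwards [hsymm.eventually hgf, e.1.open_target.mem_nhds (e.1.map_source he),
      hsymm.eventually (hf.continuousAt.eventually_mem (e'.1.open_source.mem_nhds he'))]
      with w hw1 hw2 hw3
    simp [e'.1.left_inv hw3, hw1, e.1.right_inv hw2]
  have h4 : (e'.1 ∘ f ∘ e.1.symm) (e.1 x) = e'.1 (f x) := by simp [e.1.left_inv he]
  have h5 := fderiv_comp (e.1 x) (g := e.1 ∘ g ∘ e'.1.symm) (by rwa [h4]) h1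
  rw [h3.fderiv_eq, fderiv_id, h4] at h5
  exact h5.symm

/-- The derivative of `f` has a left inverse, hence is injective. -/
theorem IsHolAt.dim_le {f : X → X'} {g : X' → X} {x : X} (hf : IsHolAt n n' f x)
    (hg : IsHolAt n' n g (f x)) (hgf : ∀ᶠ y in 𝓝 x, g (f y) = y) : n ≤ n' := by
  have h := hf.fderiv_comp_eq_id hg hgf (achart _ x) (achart _ (f x)) (mem_chart_source _ x)
    (mem_chart_source _ (f x))
  have hinj : Function.Injective (fderiv ℂ ((achart (Fin n' → ℂ) (f x)).1 ∘ f ∘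
      (achart (Fin n → ℂ) x).1.symm) ((achart (Fin n → ℂ) x).1 x)) :=
    Function.LeftInverse.injective fun v => DFunLike.congr_fun h v
  simpa using LinearMap.finrank_le_finrank_of_injective
    (f := ((fderiv ℂ ((achart (Fin n' → ℂ) (f x)).1 ∘ f ∘
      (achart (Fin n → ℂ) x).1.symm) ((achart (Fin n → ℂ) x).1 x)) :
      (Fin n → ℂ) →ₗ[ℂ] (Fin n' → ℂ))) hinj

end Holomorphic

/-! ### Birational maps on principal open sets -/

section Birational

variable {n n' M M' : ℕ} {X X' : Type*} [TopologicalSpace X] [ChartedSpace (Fin n → ℂ) X]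
  [TopologicalSpace X'] [ChartedSpace (Fin n' → ℂ) X']

/-- On the principal open set `polyNe emb P`, the map `f` is given by the homogeneous polynomials
`p` and has the holomorphic left inverse `g`, and the image of this set contains a nonempty
principal open set `polyNe emb' P'`. -/
structure IsBirationalOn (n n' : ℕ) {M M' : ℕ} {X X' : Type*} [TopologicalSpace X]
    [ChartedSpace (Fin n → ℂ) X] [TopologicalSpace X'] [ChartedSpace (Fin n' → ℂ) X']
    (emb : X → ℙ ℂ (Fin (M + 1) → ℂ)) (emb' : X' → ℙ ℂ (Fin (M' + 1) → ℂ)) (f : X → X')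
    (g : X' → X) (P : MvPolynomial (Fin (M + 1)) ℂ)
    (p : Fin (M' + 1) → MvPolynomial (Fin (M + 1)) ℂ)
    (P' : MvPolynomial (Fin (M' + 1)) ℂ) : Prop where
  isHomogeneous : ∃ d, P.IsHomogeneous d
  isHomogeneous_map : ∃ d, ∀ j, (p j).IsHomogeneous d
  isHomogeneous' : ∃ d, P'.IsHomogeneous d
  nonempty : (polyNe emb P).Nonempty
  nonempty' : (polyNe emb' P').Nonempty
  lift : ∀ y ∈ polyNe emb P, ∃ h : (fun j => MvPolynomial.eval (emb y).rep (p j)) ≠ 0,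
    emb' (f y) = Projectivization.mk ℂ (fun j => MvPolynomial.eval (emb y).rep (p j)) h
  left_inv : ∀ y ∈ polyNe emb P, g (f y) = y
  isHolAt : ∀ y ∈ polyNe emb P, IsHolAt n n' f y
  isHolAt' : ∀ y ∈ polyNe emb P, IsHolAt n' n g (f y)
  subset_image : polyNe emb' P' ⊆ f '' polyNe emb P

theorem eval_aeval_rep {p : Fin (M' + 1) → MvPolynomial (Fin (M + 1)) ℂ}
    (v : Fin (M + 1) → ℂ) (Q : MvPolynomial (Fin (M' + 1)) ℂ) :
    MvPolynomial.eval v (MvPolynomial.aeval p Q) =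
      MvPolynomial.eval (fun j => MvPolynomial.eval v (p j)) Q := by
  induction Q using MvPolynomial.induction_on with
  | C c => simp
  | add f g hf hg => simp only [map_add, hf, hg]
  | mul_X f i hf => simp only [map_mul, hf, MvPolynomial.aeval_X, MvPolynomial.eval_X]

/-- Substituting `p` into `Q` turns a condition on the image into a polynomial condition on the
source, so such preimages are again principal. -/
theorem mem_polyNe_mul_aeval_iff {X X' : Type*} {emb : X → ℙ ℂ (Fin (M + 1) → ℂ)}
    {emb' : X' → ℙ ℂ (Fin (M' + 1) → ℂ)} {f : X → X'}
    {p : Fin (M' + 1) → MvPolynomial (Fin (M + 1)) ℂ} {W : Set X}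
    (h : ∀ y ∈ W, ∃ h : (fun j => MvPolynomial.eval (emb y).rep (p j)) ≠ 0,
      emb' (f y) = Projectivization.mk ℂ (fun j => MvPolynomial.eval (emb y).rep (p j)) h)
    {P : MvPolynomial (Fin (M + 1)) ℂ} (hPW : polyNe emb P ⊆ W)
    {Q : MvPolynomial (Fin (M' + 1)) ℂ} {d : ℕ} (hQ : Q.IsHomogeneous d) {y : X} :
    y ∈ polyNe emb (P * MvPolynomial.aeval p Q) ↔ y ∈ polyNe emb P ∧ f y ∈ polyNe emb' Q := by
  have h1 : y ∈ polyNe emb (P * MvPolynomial.aeval p Q) ↔ y ∈ polyNe emb P ∧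
      MvPolynomial.eval (fun j => MvPolynomial.eval (emb y).rep (p j)) Q ≠ 0 := by
    change MvPolynomial.eval (emb y).rep (P * MvPolynomial.aeval p Q) ≠ 0 ↔ _
    rw [map_mul, eval_aeval_rep, mul_ne_zero_iff]
    rfl
  rw [h1]
  refine and_congr_right fun hy => ?_
  obtain ⟨hne, hy'⟩ := h y (hPW hy)
  exact (mem_polyNe_iff_of_eq_mk hQ hy').symm

theorem RationalMap.IsBirational.exists_isBirationalOn [CompactSpace X] [CompactSpace X']
    [IsManifold 𝓘(ℂ, Fin n → ℂ) ω X] [IsManifold 𝓘(ℂ, Fin n' → ℂ) ω X']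
    {emb : X → ℙ ℂ (Fin (M + 1) → ℂ)} (hemb : IsProjectiveEmbedding n emb)
    {emb' : X' → ℙ ℂ (Fin (M' + 1) → ℂ)} (hemb' : IsProjectiveEmbedding n' emb')
    {F : RationalMap emb emb'} (hF : F.IsBirational) :
    ∃ g P p P', IsBirationalOn n n' emb emb' F.toFun g P p P' ∧ polyNe emb P ⊆ F.domain := by
  obtain ⟨G, ⟨x₁, hx₁, hFx₁⟩, -, hGF, hFG⟩ := hF
  obtain ⟨W, hW, hxW, hWU, d, p, hp, hlift⟩ := F.isRegularOn x₁ hx₁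
  obtain ⟨P₁, d₁, hP₁, hxP₁, hPW⟩ := hW.exists_polyNe_subset hxW
  obtain ⟨P₂, d₂, hP₂, hxP₂, hPG⟩ := G.isZariskiOpen_domain.exists_polyNe_subset hFx₁
  have hiff := fun y => mem_polyNe_mul_aeval_iff (y := y) hlift hPW hP₂
  -- `P` cuts out points where `F` is given by `p` and whose image lies in the domain of `G`.
  set P := P₁ * MvPolynomial.aeval p P₂ with hPdef
  have hPh : P.IsHomogeneous (d₁ + d * d₂) := hP₁.mul (hP₂.aeval _ hp)
  have hx₁P : x₁ ∈ polyNe emb P := (hiff x₁).2 ⟨hxP₁, hxP₂⟩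
  obtain ⟨W', hW', hyW', hWV, d', p', hp', hlift'⟩ := G.isRegularOn (F.toFun x₁) hFx₁
  obtain ⟨P₃, d₃, hP₃, hyP₃, hPW'⟩ := hW'.exists_polyNe_subset hyW'
  have hiff' := fun y => mem_polyNe_mul_aeval_iff (y := y) hlift' hPW' hPh
  -- The last polynomial selects points `y` with `G y` in `polyNe emb P`. Each of them is `F (G y)`,
  -- hence in the image.
  refine ⟨G.toFun, P, p, P₃ * MvPolynomial.aeval p' P,
    ⟨⟨_, hPh⟩, ⟨d, hp⟩, ⟨_, hP₃.mul (hPh.aeval _ hp')⟩, ⟨x₁, hx₁P⟩, ⟨F.toFun x₁, ?_⟩,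
    fun y hy => ?_, fun y hy => ?_, fun y hy => ?_, fun y hy => ?_, fun y hy => ?_⟩,
    fun y hy => ?_⟩
  · exact (hiff' _).2 ⟨hyP₃, by rwa [hGF x₁ hx₁ hFx₁]⟩
  · exact hlift y (hPW ((hiff y).1 hy).1)
  · exact hGF y (hWU (hPW ((hiff y).1 hy).1)) (hPG ((hiff y).1 hy).2)
  · exact F.isHolAt hemb hemb' (hWU (hPW ((hiff y).1 hy).1))
  · exact G.isHolAt hemb' hemb (hPG ((hiff y).1 hy).2)
  · obtain ⟨h1, h2⟩ := (hiff' y).1 hy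
    exact ⟨G.toFun y, h2, hFG y (hWV (hPW' h1)) (hWU (hPW ((hiff _).1 h2).1))⟩
  · exact hWU (hPW ((hiff y).1 hy).1)

theorem RationalMap.IsBirational.exists_inverse {X X' : Type*} {emb : X → ℙ ℂ (Fin (M + 1) → ℂ)}
    {emb' : X' → ℙ ℂ (Fin (M' + 1) → ℂ)} {F : RationalMap emb emb'} (hF : F.IsBirational) :
    ∃ G : RationalMap emb' emb, G.IsBirational := by
  obtain ⟨G, h1, h2, h3, h4⟩ := hF
  exact ⟨G, F, h2, h1, h4, h3⟩

theorem IsBirationalOn.dim_le [IsManifold 𝓘(ℂ, Fin n → ℂ) ω X]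
    {emb : X → ℙ ℂ (Fin (M + 1) → ℂ)} (hemb : IsProjectiveEmbedding n emb)
    {emb' : X' → ℙ ℂ (Fin (M' + 1) → ℂ)} {f : X → X'} {g : X' → X} {P : MvPolynomial _ ℂ}
    {p : Fin (M' + 1) → MvPolynomial (Fin (M + 1)) ℂ} {P' : MvPolynomial _ ℂ}
    (h : IsBirationalOn n n' emb emb' f g P p P') : n ≤ n' := by
  obtain ⟨x, hx⟩ := h.nonempty
  obtain ⟨d, hd⟩ := h.isHomogeneous
  refine (h.isHolAt x hx).dim_le (h.isHolAt' x hx) ?_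
  filter_upwards [(isOpen_polyNe hemb hd).mem_nhds hx] with y hy using h.left_inv y hy

end Birational

/-! ### The pull-back of pluricanonical forms under birational maps -/

section Pullback

variable {n M M' k : ℕ} {X X' : Type*} [TopologicalSpace X] [ChartedSpace (Fin n → ℂ) X]
  [TopologicalSpace X'] [ChartedSpace (Fin n → ℂ) X']

theorem ExtendsAt.of_imp {E : Type*} [NormedAddCommGroup E] [NormedSpace ℂ E] {a a' h : E → ℂ}
    {z : E} (hz : ExtendsAt a h z) (heq : ∀ᶠ y in 𝓝 z, a' y ≠ 0 → a y ≠ 0) :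
    ExtendsAt a' h z := by
  obtain ⟨H, h1, h2⟩ := hz
  refine ⟨H, h1, ?_⟩
  filter_upwards [h2, heq] with y hy1 hy2 hy3 using hy1 (hy2 hy3)

theorem tendsto_symm_nhds (e : atlas (Fin n → ℂ) X) {x : X} (he : x ∈ e.1.source) :
    Tendsto e.1.symm (𝓝 (e.1 x)) (𝓝 x) := by
  have := (e.1.continuousAt_symm (e.1.map_source he)).tendsto
  rwa [e.1.left_inv he] at this

theorem continuousAt_coeff (s : pluricanonicalForms n X k) (e : atlas (Fin n → ℂ) X)
    {w : Fin n → ℂ} (hw : w ∈ e.1.target) : ContinuousAt (s.1 e) w :=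
  ((s.2.1 e).differentiableAt (e.1.open_target.mem_nhds hw)).continuousAt

/-- Coefficients are continuous on the chart targets and zero off them by convention, so a dense set
of points determines the form. -/
theorem pluricanonicalForms_ext {s t : pluricanonicalForms n X k} {U : Set X}
    (hU : ∀ x, ∃ᶠ y in 𝓝 x, y ∈ U)
    (h : ∀ e : atlas (Fin n → ℂ) X, ∀ x ∈ e.1.source, x ∈ U → s.1 e (e.1 x) = t.1 e (e.1 x)) :
    s = t := by
  refine Subtype.ext (funext fun e => funext fun w => ?_)
  by_cases hw : w ∈ e.1.target
  swap
  · rw [s.2.2.1 e w hw, t.2.2.1 e w hw]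
  have hx := e.1.map_target hw
  have h1 : ∀ r : pluricanonicalForms n X k, ContinuousAt (fun x => r.1 e (e.1 x)) (e.1.symm w) := by
    intro r
    have h2 : ContinuousAt (r.1 e) (e.1 (e.1.symm w)) := by
      rw [e.1.right_inv hw]
      exact continuousAt_coeff r e hw
    exact h2.comp (e.1.continuousAt hx)
  have := eq_of_frequently_eq (h1 s) (h1 t) (by
    refine (hU (e.1.symm w)).mp ?_
    filter_upwards [e.1.open_source.mem_nhds hx] with y hy hyU using h e y hy hyU)
  simpa [e.1.right_inv hw] using this

theorem continuousAt_det_fderiv {m : ℕ} {τ : (Fin m → ℂ) → Fin m → ℂ} {w : Fin m → ℂ}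
    (hτ : ContDiffAt ℂ ω τ w) : ContinuousAt (fun z => (fderiv ℂ τ z).det) w :=
  (eventually_differentiableAt_det_fderiv (by
    filter_upwards [hτ.eventually (by simp)] with u hu
      using hu.differentiableAt (by simp))).continuousAt

theorem IsHolAt.pullCoeff_eq [IsManifold 𝓘(ℂ, Fin n → ℂ) ω X']
    (s : pluricanonicalForms n X' k) {f : X → X'} {x : X}
    (hf : IsHolAt n n f x) (e e' : atlas (Fin n → ℂ) _) (he : x ∈ e.1.source)
    (he' : f x ∈ e'.1.source) :
    pullCoeff s (f ∘ e.1.symm) (e.1 x) =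
      s.1 e' (e'.1 (f x)) * (fderiv ℂ (e'.1 ∘ f ∘ e.1.symm) (e.1 x)).det ^ k := by
  have h1 : (f ∘ e.1.symm) (e.1 x) = f x := by simp [e.1.left_inv he]
  have h2 : ContinuousAt (f ∘ e.1.symm) (e.1 x) := by
    refine ContinuousAt.comp ?_ (e.1.continuousAt_symm (e.1.map_source he))
    rw [e.1.left_inv he]
    exact hf.continuousAt
  rw [CanonicalPointProcess.pullCoeff_eq s h2 e' (by rwa [h1])
    (hf.differentiableAt e e' he he').self_of_nhds, h1]

variable [IsManifold 𝓘(ℂ, Fin n → ℂ) ω X]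

theorem continuousAt_det_transition (e e' : atlas (Fin n → ℂ) X) {x : X} (hx : x ∈ e.1.source)
    (hx' : x ∈ e'.1.source) :
    ContinuousAt (fun y => (fderiv ℂ (e'.1 ∘ e.1.symm) (e.1 y)).det) x :=
  (continuousAt_det_fderiv (contDiffAt_transition e e' hx hx')).comp
    (f := e.1) (e.1.continuousAt hx)

theorem fderiv_chart_change {f : X → X'} {x : X} (hf : IsHolAt n n f x)
    (e₁ e₂ : atlas (Fin n → ℂ) X) (e' : atlas (Fin n → ℂ) X') (h₁ : x ∈ e₁.1.source)
    (h₂ : x ∈ e₂.1.source) (h' : f x ∈ e'.1.source) :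
    (fderiv ℂ (e'.1 ∘ f ∘ e₁.1.symm) (e₁.1 x)).det =
      (fderiv ℂ (e'.1 ∘ f ∘ e₂.1.symm) (e₂.1 x)).det *
        (fderiv ℂ (e₂.1 ∘ e₁.1.symm) (e₁.1 x)).det := by
  have h1 : (e'.1 ∘ f ∘ e₁.1.symm) =ᶠ[𝓝 (e₁.1 x)]
      (e'.1 ∘ f ∘ e₂.1.symm) ∘ (e₂.1 ∘ e₁.1.symm) := by
    filter_upwards [(tendsto_symm_nhds e₁ h₁).eventually (e₂.1.open_source.mem_nhds h₂)] with w hw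
    have hw' : e₁.1.symm w ∈ e₂.1.source := hw
    simp [e₂.1.left_inv hw']
  have h2 : (e₂.1 ∘ e₁.1.symm) (e₁.1 x) = e₂.1 x := by simp [e₁.1.left_inv h₁]
  have h3 := (hf.differentiableAt e₂ e' h₂ h').self_of_nhds
  rw [← h2] at h3
  have h4 := fderiv_comp (e₁.1 x) h3
    ((contDiffAt_transition e₁ e₂ h₁ h₂).differentiableAt (by simp))
  rw [h1.fderiv_eq, h4, h2]
  exact LinearMap.det_comp _ _

variable {emb : X → ℙ ℂ (Fin (M + 1) → ℂ)} {emb' : X' → ℙ ℂ (Fin (M' + 1) → ℂ)} {f : X → X'}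
  {g : X' → X} {P : MvPolynomial (Fin (M + 1)) ℂ}
  {p : Fin (M' + 1) → MvPolynomial (Fin (M + 1)) ℂ} {P' : MvPolynomial (Fin (M' + 1)) ℂ}

/-- Take determinants in the chain rule for `g ∘ f = id`. -/
theorem IsBirationalOn.det_ne_zero (hemb : IsProjectiveEmbedding n emb)
    (h : IsBirationalOn n n emb emb' f g P p P') {x : X} (hx : x ∈ polyNe emb P)
    (e e' : atlas (Fin n → ℂ) _) (he : x ∈ e.1.source) (he' : f x ∈ e'.1.source) :
    (fderiv ℂ (e'.1 ∘ f ∘ e.1.symm) (e.1 x)).det ≠ 0 := by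
  obtain ⟨d, hd⟩ := h.isHomogeneous
  have h1 := (h.isHolAt x hx).fderiv_comp_eq_id (h.isHolAt' x hx)
    (by filter_upwards [(isOpen_polyNe hemb hd).mem_nhds hx] with y hy using h.left_inv y hy)
    e e' he he'
  have h2 := congrArg ContinuousLinearMap.det h1
  have h3 := LinearMap.det_comp
    (fderiv ℂ (e.1 ∘ g ∘ e'.1.symm) (e'.1 (f x)) : (Fin n → ℂ) →ₗ[ℂ] (Fin n → ℂ))
    (fderiv ℂ (e'.1 ∘ f ∘ e.1.symm) (e.1 x) : (Fin n → ℂ) →ₗ[ℂ] (Fin n → ℂ))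
  intro h0
  rw [ContinuousLinearMap.det] at h0 h2
  rw [ContinuousLinearMap.toLinearMap_comp, h3, h0, mul_zero] at h2
  simp [ContinuousLinearMap.det] at h2

variable [IsManifold 𝓘(ℂ, Fin n → ℂ) ω X']

/-- A form `s` on `X` is the pull-back of the form `s'` on `X'` under the map `f`, on `U`. -/
def IsPullbackOn (f : X → X') (U : Set X) (s : pluricanonicalForms n X k)
    (s' : pluricanonicalForms n X' k) : Prop :=
  ∀ (e : atlas (Fin n → ℂ) X) (e' : atlas (Fin n → ℂ) X'), ∀ x ∈ U, x ∈ e.1.source →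
    f x ∈ e'.1.source → s.1 e (e.1 x) =
      s'.1 e' (e'.1 (f x)) * (fderiv ℂ (e'.1 ∘ f ∘ e.1.symm) (e.1 x)).det ^ k

/-- In each chart the pulled-back coefficient extends across the zeros of `P`. The extensions obey
the transformation rule because they do so on the dense set `polyNe emb P`. -/
theorem IsBirationalOn.exists_isPullbackOn [ConnectedSpace X] [CompactSpace X']
    (hemb : IsProjectiveEmbedding n emb) (hemb' : IsProjectiveEmbedding n emb')
    (h : IsBirationalOn n n emb emb' f g P p P') (s' : pluricanonicalForms n X' k) :
    ∃ s : pluricanonicalForms n X k, IsPullbackOn f (polyNe emb P) s s' := by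
  classical
  obtain ⟨d, hd⟩ := h.isHomogeneous
  obtain ⟨dp, hp⟩ := h.isHomogeneous_map
  -- Holomorphic equations for `P` exist only on small balls. This indicator has the same nonzero
  -- locus and is defined on the whole chart, so the local extensions can be glued over the target.
  let a : atlas (Fin n → ℂ) X → (Fin n → ℂ) → ℂ := fun e w =>
    if e.1.symm w ∈ polyNe emb P then 1 else 0
  have ha : ∀ e w, a e w ≠ 0 ↔ e.1.symm w ∈ polyNe emb P := by
    intro e w
    by_cases hw : e.1.symm w ∈ polyNe emb P <;> simp [a, hw]
  have hfreq : ∀ e : atlas (Fin n → ℂ) X, ∀ w ∈ e.1.target, ∃ᶠ z in 𝓝 w, a e z ≠ 0 := by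
    intro e w hw
    simpa only [ha] using frequently_symm_mem_polyNe hemb hd h.nonempty e hw
  have hext : ∀ e : atlas (Fin n → ℂ) X, ∀ w ∈ e.1.target,
      ExtendsAt (a e) (pullCoeff s' (f ∘ e.1.symm)) w := by
    intro e w hw
    obtain ⟨ρ, hρ, hρt, ψ, hψ, hψe⟩ := exists_ball_lift hemb e hw
    have hiff : ∀ z ∈ Metric.ball w ρ,
        (e.1.symm z ∈ polyNe emb P ↔ MvPolynomial.eval (ψ z) P ≠ 0) := fun z hz =>
      mem_polyNe_iff_of_eq_mk hd (hψe z hz).2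
    have hpol : ∀ Q : MvPolynomial (Fin (M + 1)) ℂ,
        DifferentiableOn ℂ (fun z => MvPolynomial.eval (ψ z) Q) (Metric.ball w ρ) := fun Q z hz =>
      (differentiableAt_eval_comp Q
        (hψ.differentiableAt (Metric.isOpen_ball.mem_nhds hz))).differentiableWithinAt
    have key := extendsAt_pullCoeff hemb' s' (O := Metric.ball w ρ)
      (a := fun z => MvPolynomial.eval (ψ z) P) (g := fun j z => MvPolynomial.eval (ψ z) (p j))
      (Z := f ∘ e.1.symm) Metric.isOpen_ball (hpol P) ?_ (fun j => hpol (p j)) ?_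
      (Metric.mem_ball_self hρ)
    · refine key.of_imp ?_
      filter_upwards [Metric.ball_mem_nhds w hρ] with z hz hz'
      exact (hiff z hz).1 ((ha e z).1 hz')
    · intro z hz
      refine (frequently_symm_mem_polyNe hemb hd h.nonempty e (hρt hz)).mp ?_
      filter_upwards [Metric.isOpen_ball.mem_nhds hz] with y hy hy' using (hiff y hy).1 hy'
    · intro z hz hne
      obtain ⟨h1, h2⟩ := h.lift _ ((hiff z hz).2 hne)
      obtain ⟨h3, h4⟩ := mk_eval_rep_eq hp (hψe z hz).2 h1
      exact ⟨h3, h2.trans h4⟩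
  choose H hHd hH using fun e : atlas (Fin n → ℂ) X =>
    exists_differentiableOn_of_extendsAt (hfreq e) e.1.open_target (hext e)
  have hHU : ∀ (e : atlas (Fin n → ℂ) X), ∀ x ∈ e.1.source, x ∈ polyNe emb P →
      H e (e.1 x) = pullCoeff s' (f ∘ e.1.symm) (e.1 x) := fun e x hx hxU =>
    hH e _ (e.1.map_source hx) (by rw [ha, e.1.left_inv hx]; exact hxU)
  have hHc : ∀ (e : atlas (Fin n → ℂ) X), ∀ x ∈ e.1.source,
      ContinuousAt (fun y => H e (e.1 y)) x := by
    intro e x hx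
    have h1 : ContinuousAt (H e) (e.1 x) :=
      ((hHd e).differentiableAt (e.1.open_target.mem_nhds (e.1.map_source hx))).continuousAt
    exact h1.comp (e.1.continuousAt hx)
  have hdense := frequently_mem_polyNe hemb hd h.nonempty
  refine ⟨⟨fun e w => if w ∈ e.1.target then H e w else 0, ?_, ?_, ?_⟩, ?_⟩
  · intro e
    refine (hHd e).congr fun w hw => ?_
    simp [hw]
  · intro e w hw
    simp [hw]
  · intro e₁ e₂ x hx
    simp only [e₁.1.map_source hx.1, e₂.1.map_source hx.2, if_true]
    refine eq_of_frequently_eq (hHc e₁ x hx.1)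
      ((hHc e₂ x hx.2).mul ((continuousAt_det_transition e₁ e₂ hx.1 hx.2).pow k)) ?_
    refine (hdense x).mp ?_
    filter_upwards [e₁.1.open_source.mem_nhds hx.1, e₂.1.open_source.mem_nhds hx.2]
      with y h₁ h₂ hy
    have hf := h.isHolAt y hy
    simp only [Pi.mul_apply, Pi.pow_apply]
    rw [hHU e₁ y h₁ hy, hHU e₂ y h₂ hy, hf.pullCoeff_eq s' e₁ (achart _ (f y)) h₁
        (mem_chart_source _ (f y)),
      hf.pullCoeff_eq s' e₂ (achart _ (f y)) h₂ (mem_chart_source _ (f y)),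
      fderiv_chart_change hf e₁ e₂ (achart _ (f y)) h₁ h₂ (mem_chart_source _ (f y)),
      mul_pow, mul_assoc]
  · intro e e' x hxU hx hx'
    simp only [e.1.map_source hx, if_true]
    rw [hHU e x hx hxU, (h.isHolAt x hxU).pullCoeff_eq s' e e' hx hx']

/-- Density determines the pulled-back form uniquely, which makes the choice linear. Injectivity
comes from invertible Jacobians over the dense set `polyNe emb' P'` in the image. -/
theorem IsBirationalOn.exists_pullback [ConnectedSpace X] [CompactSpace X'] [ConnectedSpace X']
    (hemb : IsProjectiveEmbedding n emb) (hemb' : IsProjectiveEmbedding n emb')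
    (h : IsBirationalOn n n emb emb' f g P p P') (k : ℕ) :
    ∃ Φ : pluricanonicalForms n X' k →ₗ[ℂ] pluricanonicalForms n X k,
      Function.Injective Φ ∧ ∀ s', IsPullbackOn f (polyNe emb P) (Φ s') s' := by
  obtain ⟨d, hd⟩ := h.isHomogeneous
  obtain ⟨d', hd'⟩ := h.isHomogeneous'
  have hdense := frequently_mem_polyNe hemb hd h.nonempty
  have hdense' := frequently_mem_polyNe hemb' hd' h.nonempty'
  choose Φ hΦ using fun s' : pluricanonicalForms n X' k =>
    h.exists_isPullbackOn hemb hemb' s'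
  have hval := fun s' (e : atlas (Fin n → ℂ) X) x (hxU : x ∈ polyNe emb P) (hx : x ∈ e.1.source) =>
    hΦ s' e (achart _ (f x)) x hxU hx (mem_chart_source _ (f x))
  refine ⟨⟨⟨Φ, fun s t => ?_⟩, fun c s => ?_⟩, ?_, hΦ⟩
  · refine pluricanonicalForms_ext hdense fun e x hx hxU => ?_
    simp only [Submodule.coe_add, Pi.add_apply]
    rw [hval s e x hxU hx, hval t e x hxU hx, hval (s + t) e x hxU hx]
    simp only [Submodule.coe_add, Pi.add_apply]
    ring
  · refine pluricanonicalForms_ext hdense fun e x hx hxU => ?_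
    simp only [RingHom.id_apply, Submodule.coe_smul, Pi.smul_apply, smul_eq_mul]
    rw [hval s e x hxU hx, hval (c • s) e x hxU hx]
    simp only [Submodule.coe_smul, Pi.smul_apply, smul_eq_mul]
    ring
  · intro s t hst
    refine pluricanonicalForms_ext hdense' fun e' y hy hyU => ?_
    obtain ⟨x, hxU, rfl⟩ := h.subset_image hyU
    have hx := mem_chart_source (Fin n → ℂ) x
    have h1 := hΦ s (achart _ x) e' x hxU hx hy
    have h2 := hΦ t (achart _ x) e' x hxU hx hy
    have hst' : Φ s = Φ t := hst
    rw [hst', h2] at h1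
    exact (mul_right_cancel₀ (pow_ne_zero k
      (h.det_ne_zero hemb hxU (achart _ x) e' hx hy)) h1).symm

end Pullback

/-! ### Finite-dimensionality of the space of pluricanonical forms -/

section FiniteDimensional

variable {n k : ℕ} {X : Type*} [TopologicalSpace X] [ChartedSpace (Fin n → ℂ) X]

/-- Finitely many closed balls in charts cover `X`, and evaluation at fine enough finite nets in
them is injective. For a form vanishing on the nets, let `m` be its largest coefficient on these
balls; on larger balls the transition functions bound it by `B * m`, and the Schwarz lemma then
gives `m ≤ m / 4`. -/
theorem finite_pluricanonicalForms [T2Space X] [CompactSpace X]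
    [IsManifold 𝓘(ℂ, Fin n → ℂ) ω X] (k : ℕ) : Module.Finite ℂ (pluricanonicalForms n X k) := by
  have hr : ∀ x : X, ∃ r > 0, Metric.closedBall ((achart (Fin n → ℂ) x).1 x) (2 * r) ⊆
      (achart (Fin n → ℂ) x).1.target := by
    intro x
    obtain ⟨r, hr, hrs⟩ := Metric.nhds_basis_closedBall.mem_iff.1
      ((achart (Fin n → ℂ) x).1.open_target.mem_nhds
        ((achart (Fin n → ℂ) x).1.map_source (mem_chart_source _ x)))
    refine ⟨r / 2, by positivity, ?_⟩
    rwa [mul_div_cancel₀ r two_ne_zero]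
  choose r hr0 hr using hr
  set e : X → atlas (Fin n → ℂ) X := fun x => achart (Fin n → ℂ) x with he
  set D : X → Set (Fin n → ℂ) := fun x => Metric.closedBall ((e x).1 x) (r x) with hD
  have hD2 : ∀ x, D x ⊆ Metric.closedBall ((e x).1 x) (2 * r x) := fun x =>
    Metric.closedBall_subset_closedBall (by linarith [hr0 x])
  have hDt : ∀ x, D x ⊆ (e x).1.target := fun x => (hD2 x).trans (hr x)
  obtain ⟨T, -, hT⟩ := isCompact_univ.elim_nhds_subcover (fun x => (e x).1.symm '' D x)
    fun x _ => by
      have hx : x ∈ (e x).1.source := mem_chart_source _ x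
      filter_upwards [(e x).1.open_source.mem_nhds hx, ((e x).1.continuousAt hx).eventually_mem
        (Metric.closedBall_mem_nhds _ (hr0 x))] with y hy1 hy2
      exact ⟨(e x).1 y, hy2, (e x).1.left_inv hy1⟩
  -- bounds for the transition functions
  have hC : ∀ x y : X, ∃ C : ℝ, ∀ w ∈ Metric.closedBall ((e x).1 x) (2 * r x),
      (e x).1.symm w ∈ (e y).1.symm '' D y →
      ‖(fderiv ℂ ((e y).1 ∘ (e x).1.symm) w).det ^ k‖ ≤ C := by
    intro x y
    have hcomp : IsCompact ((e y).1.symm '' D y) := (isCompact_closedBall _ _).image_of_continuousOn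
      ((e y).1.continuousOn_symm.mono (hDt y))
    have hK : IsCompact (Metric.closedBall ((e x).1 x) (2 * r x) ∩
        (e x).1.symm ⁻¹' ((e y).1.symm '' D y)) := by
      refine (isCompact_closedBall _ _).of_isClosed_subset ?_ inter_subset_left
      exact ((e x).1.continuousOn_symm.mono (hr x)).preimage_isClosed_of_isClosed
        Metric.isClosed_closedBall hcomp.isClosed
    obtain ⟨C, hC⟩ := hK.exists_bound_of_continuousOn
      (f := fun w => (fderiv ℂ ((e y).1 ∘ (e x).1.symm) w).det ^ k) (by
        rintro w ⟨hw1, w', hw2, hw3⟩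
        have hwt := hr x hw1
        have h1 : (e x).1.symm w ∈ (e y).1.source := by
          rw [← hw3]
          exact (e y).1.map_target (hDt y hw2)
        have h2 := contDiffAt_transition (e x) (e y) ((e x).1.map_target hwt) h1
        rw [(e x).1.right_inv hwt] at h2
        exact ((continuousAt_det_fderiv h2).pow k).continuousWithinAt)
    exact ⟨C, fun w hw1 hw2 => hC w ⟨hw1, hw2⟩⟩
  choose C hC using hC
  obtain ⟨B, hB0, hB1, hB⟩ : ∃ B : ℝ, 0 < B ∧ 1 ≤ B ∧ ∀ x ∈ T, ∀ y ∈ T, C x y ≤ B := by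
    obtain ⟨B, hB⟩ := ((T ×ˢ T).image fun q : X × X => C q.1 q.2).bddAbove
    refine ⟨max B 1, by positivity, le_max_right _ _, fun x hx y hy => le_max_of_le_left (hB ?_)⟩
    exact Finset.mem_coe.2 (Finset.mem_image.2 ⟨(x, y), Finset.mk_mem_product hx hy, rfl⟩)
  -- finite nets
  have hnet : ∀ x, ∃ N : Finset (Fin n → ℂ), ↑N ⊆ D x ∧
      ∀ w ∈ D x, ∃ ν ∈ N, dist w ν < r x / (4 * B) := by
    intro x
    have hε : 0 < r x / (4 * B) := by have := hr0 x; positivity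
    obtain ⟨N, hN1, hN2⟩ := (isCompact_closedBall ((e x).1 x) (r x)).elim_nhds_subcover
      (fun ν => Metric.ball ν (r x / (4 * B))) fun ν _ => Metric.ball_mem_nhds ν hε
    refine ⟨N, fun ν hν => hN1 ν hν, fun w hw => ?_⟩
    obtain ⟨ν, hν, hw'⟩ := mem_iUnion₂.1 (hN2 hw)
    exact ⟨ν, hν, hw'⟩
  choose N hND hN using hnet
  have hpt : ∀ y : X, ∃ x ∈ T, y ∈ (e x).1.symm '' D x := fun y => by
    simpa using hT (mem_univ y)
  let ev : pluricanonicalForms n X k →ₗ[ℂ] ((Σ x : T, N x.1) → ℂ) :=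
    { toFun := fun s i => s.1 (e i.1.1) i.2.1
      map_add' := fun s t => rfl
      map_smul' := fun c s => rfl }
  have hker : LinearMap.ker ev = ⊥ := by
    rw [LinearMap.ker_eq_bot']
    intro s hs
    have hs0 : ∀ x ∈ T, ∀ ν ∈ N x, s.1 (e x) ν = 0 := fun x hx ν hν =>
      congrFun hs ⟨⟨x, hx⟩, ⟨ν, hν⟩⟩
    have hmax : ∀ x, ∃ w ∈ D x, ∀ w' ∈ D x, ‖s.1 (e x) w'‖ ≤ ‖s.1 (e x) w‖ := fun x =>
      (isCompact_closedBall ((e x).1 x) (r x)).exists_isMaxOn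
        ⟨_, Metric.mem_closedBall_self (hr0 x).le⟩
        ((s.2.1 (e x)).continuousOn.mono (hDt x)).norm
    choose w hwD hw using hmax
    have hzero : ∀ x ∈ T, s.1 (e x) (w x) = 0 := by
      by_contra! hne
      obtain ⟨x₁, hx₁, hne⟩ := hne
      obtain ⟨x, hxT, hx⟩ := Finset.exists_max_image T (fun x => ‖s.1 (e x) (w x)‖) ⟨x₁, hx₁⟩
      set m := ‖s.1 (e x) (w x)‖ with hm
      have hmpos : 0 < m := lt_of_lt_of_le (norm_pos_iff.2 hne) (hx x₁ hx₁)
      obtain ⟨ν, hν, hdist⟩ := hN x (w x) (hwD x)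
      have hball : Metric.ball ν (r x) ⊆ Metric.closedBall ((e x).1 x) (2 * r x) := by
        intro z hz
        have h1 : dist ν ((e x).1 x) ≤ r x := hND x hν
        have h2 : dist z ν < r x := hz
        rw [Metric.mem_closedBall]
        linarith [dist_triangle z ν ((e x).1 x)]
      have hbound : ∀ z ∈ Metric.ball ν (r x), ‖s.1 (e x) z‖ ≤ B * m := by
        intro z hz
        have hzt := hr x (hball hz)
        obtain ⟨y, hyT, z', hz', hzz'⟩ := hpt ((e x).1.symm z)
        have hsrc : (e x).1.symm z ∈ (e y).1.source := by
          rw [← hzz']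
          exact (e y).1.map_target (hDt y hz')
        have h1 := s.2.2.2 (e x) (e y) _ ⟨(e x).1.map_target hzt, hsrc⟩
        rw [(e x).1.right_inv hzt, ← hzz', (e y).1.right_inv (hDt y hz')] at h1
        rw [h1, norm_mul, mul_comm]
        refine mul_le_mul ((hC x y z (hball hz) ⟨z', hz', hzz'⟩).trans (hB x hxT y hyT))
          ((hw y z' hz').trans (hx y hyT)) (norm_nonneg _) hB0.le
      have hνD : w x ∈ Metric.ball ν (r x) := by
        refine lt_trans hdist ?_
        have := hr0 x
        rw [div_lt_iff₀ (by positivity)]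
        nlinarith
      -- Schwarz lemma centred at the net point `ν`, a zero of the coefficient. The mesh `r x / (4 *
      -- B)` was chosen to beat the loss `B`.
      have hd := Complex.dist_le_div_mul_dist_of_mapsTo_ball (R₂ := B * m)
        ((s.2.1 (e x)).mono (hball.trans (hr x)))
        (fun z hz => by simpa [hs0 x hxT ν hν] using hbound z hz) hνD
      rw [hs0 x hxT ν hν, dist_zero_right, ← hm] at hd
      have h3 : B * m / r x * dist (w x) ν ≤ B * m / r x * (r x / (4 * B)) := by
        have := hr0 x
        gcongr
      have h4 : B * m / r x * (r x / (4 * B)) = m / 4 := by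
        have := hr0 x
        field_simp
      linarith
    refine Subtype.ext (funext fun e' => funext fun z => ?_)
    by_cases hz : z ∈ e'.1.target
    swap
    · exact s.2.2.1 e' z hz
    obtain ⟨y, hyT, z', hz', hzz'⟩ := hpt (e'.1.symm z)
    have hsrc : e'.1.symm z ∈ (e y).1.source := by
      rw [← hzz']
      exact (e y).1.map_target (hDt y hz')
    have h1 := s.2.2.2 e' (e y) _ ⟨e'.1.map_target hz, hsrc⟩
    have h2 : s.1 (e y) z' = 0 := by
      have := hw y z' hz'
      rw [hzero y hyT, norm_zero] at this
      exact norm_le_zero_iff.1 this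
    rw [e'.1.right_inv hz, ← hzz', (e y).1.right_inv (hDt y hz'), h2, zero_mul] at h1
    exact h1
  exact Module.Finite.of_injective ev (LinearMap.ker_eq_bot.1 hker)

end FiniteDimensional

/-! ### Change of variables for the local measures -/

section LocalMeasure

/-- The product of the sets `A j`, `j < N`. -/
def box {N : ℕ} {X : Type*} (A : Fin N → Set X) : Set (Fin N → X) := {x | ∀ j, x j ∈ A j}

theorem isOpen_box {N : ℕ} {X : Type*} [TopologicalSpace X] {A : Fin N → Set X}
    (hA : ∀ j, IsOpen (A j)) : IsOpen (box A) := by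
  have : box A = univ.pi A := by ext x; simp [box]
  rw [this]
  exact isOpen_set_pi finite_univ fun j _ => hA j

theorem continuousOn_box {N : ℕ} {X X' : Type*} [TopologicalSpace X] [TopologicalSpace X']
    {A : Fin N → Set X} {f : Fin N → X → X'} (hf : ∀ j, ContinuousOn (f j) (A j)) :
    ContinuousOn (fun (x : Fin N → X) j => f j (x j)) (box A) :=
  continuousOn_pi.2 fun j => (hf j).comp (continuous_apply j).continuousOn fun _ hx => hx j

theorem measurableSet_inter_preimage_of_continuousOn {α β : Type*} [TopologicalSpace α]
    [MeasurableSpace α] [OpensMeasurableSpace α] [TopologicalSpace β] [MeasurableSpace β]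
    [BorelSpace β] {f : α → β} {s : Set α} (hs : MeasurableSet s) (hf : ContinuousOn f s)
    {t : Set β} (ht : MeasurableSet t) : MeasurableSet (s ∩ f ⁻¹' t) := by
  have h := hs.subtype_image ((continuousOn_iff_continuous_domRestrict.1 hf).measurable ht)
  convert h using 1
  ext x
  simp [and_comm]

variable {n N k : ℕ} {X : Type*} [TopologicalSpace X] [ChartedSpace (Fin n → ℂ) X]

/-- The density of the local measure in a product chart. -/
noncomputable def localDensity (s : Fin N → pluricanonicalForms n X k)
    (e : Fin N → atlas (Fin n → ℂ) X) (z : Fin N → Fin n → ℂ) : ℝ≥0∞ :=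
  ENNReal.ofReal (‖(Matrix.of fun i j : Fin N => (s i).1 (e j) (z j)).det‖ ^ (2 / (k : ℝ)))

/-- The inverse of a product chart. -/
noncomputable def tupleSymm (e : Fin N → atlas (Fin n → ℂ) X) (z : Fin N → Fin n → ℂ) : Fin N → X :=
  fun j => (e j).1.symm (z j)

/-- The target of a product chart. -/
noncomputable def tupleTarget (e : Fin N → atlas (Fin n → ℂ) X) : Set (Fin N → Fin n → ℂ) :=
  box fun j => (e j).1.target

/-- The source of a product chart. -/
noncomputable def tupleSource (e : Fin N → atlas (Fin n → ℂ) X) : Set (Fin N → X) :=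
  box fun j => (e j).1.source

theorem isOpen_tupleTarget (e : Fin N → atlas (Fin n → ℂ) X) : IsOpen (tupleTarget e) :=
  isOpen_box fun j => (e j).1.open_target

theorem isOpen_tupleSource (e : Fin N → atlas (Fin n → ℂ) X) : IsOpen (tupleSource e) :=
  isOpen_box fun j => (e j).1.open_source

theorem continuousOn_tupleSymm (e : Fin N → atlas (Fin n → ℂ) X) :
    ContinuousOn (tupleSymm e) (tupleTarget e) :=
  continuousOn_box fun j => (e j).1.continuousOn_symm

theorem tupleSymm_mem_tupleSource {e : Fin N → atlas (Fin n → ℂ) X} {z : Fin N → Fin n → ℂ}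
    (hz : z ∈ tupleTarget e) : tupleSymm e z ∈ tupleSource e := fun j => (e j).1.map_target (hz j)

theorem exists_mem_tupleSource (x : Fin N → X) :
    ∃ e : Fin N → atlas (Fin n → ℂ) X, x ∈ tupleSource e :=
  ⟨fun j => achart _ (x j), fun j => mem_chart_source _ (x j)⟩

variable [MeasurableSpace X] [BorelSpace X] [SecondCountableTopology X]

theorem localMeasure_apply (s : Fin N → pluricanonicalForms n X k)
    (e : Fin N → atlas (Fin n → ℂ) X) {A : Set (Fin N → X)} (hA : MeasurableSet A) :
    localMeasure s e A = ∫⁻ z in tupleTarget e ∩ tupleSymm e ⁻¹' A, localDensity s e z := by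
  have hm : MeasurableSet (tupleTarget e) := (isOpen_tupleTarget e).measurableSet
  have h1 : AEMeasurable (tupleSymm e)
      ((volume.restrict (tupleTarget e)).withDensity (localDensity s e)) :=
    ((continuousOn_tupleSymm e).aemeasurable hm).mono_ac (withDensity_absolutelyContinuous _ _)
  change Measure.map (tupleSymm e)
    ((volume.restrict (tupleTarget e)).withDensity (localDensity s e)) A = _
  rw [Measure.map_apply_of_aemeasurable h1 hA, withDensity_apply', Measure.restrict_restrict' hm,
    inter_comm]

theorem localMeasure_restrict_tupleSource (s : Fin N → pluricanonicalForms n X k)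
    (e : Fin N → atlas (Fin n → ℂ) X) :
    (localMeasure s e).restrict (tupleSource e) = localMeasure s e := by
  have hm := (isOpen_tupleSource e).measurableSet
  ext A hA
  rw [Measure.restrict_apply hA, localMeasure_apply s e hA, localMeasure_apply s e (hA.inter hm)]
  congr 2
  ext z
  simp only [mem_inter_iff, mem_preimage]
  exact ⟨fun h => ⟨h.1, h.2.1⟩, fun h => ⟨h.1, h.2, tupleSymm_mem_tupleSource h.1⟩⟩

variable {X' : Type*} [TopologicalSpace X'] [ChartedSpace (Fin n → ℂ) X'] [MeasurableSpace X']
  [BorelSpace X'] [SecondCountableTopology X']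

/-- The map `f` is biholomorphic from the open set `U` to the open set `U'`, with inverse `g`. -/
structure IsBihol (n : ℕ) {X X' : Type*} [TopologicalSpace X] [ChartedSpace (Fin n → ℂ) X]
    [TopologicalSpace X'] [ChartedSpace (Fin n → ℂ) X'] (f : X → X') (g : X' → X) (U : Set X)
    (U' : Set X') : Prop where
  isOpen : IsOpen U
  isOpen' : IsOpen U'
  isHolAt : ∀ x ∈ U, IsHolAt n n f x
  isHolAt' : ∀ y ∈ U', IsHolAt n n g y
  mapsTo : MapsTo f U U'
  mapsTo' : MapsTo g U' U
  left_inv : ∀ x ∈ U, g (f x) = x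
  right_inv : ∀ y ∈ U', f (g y) = y

/-- The part of `U` which is in the domain of the chart `e` and is mapped by `f` into the domain
of the chart `e'`. -/
noncomputable def chartDomain (f : X → X') (U : Set X) (e : atlas (Fin n → ℂ) X)
    (e' : atlas (Fin n → ℂ) X') : Set X :=
  {x | x ∈ U ∧ x ∈ e.1.source ∧ f x ∈ e'.1.source}

theorem isOpen_chartDomain {X X' : Type*} [TopologicalSpace X] [ChartedSpace (Fin n → ℂ) X]
    [TopologicalSpace X'] [ChartedSpace (Fin n → ℂ) X'] {f : X → X'} {U : Set X} (hU : IsOpen U)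
    (hf : ∀ x ∈ U, ContinuousAt f x) (e : atlas (Fin n → ℂ) X) (e' : atlas (Fin n → ℂ) X') :
    IsOpen (chartDomain f U e e') := by
  refine isOpen_iff_mem_nhds.2 fun x hx => ?_
  filter_upwards [hU.mem_nhds hx.1, e.1.open_source.mem_nhds hx.2.1,
    (hf x hx.1).eventually_mem (e'.1.open_source.mem_nhds hx.2.2)] with y h1 h2 h3
    using ⟨h1, h2, h3⟩

/-- A block-diagonal determinant is a product, and the real determinant of a complex-linear map is
the squared modulus of its complex one. -/
theorem abs_det_restrictScalars_pi {N n : ℕ} (L : Fin N → (Fin n → ℂ) →L[ℂ] (Fin n → ℂ)) :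
    |((ContinuousLinearMap.pi fun j => (L j).comp
      (ContinuousLinearMap.proj (R := ℂ) (φ := fun _ : Fin N => Fin n → ℂ) j)).restrictScalars
        ℝ).det| = (∏ j, ‖(L j).det‖) ^ 2 := by
  have h1 : LinearMap.det ((ContinuousLinearMap.pi fun j => (L j).comp
      (ContinuousLinearMap.proj (R := ℂ) (φ := fun _ : Fin N => Fin n → ℂ) j)) :
        (Fin N → Fin n → ℂ) →ₗ[ℂ] (Fin N → Fin n → ℂ)) = ∏ j, (L j).det :=
    LinearMap.det_pi fun j => (L j : (Fin n → ℂ) →ₗ[ℂ] (Fin n → ℂ))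
  have h2 := LinearMap.det_restrictScalars (R := ℝ) (S := ℂ)
    (f := ((ContinuousLinearMap.pi fun j => (L j).comp
      (ContinuousLinearMap.proj (R := ℂ) (φ := fun _ : Fin N => Fin n → ℂ) j)) :
        (Fin N → Fin n → ℂ) →ₗ[ℂ] (Fin N → Fin n → ℂ)))
  rw [h1, Algebra.norm_complex_eq] at h2
  have h3 : ((ContinuousLinearMap.pi fun j => (L j).comp
      (ContinuousLinearMap.proj (R := ℂ) (φ := fun _ : Fin N => Fin n → ℂ) j)).restrictScalars
        ℝ).det = Complex.normSq (∏ j, (L j).det) := h2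
  rw [h3, Complex.normSq_eq_norm_sq, abs_of_nonneg (by positivity), norm_prod]

-- The factor `J_j ^ k` is common to column `j` and comes out of the determinant; the exponent `2 /
-- k` turns it into `|J_j|²`, exactly the real Jacobian.
omit [MeasurableSpace X] [BorelSpace X] [SecondCountableTopology X] [MeasurableSpace X']
  [BorelSpace X'] [SecondCountableTopology X'] in
theorem localDensity_eq_of_isPullbackOn (hk : 1 ≤ k) {s : Fin N → pluricanonicalForms n X k}
    {s' : Fin N → pluricanonicalForms n X' k} {f : X → X'} {U : Set X}
    (hs : ∀ i, IsPullbackOn f U (s i) (s' i)) {e : Fin N → atlas (Fin n → ℂ) X}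
    {e' : Fin N → atlas (Fin n → ℂ) X'} {x : Fin N → X}
    (hx : x ∈ box fun j => chartDomain f U (e j) (e' j)) :
    localDensity s e (fun j => (e j).1 (x j)) =
      ENNReal.ofReal ((∏ j, ‖(fderiv ℂ ((e' j).1 ∘ f ∘ (e j).1.symm) ((e j).1 (x j))).det‖) ^ 2) *
        localDensity s' e' fun j => (e' j).1 (f (x j)) := by
  have hk0 : (k : ℝ) ≠ 0 := by positivity
  set d : Fin N → ℂ := fun j => (fderiv ℂ ((e' j).1 ∘ f ∘ (e j).1.symm) ((e j).1 (x j))).det with hd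
  have h1 : (Matrix.of fun i j : Fin N => (s i).1 (e j) ((e j).1 (x j))) =
      Matrix.of fun i j : Fin N => d j ^ k * (Matrix.of fun i j : Fin N =>
        (s' i).1 (e' j) ((e' j).1 (f (x j)))) i j := by
    ext i j
    simp only [Matrix.of_apply]
    rw [hs i (e j) (e' j) (x j) (hx j).1 (hx j).2.1 (hx j).2.2, mul_comm]
  unfold localDensity
  rw [h1, Matrix.det_mul_row, ← ENNReal.ofReal_mul (by positivity), norm_mul,
    Real.mul_rpow (norm_nonneg _) (norm_nonneg _)]
  congr 2
  rw [Finset.prod_pow, norm_pow, norm_prod, ← Real.rpow_natCast, ← Real.rpow_mul (by positivity),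
    mul_div_cancel₀ _ hk0]
  norm_cast

/-- The local measures correspond to each other under a biholomorphic map. -/
theorem IsBihol.map_localMeasure (hk : 1 ≤ k) {s : Fin N → pluricanonicalForms n X k}
    {s' : Fin N → pluricanonicalForms n X' k} {f : X → X'} {g : X' → X} {U : Set X} {U' : Set X'}
    (h : IsBihol n f g U U') (hs : ∀ i, IsPullbackOn f U (s i) (s' i))
    (e : Fin N → atlas (Fin n → ℂ) X) (e' : Fin N → atlas (Fin n → ℂ) X') :
    ((localMeasure s e).restrict (box fun j => chartDomain f U (e j) (e' j))).map
      (fun x j => f (x j)) =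
      (localMeasure s' e').restrict (box fun j => chartDomain g U' (e' j) (e j)) := by
  set Ω : Set (Fin N → X) := box fun j => chartDomain f U (e j) (e' j) with hΩ
  set Ω' : Set (Fin N → X') := box fun j => chartDomain g U' (e' j) (e j) with hΩ'
  have hΩo : IsOpen Ω := isOpen_box fun j =>
    isOpen_chartDomain h.isOpen (fun x hx => (h.isHolAt x hx).continuousAt) (e j) (e' j)
  have hΩo' : IsOpen Ω' := isOpen_box fun j =>
    isOpen_chartDomain h.isOpen' (fun x hx => (h.isHolAt' x hx).continuousAt) (e' j) (e j)
  have hfc : ContinuousOn (fun (x : Fin N → X) j => f (x j)) Ω := continuousOn_box fun j x hx =>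
    (h.isHolAt x hx.1).continuousAt.continuousWithinAt
  ext A' hA'
  rw [Measure.map_apply_of_aemeasurable (hfc.aemeasurable hΩo.measurableSet) hA',
    Measure.restrict_apply' hΩo.measurableSet, Measure.restrict_apply hA', inter_comm,
    localMeasure_apply s e
      (measurableSet_inter_preimage_of_continuousOn hΩo.measurableSet hfc hA'),
    localMeasure_apply s' e' (hA'.inter hΩo'.measurableSet)]
  set S := tupleTarget e ∩ tupleSymm e ⁻¹' (Ω ∩ (fun (x : Fin N → X) j => f (x j)) ⁻¹' A') with hS
  have hSm : MeasurableSet S := measurableSet_inter_preimage_of_continuousOn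
    (isOpen_tupleTarget e).measurableSet (continuousOn_tupleSymm e)
    (measurableSet_inter_preimage_of_continuousOn hΩo.measurableSet hfc hA')
  let ψ : Fin N → (Fin n → ℂ) → Fin n → ℂ := fun j => (e' j).1 ∘ f ∘ (e j).1.symm
  let Ψ : (Fin N → Fin n → ℂ) → Fin N → Fin n → ℂ := fun z j => ψ j (z j)
  have himage : Ψ '' S = tupleTarget e' ∩ tupleSymm e' ⁻¹' (A' ∩ Ω') := by
    ext w
    constructor
    · rintro ⟨z, ⟨hz, hzΩ, hzA⟩, rfl⟩
      have h1 : tupleSymm e' (Ψ z) = fun j => f (tupleSymm e z j) :=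
        funext fun j => (e' j).1.left_inv (hzΩ j).2.2
      refine ⟨fun j => (e' j).1.map_source (hzΩ j).2.2, ?_⟩
      rw [mem_preimage, h1]
      refine ⟨hzA, fun j => ⟨h.mapsTo (hzΩ j).1, (hzΩ j).2.2, ?_⟩⟩
      rw [h.left_inv _ (hzΩ j).1]
      exact (hzΩ j).2.1
    · rintro ⟨hw, hwA, hwΩ⟩
      refine ⟨fun j => (e j).1 (g (tupleSymm e' w j)),
        ⟨fun j => (e j).1.map_source (hwΩ j).2.2, ?_⟩, ?_⟩
      · have h1 : tupleSymm e (fun j => (e j).1 (g (tupleSymm e' w j))) =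
            fun j => g (tupleSymm e' w j) := funext fun j => (e j).1.left_inv (hwΩ j).2.2
        have h2 : (fun j => f (g (tupleSymm e' w j))) = tupleSymm e' w :=
          funext fun j => h.right_inv _ (hwΩ j).1
        rw [mem_preimage, h1]
        refine ⟨fun j => ⟨h.mapsTo' (hwΩ j).1, (hwΩ j).2.2, ?_⟩, ?_⟩
        · rw [h.right_inv _ (hwΩ j).1]
          exact (hwΩ j).2.1
        · rw [mem_preimage, h2]
          exact hwA
      · ext1 j
        change (e' j).1 (f ((e j).1.symm ((e j).1 (g (tupleSymm e' w j))))) = w j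
        rw [(e j).1.left_inv (hwΩ j).2.2, h.right_inv _ (hwΩ j).1]
        exact (e' j).1.right_inv (hw j)
  have hinj : InjOn Ψ S := by
    rintro z ⟨hz, hzΩ, -⟩ w ⟨hw, hwΩ, -⟩ hzw
    ext1 j
    have h1 := (e' j).1.injOn (hzΩ j).2.2 (hwΩ j).2.2 (congrFun hzw j)
    have h2 := congrArg g h1
    rw [h.left_inv _ (hzΩ j).1, h.left_inv _ (hwΩ j).1] at h2
    exact (e j).1.symm.injOn (hz j) (hw j) h2
  have hderiv : ∀ z ∈ S, HasFDerivWithinAt Ψ ((ContinuousLinearMap.pi fun j =>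
      (fderiv ℂ (ψ j) (z j)).comp (ContinuousLinearMap.proj (R := ℂ)
        (φ := fun _ : Fin N => Fin n → ℂ) j)).restrictScalars ℝ) S z := by
    rintro z ⟨hz, hzΩ, -⟩
    refine (HasFDerivAt.restrictScalars ℝ ?_).hasFDerivWithinAt
    refine hasFDerivAt_pi.2 fun j => ?_
    have h1 := ((h.isHolAt _ (hzΩ j).1).differentiableAt (e j) (e' j) (hzΩ j).2.1
      (hzΩ j).2.2).self_of_nhds
    have h2 : (e j).1 (tupleSymm e z j) = z j := (e j).1.right_inv (hz j)
    rw [h2] at h1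
    exact h1.hasFDerivAt.comp z (ContinuousLinearMap.proj (R := ℂ)
      (φ := fun _ : Fin N => Fin n → ℂ) j).hasFDerivAt
  have hHaar : (volume : Measure (Fin N → Fin n → ℂ)).IsAddHaarMeasure :=
    Measure.pi.isAddHaarMeasure _
  rw [← himage, lintegral_image_eq_lintegral_abs_det_fderiv_mul
    (volume : Measure (Fin N → Fin n → ℂ)) hSm hderiv hinj]
  refine setLIntegral_congr_fun hSm ?_
  rintro z ⟨hz, hzΩ, -⟩
  have h1 := localDensity_eq_of_isPullbackOn hk hs hzΩ
  have h2 : (fun j => (e j).1 (tupleSymm e z j)) = z := funext fun j => (e j).1.right_inv (hz j)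
  have h3 : ∀ j, (e j).1 (tupleSymm e z j) = z j := congrFun h2
  simp only [h3] at h1
  change localDensity s e z = _
  simp only [abs_det_restrictScalars_pi]
  exact h1

end LocalMeasure

/-! ### The global measure -/

section Glue

variable {n N k : ℕ} {X : Type*} [TopologicalSpace X] [ChartedSpace (Fin n → ℂ) X]
  [IsManifold 𝓘(ℂ, Fin n → ℂ) ω X]

theorem isBihol_id : IsBihol n (fun x : X => x) (fun x : X => x) univ univ := by
  have h : ∀ x : X, IsHolAt n n (fun x : X => x) x := fun x =>
    ⟨continuousAt_id, fun e e' he he' => by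
      filter_upwards [(contDiffAt_transition e e' he he').eventually (by simp)] with w hw
        using hw.differentiableAt (by simp)⟩
  exact ⟨isOpen_univ, isOpen_univ, fun x _ => h x, fun x _ => h x, fun x _ => trivial,
    fun x _ => trivial, fun x _ => rfl, fun x _ => rfl⟩

omit [IsManifold 𝓘(ℂ, Fin n → ℂ) ω X] in
theorem isPullbackOn_id (s : pluricanonicalForms n X k) :
    IsPullbackOn (fun x : X => x) univ s s :=
  fun e e' x _ hx hx' => s.2.2.2 e e' x ⟨hx, hx'⟩

variable [MeasurableSpace X] [BorelSpace X] [SecondCountableTopology X]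

/-- Independence of the chart is change of variables for the identity map. -/
theorem localMeasure_restrict_comm (hk : 1 ≤ k) (s : Fin N → pluricanonicalForms n X k)
    (e e' : Fin N → atlas (Fin n → ℂ) X) :
    (localMeasure s e).restrict (tupleSource e') = (localMeasure s e').restrict (tupleSource e) := by
  have h := isBihol_id.map_localMeasure hk (fun i => isPullbackOn_id (s i)) e e'
  have h1 : (box fun j => chartDomain (fun x : X => x) univ (e j) (e' j)) =
      tupleSource e' ∩ tupleSource e := by
    ext x
    exact ⟨fun hx => ⟨fun j => (hx j).2.2, fun j => (hx j).2.1⟩,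
      fun hx j => ⟨trivial, hx.2 j, hx.1 j⟩⟩
  have h2 : (box fun j => chartDomain (fun x : X => x) univ (e' j) (e j)) =
      tupleSource e ∩ tupleSource e' := by
    ext x
    exact ⟨fun hx => ⟨fun j => (hx j).2.2, fun j => (hx j).2.1⟩,
      fun hx j => ⟨trivial, hx.2 j, hx.1 j⟩⟩
  have h3 : (fun (x : Fin N → X) j => x j) = id := rfl
  rw [h1, h2, h3, Measure.map_id,
    ← Measure.restrict_restrict' (isOpen_tupleSource e).measurableSet,
    ← Measure.restrict_restrict' (isOpen_tupleSource e').measurableSet,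
    localMeasure_restrict_tupleSource, localMeasure_restrict_tupleSource] at h
  exact h

/-- The global measure restricts to the local measures. -/
theorem detMeasure_restrict (hk : 1 ≤ k) (s : Fin N → pluricanonicalForms n X k)
    (e : Fin N → atlas (Fin n → ℂ) X) :
    (detMeasure s).restrict (tupleSource e) = localMeasure s e := by
  have hm := (isOpen_tupleSource e).measurableSet
  refine le_antisymm ?_ ?_
  -- A supremum of measures is not computed set by set. Each local measure is therefore bounded by
  -- one measure whose second term disappears on restriction to the source of `e`.
  · have h1 : detMeasure s ≤ localMeasure s e +
        (⊤ : Measure (Fin N → X)).restrict (tupleSource e)ᶜ := by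
      refine iSup_le fun e' => ?_
      rw [← Measure.restrict_add_restrict_compl (μ := localMeasure s e') hm]
      refine add_le_add ?_ (Measure.restrict_mono Subset.rfl le_top)
      rw [localMeasure_restrict_comm hk]
      exact Measure.restrict_le_self
    refine (Measure.restrict_mono Subset.rfl h1).trans ?_
    rw [Measure.restrict_add, Measure.restrict_restrict hm, inter_compl_self,
      Measure.restrict_empty, add_zero]
    exact Measure.restrict_le_self
  · rw [← localMeasure_restrict_tupleSource s e]
    exact Measure.restrict_mono Subset.rfl (le_iSup (localMeasure s) e)

omit [IsManifold 𝓘(ℂ, Fin n → ℂ) ω X] [BorelSpace X] [MeasurableSpace X] in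
theorem exists_countable_iUnion_tupleSource : ∃ T : Set (Fin N → atlas (Fin n → ℂ) X),
    T.Countable ∧ ⋃ e ∈ T, tupleSource e = univ := by
  obtain ⟨T, hT, h⟩ := TopologicalSpace.isOpen_iUnion_countable
    (fun e : Fin N → atlas (Fin n → ℂ) X => tupleSource e) isOpen_tupleSource
  refine ⟨T, hT, h.trans (eq_univ_of_forall fun x => ?_)⟩
  obtain ⟨e, he⟩ := exists_mem_tupleSource (n := n) x
  exact mem_iUnion.2 ⟨e, he⟩

/-- By second countability, countably many product charts cover `X^N`, and measures that agree on
each of them are equal. -/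
theorem eq_detMeasure (hk : 1 ≤ k) {s : Fin N → pluricanonicalForms n X k}
    {ν : Measure (Fin N → X)} (h : ∀ e, ν.restrict (tupleSource e) = localMeasure s e) :
    ν = detMeasure s := by
  obtain ⟨T, hT, hTu⟩ := exists_countable_iUnion_tupleSource (n := n) (N := N) (X := X)
  have := (Measure.restrict_biUnion_congr (μ := ν) (ν := detMeasure s) hT).2
    fun e _ => (h e).trans (detMeasure_restrict hk s e).symm
  rwa [hTu, Measure.restrict_univ, Measure.restrict_univ] at this

theorem detMeasure_eq_zero (hk : 1 ≤ k) {s : Fin N → pluricanonicalForms n X k}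
    {B : Set (Fin N → X)} (h : ∀ e, localMeasure s e B = 0) : detMeasure s B = 0 := by
  refine measure_null_of_locally_null B fun x _ => ?_
  obtain ⟨e, he⟩ := exists_mem_tupleSource (n := n) x
  refine ⟨B ∩ tupleSource e, inter_mem self_mem_nhdsWithin
    (mem_nhdsWithin_of_mem_nhds ((isOpen_tupleSource e).mem_nhds he)), ?_⟩
  rw [← Measure.restrict_apply' (isOpen_tupleSource e).measurableSet, detMeasure_restrict hk, h e]

/-! ### Finiteness and positivity of the partition function -/

omit [IsManifold 𝓘(ℂ, Fin n → ℂ) ω X] [SecondCountableTopology X] [MeasurableSpace X]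
  [BorelSpace X] in
theorem continuousAt_localDensity (hk : 1 ≤ k) (s : Fin N → pluricanonicalForms n X k)
    (e : Fin N → atlas (Fin n → ℂ) X) {z : Fin N → Fin n → ℂ} (hz : z ∈ tupleTarget e) :
    ContinuousAt (localDensity s e) z := by
  have hk0 : 0 < (2 / (k : ℝ)) := by positivity
  unfold localDensity
  refine ENNReal.continuous_ofReal.continuousAt.comp ?_
  refine ContinuousAt.rpow_const ?_ (Or.inr hk0.le)
  refine ContinuousAt.norm ?_
  simp only [Matrix.det_apply']
  refine tendsto_finsetSum _ fun σ _ => tendsto_const_nhds.mul (tendsto_finsetProd _ fun j _ => ?_)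
  simp only [Matrix.of_apply]
  have h1 : ContinuousAt ((s (σ j)).1 (e j)) (z j) := continuousAt_coeff (s (σ j)) (e j) (hz j)
  exact h1.tendsto.comp ((continuous_apply j).tendsto z)

/-- The density is continuous in product charts, so the measure is locally finite; compactness does
the rest. -/
theorem partitionFunction_lt_top [CompactSpace X] (hk : 1 ≤ k)
    (s : Fin N → pluricanonicalForms n X k) : partitionFunction s < ⊤ := by
  refine isCompact_univ.measure_lt_top_of_nhdsWithin fun x _ => ?_
  rw [nhdsWithin_univ]
  obtain ⟨e, he⟩ := exists_mem_tupleSource (n := n) x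
  set z : Fin N → Fin n → ℂ := fun j => (e j).1 (x j) with hz
  have hzt : z ∈ tupleTarget e := fun j => (e j).1.map_source (he j)
  have hc := continuousAt_localDensity hk s e hzt
  have hfin : localDensity s e z < ⊤ := ENNReal.ofReal_lt_top
  obtain ⟨C, hC1, hC2⟩ := exists_between hfin
  have hlt : ∀ᶠ w in 𝓝 z, localDensity s e w < C := hc.eventually_lt continuousAt_const hC1
  obtain ⟨r, hr, hrC⟩ := Metric.mem_nhds_iff.1 hlt
  have hW : ∀ᶠ y in 𝓝 x, y ∈ tupleSource e ∧ (fun j => (e j).1 (y j)) ∈ Metric.ball z r := by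
    refine ((isOpen_tupleSource e).eventually_mem he).and ?_
    have h1 : ContinuousAt (fun (y : Fin N → X) j => (e j).1 (y j)) x :=
      continuousAt_pi.2 fun j => ContinuousAt.comp (f := fun y : Fin N → X => y j)
        ((e j).1.continuousAt (he j)) (continuous_apply j).continuousAt
    exact h1.eventually_mem (Metric.ball_mem_nhds z hr)
  obtain ⟨W, hWs, hWo, hxW⟩ := _root_.eventually_nhds_iff.1 hW
  refine ⟨W, hWo.mem_nhds hxW, ?_⟩
  have hWsrc : W ∩ tupleSource e = W := inter_eq_left.2 fun y hy => (hWs y hy).1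
  rw [← hWsrc, ← Measure.restrict_apply' (isOpen_tupleSource e).measurableSet,
    detMeasure_restrict hk, localMeasure_apply s e hWo.measurableSet]
  have hsub : tupleTarget e ∩ tupleSymm e ⁻¹' W ⊆ Metric.ball z r := by
    rintro w ⟨hw, hwW⟩
    have h1 := (hWs _ hwW).2
    have h2 : (fun j => (e j).1 (tupleSymm e w j)) = w := funext fun j => (e j).1.right_inv (hw j)
    rwa [h2] at h1
  calc ∫⁻ w in tupleTarget e ∩ tupleSymm e ⁻¹' W, localDensity s e w
      ≤ ∫⁻ w in Metric.ball z r, localDensity s e w := lintegral_mono_set hsub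
    _ ≤ ∫⁻ w in Metric.ball z r, C := setLIntegral_mono' Metric.isOpen_ball.measurableSet
        fun w hw => (hrC hw).le
    _ = C * volume (Metric.ball z r) := by rw [setLIntegral_const]
    _ < ⊤ := ENNReal.mul_lt_top hC2 measure_ball_lt_top

omit [IsManifold 𝓘(ℂ, Fin n → ℂ) ω X] in
theorem localMeasure_univ_pos (hk : 1 ≤ k) (s : Fin N → pluricanonicalForms n X k)
    (e : Fin N → atlas (Fin n → ℂ) X) {z : Fin N → Fin n → ℂ}
    (hz : (Matrix.of fun i j : Fin N => (s i).1 (e j) (z j)).det ≠ 0) :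
    0 < localMeasure s e univ := by
  -- Coefficients are zero off the chart target, so a point outside would produce a zero column.
  have hzt : z ∈ tupleTarget e := by
    intro j
    by_contra hj
    refine hz (Matrix.det_eq_zero_of_column_eq_zero j fun i => ?_)
    exact (s i).2.2.1 (e j) (z j) hj
  have hpos : 0 < localDensity s e z := by
    unfold localDensity
    rw [ENNReal.ofReal_pos]
    have := norm_pos_iff.2 hz
    positivity
  obtain ⟨c, hc0, hc⟩ := exists_between hpos
  have hlt : ∀ᶠ w in 𝓝 z, c < localDensity s e w :=
    continuousAt_const.eventually_lt (continuousAt_localDensity hk s e hzt) hc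
  obtain ⟨r, hr, hrC⟩ := Metric.mem_nhds_iff.1
    (inter_mem hlt ((isOpen_tupleTarget e).mem_nhds hzt))
  rw [localMeasure_apply s e MeasurableSet.univ, preimage_univ, inter_univ]
  have hball : 0 < volume (Metric.ball z r) := Metric.measure_ball_pos volume z hr
  calc 0 < c * volume (Metric.ball z r) := ENNReal.mul_pos hc0.ne' hball.ne'
    _ = ∫⁻ w in Metric.ball z r, c := by rw [setLIntegral_const]
    _ ≤ ∫⁻ w in Metric.ball z r, localDensity s e w :=
        setLIntegral_mono' Metric.isOpen_ball.measurableSet fun w hw => (hrC hw).1.le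
    _ ≤ ∫⁻ w in tupleTarget e, localDensity s e w := lintegral_mono_set fun w hw => (hrC hw).2

/-- Linearly independent functions are linearly independent on suitable points. -/
theorem exists_det_ne_zero_of_linearIndependent {α : Type*} {N : ℕ} {v : Fin N → α → ℂ}
    (hv : LinearIndependent ℂ v) : ∃ a : Fin N → α, (Matrix.of fun i j => v i (a j)).det ≠ 0 := by
  set S : Set (Fin N → ℂ) := range fun a i => v i a with hS
  have htop : Submodule.span ℂ S = ⊤ := by
    by_contra hne
    obtain ⟨φ, hφ0, hφ⟩ := Submodule.exists_le_ker_of_lt_top _ (lt_top_iff_ne_top.2 hne)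
    refine hφ0 (LinearMap.pi_ext' fun i => LinearMap.ext_ring ?_)
    -- A functional killing all vectors `(v i a)ᵢ` is a linear relation among the functions `v i`.
    have h1 : ∑ i, φ (Pi.single i 1) • v i = 0 := by
      ext a
      have h2 : φ (fun i => v i a) = 0 := hφ (Submodule.subset_span ⟨a, rfl⟩)
      rw [LinearMap.pi_apply_eq_sum_univ] at h2
      simp only [Finset.sum_apply, Pi.smul_apply, smul_eq_mul, Pi.zero_apply]
      rw [← h2]
      refine Finset.sum_congr rfl fun i _ => ?_
      rw [smul_eq_mul, mul_comm]
      congr 2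
      ext j
      simp [Pi.single_apply, eq_comm]
    exact Fintype.linearIndependent_iff.1 hv _ h1 i
  obtain ⟨w, hwS, -, hw⟩ := Submodule.exists_fun_fin_finrank_span_eq ℂ S
  have hdim : Module.finrank ℂ (Submodule.span ℂ S) = N := by rw [htop, finrank_top]; simp
  choose a ha using hwS
  refine ⟨fun j => a (Fin.cast hdim.symm j), ?_⟩
  have h3 : LinearIndependent ℂ
      (Matrix.of fun i j => v i (a (Fin.cast hdim.symm j)) : Matrix (Fin N) (Fin N) ℂ).col := by
    have h4 := hw.comp (Fin.cast hdim.symm) (Fin.cast_injective _)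
    have h5 : (Matrix.of fun i j => v i (a (Fin.cast hdim.symm j)) :
        Matrix (Fin N) (Fin N) ℂ).col = w ∘ Fin.cast hdim.symm := by
      ext j i
      exact congrFun (ha (Fin.cast hdim.symm j)) i
    rw [h5]
    exact h4
  rw [Matrix.linearIndependent_cols_iff_isUnit, Matrix.isUnit_iff_isUnit_det] at h3
  exact h3.ne_zero

-- Linear independence makes the determinant nonzero at some tuple of (chart, coordinate) pairs, and
-- continuity of the density then gives positive mass.
omit [IsManifold 𝓘(ℂ, Fin n → ℂ) ω X] in
theorem partitionFunction_pos (hk : 1 ≤ k) {s : Fin N → pluricanonicalForms n X k}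
    (hs : LinearIndependent ℂ s) : 0 < partitionFunction s := by
  have h1 : LinearIndependent ℂ fun i => fun p : atlas (Fin n → ℂ) X × (Fin n → ℂ) =>
      (s i).1 p.1 p.2 := by
    let L : pluricanonicalForms n X k →ₗ[ℂ] (atlas (Fin n → ℂ) X × (Fin n → ℂ) → ℂ) :=
      { toFun := fun s p => s.1 p.1 p.2
        map_add' := fun s t => rfl
        map_smul' := fun c s => rfl }
    refine hs.map' L (LinearMap.ker_eq_bot.2 fun s t hst => ?_)
    exact Subtype.ext (funext fun e => funext fun z => congrFun hst (e, z))
  obtain ⟨a, ha⟩ := exists_det_ne_zero_of_linearIndependent h1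
  have h2 := localMeasure_univ_pos hk s (fun j => (a j).1) (z := fun j => (a j).2) ha
  exact h2.trans_le (le_iSup (localMeasure s) _ univ)

theorem isProbabilityMeasure_canonicalMeasure [CompactSpace X] (hk : 1 ≤ k)
    (s : Module.Basis (Fin N) ℂ (pluricanonicalForms n X k)) :
    IsProbabilityMeasure (canonicalMeasure s) := by
  refine ⟨?_⟩
  change (partitionFunction s)⁻¹ * partitionFunction s = 1
  exact ENNReal.inv_mul_cancel (partitionFunction_pos hk s.linearIndependent).ne'
    (partitionFunction_lt_top hk s).ne

/-! ### Independence of the basis -/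

/-- A change of basis with matrix `A` multiplies the determinant by `det A`, hence every local
density by the constant `|det A|^{2/k}`. -/
theorem exists_detMeasure_eq_smul (hk : 1 ≤ k)
    (s t : Module.Basis (Fin N) ℂ (pluricanonicalForms n X k)) :
    ∃ c : ℝ≥0∞, c ≠ 0 ∧ c ≠ ⊤ ∧ detMeasure s = c • detMeasure t := by
  set A : Matrix (Fin N) (Fin N) ℂ := (t.toMatrix s).transpose with hA
  have hAdet : A.det ≠ 0 := by
    rw [hA, Matrix.det_transpose]
    intro h0
    have h1 := congrArg Matrix.det (t.toMatrix_mul_toMatrix_flip s)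
    rw [Matrix.det_mul, h0, zero_mul, Matrix.det_one] at h1
    exact zero_ne_one h1
  have hsA : ∀ i, s i = ∑ l, A i l • t l := fun i => by
    simp only [hA, Matrix.transpose_apply]
    exact (t.sum_toMatrix_smul_self s i).symm
  have hdens : ∀ (e : Fin N → atlas (Fin n → ℂ) X) z, localDensity s e z =
      ENNReal.ofReal (‖A.det‖ ^ (2 / (k : ℝ))) * localDensity t e z := by
    intro e z
    have h1 : (Matrix.of fun i j : Fin N => (s i).1 (e j) (z j)) =
        A * Matrix.of fun i j : Fin N => (t i).1 (e j) (z j) := by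
      ext i j
      rw [Matrix.mul_apply, Matrix.of_apply, hsA i, Submodule.coe_sum]
      simp [Finset.sum_apply]
    unfold localDensity
    rw [h1, Matrix.det_mul, norm_mul, Real.mul_rpow (norm_nonneg _) (norm_nonneg _),
      ENNReal.ofReal_mul (by positivity)]
  refine ⟨ENNReal.ofReal (‖A.det‖ ^ (2 / (k : ℝ))), ?_, ENNReal.ofReal_ne_top, ?_⟩
  · have := norm_pos_iff.2 hAdet
    exact (ENNReal.ofReal_pos.2 (by positivity)).ne'
  · refine (eq_detMeasure hk fun e => ?_).symm
    rw [Measure.restrict_smul, detMeasure_restrict hk]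
    ext B hB
    rw [Measure.smul_apply, localMeasure_apply _ e hB, localMeasure_apply _ e hB, smul_eq_mul,
      ← lintegral_const_mul' _ _ ENNReal.ofReal_ne_top]
    simp only [hdens]

theorem canonicalMeasure_eq (hk : 1 ≤ k)
    (s t : Module.Basis (Fin N) ℂ (pluricanonicalForms n X k)) :
    canonicalMeasure s = canonicalMeasure t := by
  obtain ⟨c, hc0, hc, h⟩ := exists_detMeasure_eq_smul hk s t
  unfold canonicalMeasure partitionFunction
  rw [h, Measure.smul_apply, smul_smul, smul_eq_mul, ENNReal.mul_inv (Or.inl hc0) (Or.inl hc),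
    mul_right_comm, ENNReal.inv_mul_cancel hc0 hc, one_mul]

end Glue

/-! ### The push-forward of the canonical measure -/

section Null

variable {n N k M : ℕ} {X : Type*} [TopologicalSpace X] [ChartedSpace (Fin n → ℂ) X]
  [IsManifold 𝓘(ℂ, Fin n → ℂ) ω X] [ConnectedSpace X] {emb : X → ℙ ℂ (Fin (M + 1) → ℂ)}

/-- In charts this is locally the zero set of a holomorphic function that does not vanish
identically near any of its points. -/
theorem volume_symm_notMem_polyNe (hemb : IsProjectiveEmbedding n emb)
    {P : MvPolynomial (Fin (M + 1)) ℂ} {d : ℕ} (hP : P.IsHomogeneous d)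
    (hne : (polyNe emb P).Nonempty) (e : atlas (Fin n → ℂ) X) :
    volume {w | w ∈ e.1.target ∧ e.1.symm w ∉ polyNe emb P} = 0 := by
  refine measure_null_of_locally_null _ fun w hw => ?_
  obtain ⟨ρ, hρ, hρt, a, ha, haP⟩ := exists_ball_equation hemb e hw.1 hP
  have hball : ∀ᶠ z in 𝓝 w, z ∈ Metric.ball w ρ := Metric.ball_mem_nhds w hρ
  have ha' : ∀ᶠ z in 𝓝 w, DifferentiableAt ℂ a z := by
    filter_upwards [hball] with z hz using ha.differentiableAt (Metric.isOpen_ball.mem_nhds hz)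
  have ha0 : ∃ᶠ z in 𝓝 w, a z ≠ 0 :=
    ((frequently_symm_mem_polyNe hemb hP hne e hw.1).and_eventually hball).mono
      fun z hz => (haP z hz.2).1 hz.1
  obtain ⟨V, hV, hV0⟩ := exists_mem_nhds_measure_zero_set volume ha' ha0
  refine ⟨_, inter_mem_nhdsWithin _ (inter_mem hV hball), measure_mono_null ?_ hV0⟩
  rintro z ⟨hz, hzV, hzb⟩
  exact ⟨hzV, not_not.1 fun h => hz.2 ((haP z hzb).2 h)⟩

variable [MeasurableSpace X] [BorelSpace X] [SecondCountableTopology X]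

theorem detMeasure_compl_box_polyNe (hk : 1 ≤ k) (hemb : IsProjectiveEmbedding n emb)
    {P : MvPolynomial (Fin (M + 1)) ℂ} {d : ℕ} (hP : P.IsHomogeneous d)
    (hne : (polyNe emb P).Nonempty) (s : Fin N → pluricanonicalForms n X k) :
    detMeasure s (box fun _ => polyNe emb P)ᶜ = 0 := by
  refine detMeasure_eq_zero hk fun e => ?_
  rw [localMeasure_apply s e (isOpen_box fun _ => isOpen_polyNe hemb hP).measurableSet.compl]
  refine setLIntegral_measure_zero _ _ ?_
  refine measure_mono_null (t := ⋃ j, Function.eval j ⁻¹'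
    {w | w ∈ (e j).1.target ∧ (e j).1.symm w ∉ polyNe emb P}) ?_ (measure_iUnion_null fun j =>
      Measure.pi_eval_preimage_null _ (volume_symm_notMem_polyNe hemb hP hne (e j)))
  rintro z ⟨hz, hzB⟩
  obtain ⟨j, hj⟩ := not_forall.1 hzB
  exact mem_iUnion.2 ⟨j, hz j, hj⟩

end Null

section Pushforward

variable {n N k : ℕ} {X X' : Type*} [TopologicalSpace X] [ChartedSpace (Fin n → ℂ) X]
  [IsManifold 𝓘(ℂ, Fin n → ℂ) ω X] [TopologicalSpace X'] [ChartedSpace (Fin n → ℂ) X']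
  [IsManifold 𝓘(ℂ, Fin n → ℂ) ω X']
  [MeasurableSpace X] [BorelSpace X] [SecondCountableTopology X]
  [MeasurableSpace X'] [BorelSpace X'] [SecondCountableTopology X']

/-- The measures of forms that correspond under a biholomorphic map correspond. -/
theorem IsBihol.map_detMeasure (hk : 1 ≤ k) {s : Fin N → pluricanonicalForms n X k}
    {s' : Fin N → pluricanonicalForms n X' k} {f : X → X'} {g : X' → X} {U : Set X} {U' : Set X'}
    (h : IsBihol n f g U U') (hs : ∀ i, IsPullbackOn f U (s i) (s' i)) :
    ((detMeasure s).restrict (box fun _ => U)).map (fun x j => f (x j)) =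
      (detMeasure s').restrict (box fun _ => U') := by
  have hUo : IsOpen (box fun _ : Fin N => U) := isOpen_box fun _ => h.isOpen
  have hUo' : IsOpen (box fun _ : Fin N => U') := isOpen_box fun _ => h.isOpen'
  have hm : AEMeasurable (fun (x : Fin N → X) j => f (x j))
      ((detMeasure s).restrict (box fun _ => U)) :=
    (continuousOn_box fun _ x hx => (h.isHolAt x hx).continuousAt.continuousWithinAt).aemeasurable
      hUo.measurableSet
  -- On each such piece both sides are local measures in a single product chart; countably many
  -- pieces cover the target.
  set Ω' : (Fin N → atlas (Fin n → ℂ) X) × (Fin N → atlas (Fin n → ℂ) X') → Set (Fin N → X') :=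
    fun q => box fun j => chartDomain g U' (q.2 j) (q.1 j) with hΩ'
  have hΩo' : ∀ q, IsOpen (Ω' q) := fun q => isOpen_box fun j =>
    isOpen_chartDomain h.isOpen' (fun x hx => (h.isHolAt' x hx).continuousAt) _ _
  have hpiece : ∀ q, (((detMeasure s).restrict (box fun _ => U)).map
      (fun x j => f (x j))).restrict (Ω' q) = (detMeasure s').restrict (Ω' q) := by
    rintro ⟨e, e'⟩
    rw [Measure.restrict_map_of_aemeasurable hm (hΩo' _).measurableSet,
      Measure.restrict_restrict' hUo.measurableSet]
    have h1 : (fun (x : Fin N → X) j => f (x j)) ⁻¹' Ω' (e, e') ∩ (box fun _ => U) =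
        box fun j => chartDomain f U (e j) (e' j) := by
      ext x
      refine ⟨fun hx j => ⟨hx.2 j, ?_, (hx.1 j).2.1⟩, fun hx => ⟨fun j => ⟨h.mapsTo (hx j).1,
        (hx j).2.2, ?_⟩, fun j => (hx j).1⟩⟩
      · have := (hx.1 j).2.2
        rwa [h.left_inv _ (hx.2 j)] at this
      · rw [h.left_inv _ (hx j).1]
        exact (hx j).2.1
    have h2 : (box fun j => chartDomain f U (e j) (e' j)) ⊆ tupleSource e :=
      fun x hx j => (hx j).2.1
    have h3 : Ω' (e, e') ⊆ tupleSource e' := fun x hx j => (hx j).2.1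
    rw [h1, ← Measure.restrict_restrict_of_subset h2, detMeasure_restrict hk,
      h.map_localMeasure hk hs e e', ← detMeasure_restrict hk s' e',
      Measure.restrict_restrict_of_subset h3]
  obtain ⟨T, hT, hTu⟩ := TopologicalSpace.isOpen_iUnion_countable Ω' hΩo'
  have hΩu : ⋃ q, Ω' q = box fun _ => U' := by
    ext y
    refine ⟨fun hy j => ?_, fun hy => ?_⟩
    · obtain ⟨q, hq⟩ := mem_iUnion.1 hy
      exact (hq j).1
    · obtain ⟨e', he'⟩ := exists_mem_tupleSource (n := n) y
      obtain ⟨e, he⟩ := exists_mem_tupleSource (n := n) fun j => g (y j)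
      exact mem_iUnion.2 ⟨(e, e'), fun j => ⟨hy j, he' j, he j⟩⟩
  have key := (Measure.restrict_biUnion_congr hT).2 fun q _ => hpiece q
  rw [hTu, hΩu] at key
  have hsub : (box fun _ => U) ⊆ (fun (x : Fin N → X) j => f (x j)) ⁻¹' box fun _ => U' :=
    fun x hx j => h.mapsTo (hx j)
  rw [← key, Measure.restrict_map_of_aemeasurable hm hUo'.measurableSet,
    Measure.restrict_restrict' hUo.measurableSet, inter_eq_right.2 hsub]

end Pushforward

/-! ### Invariance of forms and canonical measures under birational maps -/

section Birational

variable {n N k M M' : ℕ} {X X' : Type*}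
  [TopologicalSpace X] [ChartedSpace (Fin n → ℂ) X] [IsManifold 𝓘(ℂ, Fin n → ℂ) ω X]
  [TopologicalSpace X'] [ChartedSpace (Fin n → ℂ) X'] [IsManifold 𝓘(ℂ, Fin n → ℂ) ω X']
  {emb : X → ℙ ℂ (Fin (M + 1) → ℂ)} {emb' : X' → ℙ ℂ (Fin (M' + 1) → ℂ)}

/-- The source is shrunk to the preimage of `polyNe emb' P'`, which is principal; since `polyNe emb'
P'` lies in the image, `g` becomes a two-sided inverse there. -/
theorem IsBirationalOn.isBihol {f : X → X'} {g : X' → X} {P : MvPolynomial _ ℂ}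
    {p : Fin (M' + 1) → MvPolynomial (Fin (M + 1)) ℂ} {P' : MvPolynomial _ ℂ}
    (hemb : IsProjectiveEmbedding n emb) (hemb' : IsProjectiveEmbedding n emb')
    (h : IsBirationalOn n n emb emb' f g P p P') :
    IsBihol n f g (polyNe emb (P * MvPolynomial.aeval p P')) (polyNe emb' P') := by
  obtain ⟨d, hP⟩ := h.isHomogeneous
  obtain ⟨d₁, hp⟩ := h.isHomogeneous_map
  obtain ⟨d', hP'⟩ := h.isHomogeneous'
  have hiff := fun y => mem_polyNe_mul_aeval_iff (y := y) h.lift Subset.rfl hP'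
  refine ⟨isOpen_polyNe hemb (hP.mul (hP'.aeval _ hp)), isOpen_polyNe hemb' hP',
    fun x hx => h.isHolAt x ((hiff x).1 hx).1, fun y hy => ?_, fun x hx => ((hiff x).1 hx).2,
    fun y hy => ?_, fun x hx => h.left_inv x ((hiff x).1 hx).1, fun y hy => ?_⟩
  all_goals obtain ⟨x, hx, rfl⟩ := h.subset_image hy
  · exact h.isHolAt' x hx
  · rw [h.left_inv x hx]
    exact (hiff x).2 ⟨hx, hy⟩
  · rw [h.left_inv x hx]

variable [ConnectedSpace X] [CompactSpace X] [ConnectedSpace X'] [CompactSpace X']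

theorem RationalMap.IsBirational.plurigenus_le [T2Space X] (hemb : IsProjectiveEmbedding n emb)
    (hemb' : IsProjectiveEmbedding n emb') {F : RationalMap emb emb'} (hF : F.IsBirational)
    (k : ℕ) : plurigenus n X' k ≤ plurigenus n X k := by
  obtain ⟨g, P, p, P', h, -⟩ := hF.exists_isBirationalOn hemb hemb'
  obtain ⟨Φ, hΦ, -⟩ := h.exists_pullback hemb hemb' k
  have := finite_pluricanonicalForms (n := n) (X := X) k
  exact LinearMap.finrank_le_finrank_of_injective hΦ

variable [MeasurableSpace X] [BorelSpace X] [SecondCountableTopology X]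
  [MeasurableSpace X'] [BorelSpace X'] [SecondCountableTopology X']

-- Up to null sets, the domain of `F` and both varieties may be replaced by the open sets between
-- which `F` is biholomorphic.
omit [CompactSpace X] in
theorem RationalMap.pushforward_detMeasure (hk : 1 ≤ k) (hemb : IsProjectiveEmbedding n emb)
    (hemb' : IsProjectiveEmbedding n emb') (F : RationalMap emb emb') {g : X' → X}
    {P : MvPolynomial _ ℂ} {p : Fin (M' + 1) → MvPolynomial (Fin (M + 1)) ℂ}
    {P' : MvPolynomial _ ℂ} (h : IsBirationalOn n n emb emb' F.toFun g P p P')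
    (hPF : polyNe emb P ⊆ F.domain) {s : Fin N → pluricanonicalForms n X k}
    {s' : Fin N → pluricanonicalForms n X' k}
    (hs : ∀ i, IsPullbackOn F.toFun (polyNe emb P) (s i) (s' i)) :
    F.pushforward (detMeasure s) = detMeasure s' ∧ partitionFunction s = partitionFunction s' := by
  obtain ⟨d, hP⟩ := h.isHomogeneous
  obtain ⟨d₁, hp⟩ := h.isHomogeneous_map
  obtain ⟨d', hP'⟩ := h.isHomogeneous'
  have hiff := fun y => mem_polyNe_mul_aeval_iff (y := y) h.lift Subset.rfl hP'
  have hb := h.isBihol hemb hemb'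
  set Q := P * MvPolynomial.aeval p P' with hQdef
  have hQ : Q.IsHomogeneous _ := hP.mul (hP'.aeval _ hp)
  have hQne : (polyNe emb Q).Nonempty := h.nonempty'.elim fun y hy => ⟨g y, hb.mapsTo' hy⟩
  have hQP : polyNe emb Q ⊆ polyNe emb P := fun x hx => ((hiff x).1 hx).1
  have h0 := detMeasure_compl_box_polyNe hk hemb hQ hQne s
  have h0' := detMeasure_compl_box_polyNe hk hemb' hP' h.nonempty' s'
  have hsub : (box fun _ : Fin N => polyNe emb Q) ⊆ {x : Fin N → X | ∀ j, x j ∈ F.domain} :=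
    fun x hx j => hPF (hQP (hx j))
  -- The smaller box already has full measure, so restricting to any larger domain gives the same
  -- push-forward.
  have hset : (box fun _ : Fin N => polyNe emb Q) =ᵐ[detMeasure s]
      {x : Fin N → X | ∀ j, x j ∈ F.domain} :=
    (LE.le.eventuallyLE hsub).antisymm
      (ae_le_set.2 (measure_mono_null (fun x hx => hx.2) h0))
  have heq : F.pushforward (detMeasure s) = detMeasure s' := by
    unfold RationalMap.pushforward
    rw [← Measure.restrict_congr_set hset,
      hb.map_detMeasure hk fun i e e' x hx => hs i e e' x (hQP hx)]
    exact Measure.restrict_eq_self_of_ae_mem (mem_ae_iff.2 h0')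
  refine ⟨heq, ?_⟩
  have hm : AEMeasurable (fun (x : Fin N → X) j => F.toFun (x j))
      ((detMeasure s).restrict {x | ∀ j, x j ∈ F.domain}) :=
    (continuousOn_box fun _ x hx =>
      (F.isHolAt hemb hemb' hx).continuousAt.continuousWithinAt).aemeasurable
      (isOpen_box fun _ => F.isOpen_domain hemb).measurableSet
  unfold partitionFunction
  rw [← heq]
  unfold RationalMap.pushforward
  rw [Measure.map_apply_of_aemeasurable hm MeasurableSet.univ, preimage_univ,
    ← Measure.restrict_congr_set hset]
  exact congrFun (congrArg _ (Measure.restrict_eq_self_of_ae_mem (mem_ae_iff.2 h0)).symm) _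

theorem RationalMap.IsBirational.pushforward_canonicalMeasure (hk : 1 ≤ k) [T2Space X]
    (hemb : IsProjectiveEmbedding n emb) (hemb' : IsProjectiveEmbedding n emb')
    {F : RationalMap emb emb'} (hF : F.IsBirational)
    (s : Module.Basis (Fin N) ℂ (pluricanonicalForms n X k))
    (s' : Module.Basis (Fin N) ℂ (pluricanonicalForms n X' k)) :
    F.pushforward (canonicalMeasure s) = canonicalMeasure s' := by
  obtain ⟨g, P, p, P', h, hPF⟩ := hF.exists_isBirationalOn hemb hemb'
  obtain ⟨Φ, hΦ, hΦs⟩ := h.exists_pullback hemb hemb' k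
  have := finite_pluricanonicalForms (n := n) (X := X) k
  -- The pull-backs of `s'` are independent, and the basis `s` shows that their number is the
  -- dimension; they form a basis `t` on `X`, which may replace `s`.
  have hli : LinearIndependent ℂ fun i => Φ (s' i) :=
    s'.linearIndependent.map' Φ (LinearMap.ker_eq_bot.2 hΦ)
  have hcard : Fintype.card (Fin N) = Module.finrank ℂ (pluricanonicalForms n X k) :=
    (Module.finrank_eq_card_basis s).symm
  set t := basisOfLinearIndependentOfCardEqFinrank' _ hli hcard with ht
  have htΦ : ∀ i, t i = Φ (s' i) := fun i => by simp [ht]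
  obtain ⟨key, hZ⟩ := F.pushforward_detMeasure hk hemb hemb' h hPF (s := t) (s' := s') fun i => by
    rw [htΦ]
    exact hΦs (s' i)
  rw [canonicalMeasure_eq hk s t]
  unfold canonicalMeasure
  rw [← hZ, ← key]
  unfold RationalMap.pushforward
  rw [Measure.restrict_smul, Measure.map_smul]

end Birational

end CanonicalPointProcess

/-! ### The main theorem -/

theorem mainTheorem11
    {n n' M M' : ℕ} {X X' : Type*}
    [TopologicalSpace X] [T2Space X] [CompactSpace X] [ConnectedSpace X]
    [ChartedSpace (Fin n → ℂ) X] [IsManifold 𝓘(ℂ, Fin n → ℂ) ω X]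
    [MeasurableSpace X] [BorelSpace X]
    [TopologicalSpace X'] [T2Space X'] [CompactSpace X'] [ConnectedSpace X']
    [ChartedSpace (Fin n' → ℂ) X'] [IsManifold 𝓘(ℂ, Fin n' → ℂ) ω X']
    [MeasurableSpace X'] [BorelSpace X']
    (emb : X → ℙ ℂ (Fin (M + 1) → ℂ))
    (hemb : CanonicalPointProcess.IsProjectiveEmbedding n emb)
    (emb' : X' → ℙ ℂ (Fin (M' + 1) → ℂ))
    (hemb' : CanonicalPointProcess.IsProjectiveEmbedding n' emb')
    (hX : 0 < CanonicalPointProcess.kodairaDimension n X)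
    (F : CanonicalPointProcess.RationalMap emb emb') (hF : F.IsBirational)
    (k : ℕ) (hk : 1 ≤ k) :
    Module.Finite ℂ (CanonicalPointProcess.pluricanonicalForms n X k) ∧
    Module.Finite ℂ (CanonicalPointProcess.pluricanonicalForms n' X' k) ∧
    CanonicalPointProcess.plurigenus n X k = CanonicalPointProcess.plurigenus n' X' k ∧
    ∀ (s : Module.Basis (Fin (CanonicalPointProcess.plurigenus n X k)) ℂ
          (CanonicalPointProcess.pluricanonicalForms n X k))
      (s' : Module.Basis (Fin (CanonicalPointProcess.plurigenus n X k)) ℂ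
          (CanonicalPointProcess.pluricanonicalForms n' X' k)),
      IsProbabilityMeasure (CanonicalPointProcess.canonicalMeasure s) ∧
      IsProbabilityMeasure (CanonicalPointProcess.canonicalMeasure s') ∧
      F.pushforward (CanonicalPointProcess.canonicalMeasure s) =
        CanonicalPointProcess.canonicalMeasure s' := by
  have : SecondCountableTopology X :=
    ChartedSpace.secondCountable_of_sigmaCompact (Fin n → ℂ) X
  have : SecondCountableTopology X' :=
    ChartedSpace.secondCountable_of_sigmaCompact (Fin n' → ℂ) X'
  obtain ⟨G, hG⟩ := hF.exists_inverse
  -- The dimensions must be identified first, since Jacobian determinants need equal dimensions; `F`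
  -- and its inverse give the two inequalities.
  have hn : n = n' := by
    obtain ⟨g, P, p, P', h, -⟩ := hF.exists_isBirationalOn hemb hemb'
    obtain ⟨g', Q, q, Q', h', -⟩ := hG.exists_isBirationalOn hemb' hemb
    exact (h.dim_le hemb).antisymm (h'.dim_le hemb')
  subst hn
  refine ⟨CanonicalPointProcess.finite_pluricanonicalForms k,
    CanonicalPointProcess.finite_pluricanonicalForms k,
    (hG.plurigenus_le hemb' hemb k).antisymm (hF.plurigenus_le hemb hemb' k), fun s s' => ?_⟩
  exact ⟨CanonicalPointProcess.isProbabilityMeasure_canonicalMeasure hk s,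
    CanonicalPointProcess.isProbabilityMeasure_canonicalMeasure hk s',
    hF.pushforward_canonicalMeasure hk hemb hemb' s s'⟩
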